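/- Let $\mathcal L$ be a first-order language whose relation, function and constant symbols are indexed by natural numbers (distinct symbols of the same kind having distinct indices), and let $\mathcal M$ be an $\mathcal L$-structure whose universe is a subset of $\mathbb R^\infty=\bigcup_n\mathbb R^n$. Suppose that $\mathcal M$ is $\mathbb R$-computable, in the sense of Blum–Shub–Smale machines over $\mathbb R$, by machines all of whose real parameters (the coefficients of the rational functions at computation nodes and of the polynomials at branch nodes) are algebraic over $\mathbb Q$. This means that by such machines the sets of relation, function and constant symbols are decidable over $\mathbb R$, the arities of the symbols are computed, and the atomic diagram of $\mathcal M$ (the set of atomic and negated atomic sentences, with names for the elements of $\mathcal M$, that are true in $\mathcal M$, coded in $\mathbb R^\infty$) is decidable over $\mathbb R$; a subset of $\mathbb R^\infty$ is decidable over $\mathbb R$ if both it and its complement are halting sets of machines over $\mathbb R$. Then there is a substructure $\mathcal M^*$ of $\mathcal M$ such that 1. $\mathcal M^*\leq_1\mathcal M$: for every existential $\mathcal L$-formula $\varphi(\bar x)$ and every tuple $\bar a$ from $\mathcal M^*$, if $\mathcal M\models\varphi(\bar a)$, then $\mathcal M^*\models\varphi(\bar a)$; and 2. $\mathcal M^*$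 is computable in the sense of Turing: the sets of indices of the relation, function and constant symbols and the arity functions are Turing computable, and there is an injective numbering $\nu:\mathcal M^*\to\mathbb N$ under which the atomic diagram of $\mathcal M^*$ becomes a Turing-computable set. -/

import Mathlib

open FirstOrder

universe u v

/-! ### Machines over the real field

`ℝ^∞` is `List ℝ` (finite sequences of reals) and `ℝ_∞` is `ℤ →₀ ℝ` (bi-infinite sequences with
finitely many nonzero entries). -/

/-- A node, other than the input node, of a machine with `n` such nodes, together with the targets
of its outgoing edges.

* `computation S num den next`: the rational map `ℝ_∞ → ℝ_∞` which replaces, simultaneously for all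
  `i ∈ S`, the `i`-th coordinate by `num i / den i`, and leaves all other coordinates unchanged.
* `branch h neg nonneg`: go to `nonneg` if `h ≥ 0` and to `neg` if `h < 0`.
* `shiftLeft`, `shiftRight`: the shifts `σ_l(x)_i = x_{i+1}` and `σ_r(x)_i = x_{i-1}`. -/
inductive BSSNode (n : ℕ) : Type
  | computation (S : Finset ℤ) (num den : ℤ → MvPolynomial ℤ ℝ) (next : Fin n)
  | branch (h : MvPolynomial ℤ ℝ) (neg nonneg : Fin n)
  | shiftLeft (next : Fin n)
  | shiftRight (next : Fin n)
  | output

/-- A machine over `ℝ`: a finite directed graph of nodes. The input node, which has no incoming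
edge and exactly one outgoing edge, is represented by the target `entry` of that edge.
(Connectedness of the graph is not required: the nodes that cannot be reached from the input node
never take part in a computation.) -/
structure BSSMachine where
  size : ℕ
  entry : Fin size
  node : Fin size → BSSNode size

namespace BSSMachine

/-- The input map `ℝ^∞ → ℝ_∞`: the sequence `(x_1, …, x_n)` is written in the coordinates
`1, …, n`, and its length is recorded in unary by ones in the `n` coordinates `0, -1, …, -(n-1)`;
all other coordinates are `0`. -/
noncomputable def inputState (x : List ℝ) : ℤ →₀ ℝ :=
  Finsupp.onFinset (Finset.Icc (-(x.length : ℤ)) x.length)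
    (fun i => if 1 ≤ i then x.getD (i - 1).toNat 0 else if -(x.length : ℤ) < i then 1 else 0)
    (by
      intro i hi
      rw [Finset.mem_Icc]
      by_cases h1 : 1 ≤ i
      · simp only [h1, if_true] at hi
        refine ⟨by omega, ?_⟩
        by_contra hlt
        exact hi (List.getD_eq_default _ _ (by omega))
      · simp only [h1, if_false] at hi
        by_cases h2 : -(x.length : ℤ) < i
        · omega
        · simp [h2] at hi)

/-- The graph of the output map `ℝ_∞ → ℝ^∞`, inverse to the input map: `s` is sent to
`(s_1, …, s_l)`, where `l` is the least natural number with `s_{-l} = 0`. -/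
def IsOutput (s : ℤ →₀ ℝ) (y : List ℝ) : Prop :=
  (∀ i : ℕ, i < y.length → s (-(i : ℤ)) ≠ 0) ∧ s (-(y.length : ℤ)) = 0 ∧
    ∀ i : ℕ, i < y.length → y.getD i 0 = s ((i : ℤ) + 1)

variable (M : BSSMachine)

/-- `M.Step c d`: the configuration `d` (a node and an element of `ℝ_∞`) is the successor of the
configuration `c`. There is no successor at an output node, nor at a computation node whose
rational map is undefined because a denominator vanishes. -/
def Step (c d : Fin M.size × (ℤ →₀ ℝ)) : Prop :=
  match M.node c.1 with
  | .computation S num den next =>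
      d.1 = next ∧
      (∀ i ∈ S, MvPolynomial.eval c.2 (den i) ≠ 0 ∧
        d.2 i = MvPolynomial.eval c.2 (num i) / MvPolynomial.eval c.2 (den i)) ∧
      ∀ i, i ∉ S → d.2 i = c.2 i
  | .branch h neg nonneg =>
      (0 ≤ MvPolynomial.eval c.2 h → d.1 = nonneg) ∧
      (MvPolynomial.eval c.2 h < 0 → d.1 = neg) ∧ d.2 = c.2
  | .shiftLeft next => d.1 = next ∧ ∀ i, d.2 i = c.2 (i + 1)
  | .shiftRight next => d.1 = next ∧ ∀ i, d.2 i = c.2 (i - 1)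
  | .output => False

/-- On input `x`, the machine reaches an output node with the state `s`. -/
def HaltsWith (x : List ℝ) (s : ℤ →₀ ℝ) : Prop :=
  ∃ k : Fin M.size, M.node k = .output ∧
    Relation.ReflTransGen M.Step (M.entry, inputState x) (k, s)

/-- `x` is in the halting set of `M`, that is, `φ_M(x)` is defined. -/
def Halts (x : List ℝ) : Prop := ∃ s, M.HaltsWith x s

/-- `φ_M(x) = y`. -/
def Computes (x y : List ℝ) : Prop := ∃ s, M.HaltsWith x s ∧ IsOutput s y

/-- All real parameters of `M` (the coefficients of the polynomials occurring in its computation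
and branch nodes) belong to `K`. -/
def ParamsIn (K : Set ℝ) : Prop :=
  ∀ k : Fin M.size,
    match M.node k with
    | .computation S num den _ =>
        ∀ i ∈ S, (∀ m ∈ (num i).support, (num i).coeff m ∈ K) ∧
          ∀ m ∈ (den i).support, (den i).coeff m ∈ K
    | .branch h _ _ => ∀ m ∈ h.support, h.coeff m ∈ K
    | _ => True

end BSSMachine

/-- `X ⊆ ℝ^∞` is decidable over `ℝ` by means of machines whose parameters belong to `K`: both `X`
and its complement are halting sets of such machines. For `K = Set.univ` this is decidability
over `ℝ`. -/
def IsRealDecidable (K : Set ℝ) (X : Set (List ℝ)) : Prop :=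
  (∃ M : BSSMachine, M.ParamsIn K ∧ ∀ x, M.Halts x ↔ x ∈ X) ∧
    ∃ M : BSSMachine, M.ParamsIn K ∧ ∀ x, M.Halts x ↔ x ∉ X

/-! ### Languages and atomic diagrams -/

/-- The symbols of `L` are indexed by natural numbers: distinct function symbols have distinct
indices, and so have distinct relation symbols. Constant symbols are the function symbols of
arity `0`. -/
structure SymbolIndexing (L : FirstOrder.Language.{u, v}) where
  funIndex : (Σ n, L.Functions n) → ℕ
  relIndex : (Σ n, L.Relations n) → ℕ
  funIndex_injective : Function.Injective funIndex
  relIndex_injective : Function.Injective relIndex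

/-- Atomic sentences and negated atomic sentences of `L` with names for the elements of `A`.
(A closed term with names for the elements of `A` is an element of `L.Term A`.) -/
inductive Literal (L : FirstOrder.Language.{u, v}) (A : Type*)
  | eq (t₁ t₂ : L.Term A)
  | ne (t₁ t₂ : L.Term A)
  | rel {n : ℕ} (P : L.Relations n) (ts : Fin n → L.Term A)
  | notRel {n : ℕ} (P : L.Relations n) (ts : Fin n → L.Term A)

/-- Truth of a literal in the structure `A`. -/
def Literal.Holds {L : FirstOrder.Language.{u, v}} {A : Type*} [L.Structure A] : Literal L A → Prop
  | .eq t₁ t₂ => t₁.realize id = t₂.realize id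
  | .ne t₁ t₂ => t₁.realize id ≠ t₂.realize id
  | .rel P ts => FirstOrder.Language.Structure.RelMap P fun i => (ts i).realize id
  | .notRel P ts => ¬ FirstOrder.Language.Structure.RelMap P fun i => (ts i).realize id

namespace SymbolIndexing

variable {L : FirstOrder.Language.{u, v}} (c : SymbolIndexing L)

/-- Code of a closed term in prefix notation, as a finite sequence of elements of `R`, where the
element `a` of `A` is presented by the finite sequence `e a`. -/
def encodeTerm {R A : Type*} [Semiring R] (e : A → List R) : L.Term A → List R
  | .var a => 0 :: ((e a).length : R) :: e a
  | .func (l := n) f ts =>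
      1 :: (c.funIndex ⟨n, f⟩ : R) :: (List.ofFn fun i => encodeTerm e (ts i)).flatten

/-- Code of a literal. -/
def encodeLiteral {R A : Type*} [Semiring R] (e : A → List R) : Literal L A → List R
  | .eq t₁ t₂ => 0 :: (c.encodeTerm e t₁ ++ c.encodeTerm e t₂)
  | .ne t₁ t₂ => 1 :: (c.encodeTerm e t₁ ++ c.encodeTerm e t₂)
  | .rel (n := n) P ts =>
      2 :: (c.relIndex ⟨n, P⟩ : R) :: (List.ofFn fun i => c.encodeTerm e (ts i)).flatten
  | .notRel (n := n) P ts =>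
      3 :: (c.relIndex ⟨n, P⟩ : R) :: (List.ofFn fun i => c.encodeTerm e (ts i)).flatten

/-- The atomic diagram of the structure `A`, as a set of codes. -/
def atomicDiagram {R A : Type*} [Semiring R] [L.Structure A] (e : A → List R) : Set (List R) :=
  {w | ∃ φ : Literal L A, φ.Holds ∧ c.encodeLiteral e φ = w}

/-- The language is `ℝ`-computable, by machines with parameters in `K`: the sets of relation
symbols, of function symbols of positive arity and of constant symbols are decidable over `ℝ`, and
machines compute the arity of a relation symbol and of a function symbol. -/
def IsRealComputableLanguage (K : Set ℝ) : Prop :=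
  IsRealDecidable K {x | ∃ P, x = [(c.relIndex P : ℝ)]} ∧
  IsRealDecidable K {x | ∃ f, f.1 ≠ 0 ∧ x = [(c.funIndex f : ℝ)]} ∧
  IsRealDecidable K {x | ∃ f, f.1 = 0 ∧ x = [(c.funIndex f : ℝ)]} ∧
  (∃ M : BSSMachine, M.ParamsIn K ∧ ∀ P, M.Computes [(c.relIndex P : ℝ)] [(P.1 : ℝ)]) ∧
  ∃ M : BSSMachine, M.ParamsIn K ∧ ∀ f, M.Computes [(c.funIndex f : ℝ)] [(f.1 : ℝ)]

/-- The structure with universe `A ⊆ ℝ^∞` is `ℝ`-computable, by machines with parameters in `K`: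
its language is, and its atomic diagram is decidable over `ℝ`. For `K = Set.univ` this is
`ℝ`-computability. -/
def IsRealComputable (K : Set ℝ) (A : Set (List ℝ)) [L.Structure A] : Prop :=
  c.IsRealComputableLanguage K ∧ IsRealDecidable K (c.atomicDiagram (fun a : A => (a : List ℝ)))

/-- The language is computable in the sense of Turing. -/
def IsTuringComputableLanguage : Prop :=
  ComputablePred (fun k : ℕ => ∃ P, c.relIndex P = k) ∧
  ComputablePred (fun k : ℕ => ∃ f, f.1 ≠ 0 ∧ c.funIndex f = k) ∧
  ComputablePred (fun k : ℕ => ∃ f, f.1 = 0 ∧ c.funIndex f = k) ∧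
  (∃ a : ℕ → ℕ, Computable a ∧ ∀ P, a (c.relIndex P) = P.1) ∧
  ∃ a : ℕ → ℕ, Computable a ∧ ∀ f, a (c.funIndex f) = f.1

/-- The structure `B` is computable in the sense of Turing: its language is, and its elements can
be identified with natural numbers in such a way that its atomic diagram is computable. -/
def IsTuringComputable (B : Type*) [L.Structure B] : Prop :=
  c.IsTuringComputableLanguage ∧
    ∃ ν : B → ℕ, Function.Injective ν ∧
      ComputablePred (fun w : List ℕ => w ∈ c.atomicDiagram (fun b : B => [ν b]))

end SymbolIndexing

/-- `S ≤₁ B` for a substructure `S` of `B`: every existential formula with parameters from `S` that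
holds in `B` holds in `S`. -/
def LeOne {L : FirstOrder.Language.{u, v}} {B : Type*} [L.Structure B] (S : L.Substructure B) : Prop :=
  ∀ (n : ℕ) (φ : L.Formula (Fin n)), FirstOrder.Language.BoundedFormula.IsExistential φ →
    ∀ a : Fin n → S, φ.Realize (fun i => (a i : B)) → φ.Realize a

/-! ### Computability toolbox -/

attribute [fun_prop] Computable Primrec
attribute [fun_prop] Computable.id Computable.const Computable.comp Computable.fst Computable.snd
  Computable.pair Primrec.id Primrec.const Primrec.comp Primrec.fst Primrec.snd Primrec.pair

section Toolbox

variable {α β γ σ : Type*} [Primcodable α] [Primcodable β] [Primcodable γ] [Primcodable σ]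

@[fun_prop]
theorem Primrec.comp_nat_add {f g : α → ℕ} (hf : Primrec f) (hg : Primrec g) :
    Primrec fun a => f a + g a := Primrec.nat_add.comp hf hg

@[fun_prop]
theorem Primrec.comp_nat_mul {f g : α → ℕ} (hf : Primrec f) (hg : Primrec g) :
    Primrec fun a => f a * g a := Primrec.nat_mul.comp hf hg

@[fun_prop]
theorem Primrec.comp_decide_lt {f g : α → ℕ} (hf : Primrec f) (hg : Primrec g) :
    Primrec fun a => decide (f a < g a) := Primrec.nat_lt.decide.comp hf hg

@[fun_prop]
theorem Primrec.comp_decide_eq [DecidableEq β] {f g : α → β} (hf : Primrec f) (hg : Primrec g) :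
    Primrec fun a => decide (f a = g a) := Primrec.eq.decide.comp hf hg

@[fun_prop]
theorem Primrec.comp_and {f g : α → Bool} (hf : Primrec f) (hg : Primrec g) :
    Primrec fun a => f a && g a := Primrec.and.comp hf hg

@[fun_prop]
theorem Primrec.comp_length {f : α → List β} (hf : Primrec f) :
    Primrec fun a => (f a).length := Primrec.list_length.comp hf

@[fun_prop]
theorem Computable.comp_decide_lt {f g : α → ℕ} (hf : Computable f) (hg : Computable g) :
    Computable fun a => decide (f a < g a) := Primrec.nat_lt.decide.to_comp.comp hf hg

@[fun_prop]
theorem Computable.comp_decide_eq [DecidableEq β] {f g : α → β} (hf : Computable f)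
    (hg : Computable g) : Computable fun a => decide (f a = g a) :=
  Primrec.eq.decide.to_comp.comp hf hg

@[fun_prop]
theorem Computable.comp_and {f g : α → Bool} (hf : Computable f) (hg : Computable g) :
    Computable fun a => f a && g a := Primrec.and.to_comp.comp hf hg

@[fun_prop]
theorem Computable.comp_or {f g : α → Bool} (hf : Computable f) (hg : Computable g) :
    Computable fun a => f a || g a := Primrec.or.to_comp.comp hf hg

@[fun_prop]
theorem Computable.comp_not {f : α → Bool} (hf : Computable f) :
    Computable fun a => !f a := Primrec.not.to_comp.comp hf

@[fun_prop]
theorem Computable.comp_some {f : α → β} (hf : Computable f) :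
    Computable fun a => some (f a) := Computable.option_some.comp hf

@[fun_prop]
theorem Computable.comp_cons {f : α → β} {g : α → List β} (hf : Computable f)
    (hg : Computable g) : Computable fun a => f a :: g a := Computable.list_cons.comp hf hg

@[fun_prop]
theorem Computable.comp_append {f g : α → List β} (hf : Computable f)
    (hg : Computable g) : Computable fun a => f a ++ g a := Computable.list_append.comp hf hg

@[fun_prop]
theorem Computable.comp_length {f : α → List β} (hf : Computable f) :
    Computable fun a => (f a).length := Computable.list_length.comp hf

@[fun_prop]
theorem Computable.comp_tail {f : α → List β} (hf : Computable f) :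
    Computable fun a => (f a).tail := Primrec.list_tail.to_comp.comp hf

@[fun_prop]
theorem Computable.comp_unpair {f : α → ℕ} (hf : Computable f) :
    Computable fun a => (f a).unpair := Computable.unpair.comp hf

@[fun_prop]
theorem Computable.comp_getD {f : α → List β} {g : α → ℕ} (d : β) (hf : Computable f)
    (hg : Computable g) : Computable fun a => (f a).getD (g a) d :=
  (Primrec.list_getD d).to_comp.comp hf hg

@[fun_prop]
theorem Computable.comp_cond {c : α → Bool} {f g : α → β} (hc : Computable c)
    (hf : Computable f) (hg : Computable g) : Computable fun a => bif c a then f a else g a :=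
  Computable.cond hc hf hg

theorem Computable.list_foldl {f : α → List β} {g : α → σ} {h : α → σ × β → σ}
    (hf : Computable f) (hg : Computable g) (hh : Computable₂ h) :
    Computable fun a => (f a).foldl (fun s b => h a (s, b)) (g a) := by
  have key : ∀ a n, ((f a).take n).foldl (fun s b => h a (s, b)) (g a) =
      Nat.rec (motive := fun _ => σ) (g a)
        (fun y IH => (((f a)[y]?).map fun b => h a (IH, b)).getD IH) n := by
    intro a n
    induction n with
    | zero => simp
    | succ n ih =>
      simp only []
      rw [← ih, List.take_add_one, List.foldl_append]
      cases (f a)[n]? <;> simp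
  have hc : Computable fun a => Nat.rec (motive := fun _ => σ) (g a)
      (fun y IH => (((f a)[y]?).map fun b => h a (IH, b)).getD IH) (f a).length := by
    refine Computable.nat_rec (h := fun a (p : ℕ × σ) =>
      (((f a)[p.1]?).map fun b => h a (p.2, b)).getD p.2) (by fun_prop) hg ?_
    refine Computable.option_getD (Computable.option_map ?_ ?_) (by fun_prop)
    · exact Computable.list_getElem?.comp (by fun_prop) (by fun_prop)
    · exact hh.comp (by fun_prop) (by fun_prop)
  exact hc.of_eq fun a => by rw [← key, List.take_length]

theorem Computable.list_map {f : α → List β} {g : α → β → σ} (hf : Computable f)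
    (hg : Computable₂ g) : Computable fun a => (f a).map (g a) := by
  refine (Computable.list_foldl (g := fun _ => []) (h := fun a (p : List σ × β) => p.1 ++ [g a p.2])
    hf (by fun_prop) ?_).of_eq fun a => ?_
  · have : Computable fun q : α × List σ × β => g q.1 q.2.2 := hg.comp (by fun_prop) (by fun_prop)
    exact Computable.comp_append (f := fun q : α × List σ × β => q.2.1) (by fun_prop)
      (this.comp_cons (by fun_prop))
  · suffices ∀ (l : List β) (acc : List σ),
        l.foldl (fun s b => s ++ [g a b]) acc = acc ++ l.map (g a) by simpa using this (f a) []
    intro l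
    induction l with
    | nil => simp
    | cons b l ih => intro acc; simp [ih]

/-- A function on `Fin n × α` all of whose sections are computable is computable. -/
theorem Computable.fin_uncurry {n : ℕ} {f : Fin n → α → β} (hf : ∀ k, Computable (f k)) :
    Computable fun p : Fin n × α => f p.1 p.2 := by
  refine (Computable.vector_get.comp ((Computable.vector_ofFn hf).comp Computable.snd)
    Computable.fst).of_eq fun p => ?_
  simp

/-- Recursively enumerable predicates, presented as projections of decidable ones. -/
def IsSigmaOne (p : α → Prop) : Prop :=
  ∃ q : α × ℕ → Bool, Computable q ∧ ∀ a, p a ↔ ∃ n, q (a, n) = true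

namespace IsSigmaOne

theorem of_computable {f : α → Bool} (hf : Computable f) : IsSigmaOne fun a => f a = true :=
  ⟨fun x => f x.1, by fun_prop, fun a => by simp⟩

theorem of_eq {p q : α → Prop} (hp : IsSigmaOne p) (h : ∀ a, p a ↔ q a) : IsSigmaOne q :=
  (funext fun a => propext (h a) : p = q) ▸ hp

theorem of_computablePred {p : α → Prop} (hp : ComputablePred p) : IsSigmaOne p := by
  obtain ⟨_, h⟩ := hp
  exact (of_computable h).of_eq fun a => by simp

theorem comp {p : β → Prop} (hp : IsSigmaOne p) {f : α → β} (hf : Computable f) :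
    IsSigmaOne fun a => p (f a) := by
  obtain ⟨q, hq, h⟩ := hp
  exact ⟨fun x => q (f x.1, x.2), by fun_prop, fun a => h (f a)⟩

theorem and {p q : α → Prop} (hp : IsSigmaOne p) (hq : IsSigmaOne q) :
    IsSigmaOne fun a => p a ∧ q a := by
  obtain ⟨p', hp', hp⟩ := hp
  obtain ⟨q', hq', hq⟩ := hq
  refine ⟨fun x => p' (x.1, x.2.unpair.1) && q' (x.1, x.2.unpair.2), by fun_prop, fun a => ?_⟩
  simp only [hp, hq]
  constructor
  · rintro ⟨⟨m, hm⟩, n, hn⟩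
    exact ⟨Nat.pair m n, by simp [hm, hn]⟩
  · rintro ⟨n, hn⟩
    simp only [Bool.and_eq_true] at hn
    exact ⟨⟨_, hn.1⟩, _, hn.2⟩

theorem or {p q : α → Prop} (hp : IsSigmaOne p) (hq : IsSigmaOne q) :
    IsSigmaOne fun a => p a ∨ q a := by
  obtain ⟨p', hp', hp⟩ := hp
  obtain ⟨q', hq', hq⟩ := hq
  refine ⟨fun x => p' x || q' x, by fun_prop, fun a => ?_⟩
  simp only [hp, hq]
  simp [exists_or]

theorem proj {p : α × β → Prop} (hp : IsSigmaOne p) : IsSigmaOne fun a => ∃ b, p (a, b) := by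
  obtain ⟨q, hq, h⟩ := hp
  refine ⟨fun x => ((Encodable.decode (α := β) x.2.unpair.1).map
    fun b => q ((x.1, b), x.2.unpair.2)).getD false, ?_, fun a => ?_⟩
  · refine Computable.option_getD (Computable.option_map ?_ ?_) (by fun_prop)
    · exact Computable.decode.comp (by fun_prop)
    · exact Computable.of_eq (f := fun y : (α × ℕ) × β => q ((y.1.1, y.2), y.1.2.unpair.2))
        (by fun_prop) fun _ => rfl
  · constructor
    · rintro ⟨b, hb⟩
      obtain ⟨n, hn⟩ := (h _).1 hb
      exact ⟨Nat.pair (Encodable.encode b) n, by simp [hn]⟩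
    · rintro ⟨n, hn⟩
      cases hd : Encodable.decode (α := β) n.unpair.1 with
      | none => simp [hd] at hn
      | some b => exact ⟨b, (h _).2 ⟨n.unpair.2, by simpa [hd] using hn⟩⟩

/-- A total recursively enumerable relation contains the graph of a computable function. -/
theorem exists_computable {R : α → β → Prop} (hR : IsSigmaOne fun x : α × β => R x.1 x.2)
    (h : ∀ a, ∃ b, R a b) : ∃ f : α → β, Computable f ∧ ∀ a, R a (f a) := by
  obtain ⟨q, hq, hqR⟩ := hR
  let g : α → ℕ → Option β := fun a n => (Encodable.decode (α := β) n.unpair.1).bind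
    fun b => bif q ((a, b), n.unpair.2) then some b else none
  have hg : Computable₂ g := by
    refine Computable.option_bind ?_ ?_
    · exact Computable.decode.comp (by fun_prop)
    · exact Computable.of_eq (f := fun y : (α × ℕ) × β =>
        bif q ((y.1.1, y.2), y.1.2.unpair.2) then some y.2 else none) (by fun_prop) fun _ => rfl
  have hgR : ∀ a n b, b ∈ g a n → R a b := by
    intro a n b hb
    simp only [g, Option.mem_def, Option.bind_eq_some_iff] at hb
    obtain ⟨b', -, hb'⟩ := hb
    cases hc : q ((a, b'), n.unpair.2) with
    | false => simp [hc] at hb'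
    | true =>
      rw [hc, cond_true, Option.some.injEq] at hb'
      subst hb'
      exact (hqR (a, b')).2 ⟨_, hc⟩
  have hdom : ∀ a, (Nat.rfindOpt (g a)).Dom := by
    intro a
    obtain ⟨b, hb⟩ := h a
    obtain ⟨n, hn⟩ := (hqR (a, b)).1 hb
    exact Nat.rfindOpt_dom.2 ⟨Nat.pair (Encodable.encode b) n, b, by simp [g, hn]⟩
  refine ⟨fun a => (Nat.rfindOpt (g a)).get (hdom a), ?_, fun a => ?_⟩
  · exact (Partrec.rfindOpt hg).of_eq_tot fun a => Part.get_mem _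
  · obtain ⟨n, hn⟩ := Nat.rfindOpt_spec (Part.get_mem (hdom a))
    exact hgR a n _ hn

theorem computablePred {p : α → Prop} (hp : IsSigmaOne p) (hn : IsSigmaOne fun a => ¬ p a) :
    ComputablePred p := by
  classical
  have : IsSigmaOne fun x : α × Bool => (x.2 = true ∧ p x.1) ∨ ((!x.2) = true ∧ ¬ p x.1) :=
    ((of_computable (by fun_prop)).and (hp.comp (by fun_prop))).or
      ((of_computable (by fun_prop)).and (hn.comp (by fun_prop)))
  obtain ⟨f, hf, hfp⟩ := exists_computable
    (R := fun a b => (b = true ∧ p a) ∨ ((!b) = true ∧ ¬ p a)) this fun a => by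
      by_cases h : p a
      · exact ⟨true, by simp [h]⟩
      · exact ⟨false, by simp [h]⟩
  refine ⟨fun a => Classical.dec _, hf.of_eq fun a => ?_⟩
  rcases hfp a with ⟨h1, h2⟩ | ⟨h1, h2⟩
  · simp [h1, h2]
  · simp only [Bool.not_eq_true'] at h1
    simp [h1, h2]

end IsSigmaOne

theorem ComputablePred.comp {p : β → Prop} (hp : ComputablePred p) {f : α → β}
    (hf : Computable f) : ComputablePred fun a => p (f a) := by
  obtain ⟨_, h⟩ := hp
  exact ⟨fun a => inferInstance, h.comp hf⟩

theorem ComputablePred.exists_bool {p : α → Prop} (hp : ComputablePred p) :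
    ∃ f : α → Bool, Computable f ∧ ∀ a, f a = true ↔ p a := by
  obtain ⟨_, h⟩ := hp
  exact ⟨_, h, fun a => by simp⟩

theorem ComputablePred.of_bool {p : α → Prop} {f : α → Bool} (hf : Computable f)
    (h : ∀ a, f a = true ↔ p a) : ComputablePred p := by
  classical
  exact ⟨fun a => Classical.dec _, hf.of_eq fun a => by rw [Bool.eq_iff_iff]; simp [h]⟩

end Toolbox

/-! ### Codes of rational numbers and of rational polynomials -/

/-- Codes of rational numbers: `((a, b), d)` stands for `(a - b) / (d + 1)`. -/
abbrev RatCode := (ℕ × ℕ) × ℕ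

namespace RatCode

/-- The rational number with a given code. -/
def val (a : RatCode) : ℚ := ((a.1.1 : ℚ) - a.1.2) / (a.2 + 1)

def ofNat (n : ℕ) : RatCode := ((n, 0), 0)

def add (a b : RatCode) : RatCode :=
  ((a.1.1 * (b.2 + 1) + b.1.1 * (a.2 + 1), a.1.2 * (b.2 + 1) + b.1.2 * (a.2 + 1)),
    a.2 * b.2 + a.2 + b.2)

def mul (a b : RatCode) : RatCode :=
  ((a.1.1 * b.1.1 + a.1.2 * b.1.2, a.1.1 * b.1.2 + a.1.2 * b.1.1), a.2 * b.2 + a.2 + b.2)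

def neg (a : RatCode) : RatCode := ((a.1.2, a.1.1), a.2)

def posPart (a : RatCode) : RatCode := ((a.1.1, 0), a.2)

def negPart (a : RatCode) : RatCode := ((a.1.2, 0), a.2)

/-- Comparison of the coded rational numbers. -/
def blt (a b : RatCode) : Bool :=
  decide (a.1.1 * (b.2 + 1) + b.1.2 * (a.2 + 1) < b.1.1 * (a.2 + 1) + a.1.2 * (b.2 + 1))

/-- Equality of the coded rational numbers. -/
def beq (a b : RatCode) : Bool :=
  decide (a.1.1 * (b.2 + 1) + b.1.2 * (a.2 + 1) = b.1.1 * (a.2 + 1) + a.1.2 * (b.2 + 1))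

theorem val_surjective : Function.Surjective val := by
  intro q
  refine ⟨((q.num.toNat, (-q.num).toNat), q.den - 1), ?_⟩
  have h1 : ((q.num.toNat : ℚ) - ((-q.num).toNat : ℚ)) = q.num := by
    have : ((q.num.toNat : ℤ) - ((-q.num).toNat : ℤ)) = q.num := by omega
    exact_mod_cast this
  have h2 : ((q.den - 1 : ℕ) : ℚ) + 1 = q.den := by
    have := q.den_pos
    exact_mod_cast (by omega : q.den - 1 + 1 = q.den)
  simp only [val]
  rw [h1, h2, Rat.num_div_den]

@[simp] theorem val_ofNat (n : ℕ) : (ofNat n).val = n := by simp [val, ofNat]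

@[simp] theorem val_add (a b : RatCode) : (a.add b).val = a.val + b.val := by
  have ha : (a.2 : ℚ) + 1 ≠ 0 := by positivity
  have hb : (b.2 : ℚ) + 1 ≠ 0 := by positivity
  have hab : ((a.2 * b.2 + a.2 + b.2 : ℕ) : ℚ) + 1 = (a.2 + 1) * (b.2 + 1) := by push_cast; ring
  simp only [val, add]
  rw [hab]
  push_cast
  field_simp
  ring

@[simp] theorem val_mul (a b : RatCode) : (a.mul b).val = a.val * b.val := by
  have ha : (a.2 : ℚ) + 1 ≠ 0 := by positivity
  have hb : (b.2 : ℚ) + 1 ≠ 0 := by positivity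
  have hab : ((a.2 * b.2 + a.2 + b.2 : ℕ) : ℚ) + 1 = (a.2 + 1) * (b.2 + 1) := by push_cast; ring
  simp only [val, mul]
  rw [hab]
  push_cast
  field_simp
  ring

@[simp] theorem val_neg (a : RatCode) : a.neg.val = -a.val := by
  simp only [val, neg]; ring

theorem val_posPart_sub_negPart (a : RatCode) : a.posPart.val - a.negPart.val = a.val := by
  simp only [val, posPart, negPart]; push_cast; ring

theorem val_posPart_nonneg (a : RatCode) : 0 ≤ a.posPart.val := by
  simp only [val, posPart]; push_cast; rw [sub_zero]; positivity

theorem val_negPart_nonneg (a : RatCode) : 0 ≤ a.negPart.val := by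
  simp only [val, negPart]; push_cast; rw [sub_zero]; positivity

@[simp] theorem blt_iff (a b : RatCode) : a.blt b = true ↔ a.val < b.val := by
  have ha : (0 : ℚ) < (a.2 : ℚ) + 1 := by positivity
  have hb : (0 : ℚ) < (b.2 : ℚ) + 1 := by positivity
  simp only [blt, val, decide_eq_true_eq]
  rw [div_lt_div_iff₀ ha hb, ← Nat.cast_lt (α := ℚ)]
  push_cast
  constructor <;> intro h <;> linarith

@[simp] theorem beq_iff (a b : RatCode) : a.beq b = true ↔ a.val = b.val := by
  have ha : (a.2 : ℚ) + 1 ≠ 0 := by positivity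
  have hb : (b.2 : ℚ) + 1 ≠ 0 := by positivity
  simp only [beq, val, decide_eq_true_eq]
  rw [div_eq_div_iff ha hb, ← Nat.cast_inj (R := ℚ)]
  push_cast
  constructor <;> intro h <;> linarith

section Primrec

variable {α : Type*} [Primcodable α] {f g : α → RatCode}

@[fun_prop] theorem primrec_ofNat {f : α → ℕ} (hf : Primrec f) : Primrec fun a => ofNat (f a) := by
  unfold ofNat; fun_prop

@[fun_prop] theorem primrec_add (hf : Primrec f) (hg : Primrec g) :
    Primrec fun a => (f a).add (g a) := by unfold add; fun_prop

@[fun_prop] theorem primrec_mul (hf : Primrec f) (hg : Primrec g) :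
    Primrec fun a => (f a).mul (g a) := by unfold mul; fun_prop

@[fun_prop] theorem primrec_neg (hf : Primrec f) : Primrec fun a => (f a).neg := by
  unfold neg; fun_prop

@[fun_prop] theorem primrec_posPart (hf : Primrec f) : Primrec fun a => (f a).posPart := by
  unfold posPart; fun_prop

@[fun_prop] theorem primrec_negPart (hf : Primrec f) : Primrec fun a => (f a).negPart := by
  unfold negPart; fun_prop

@[fun_prop] theorem primrec_blt (hf : Primrec f) (hg : Primrec g) :
    Primrec fun a => (f a).blt (g a) := by unfold blt; fun_prop

@[fun_prop] theorem primrec_beq (hf : Primrec f) (hg : Primrec g) :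
    Primrec fun a => (f a).beq (g a) := by unfold beq; fun_prop

end Primrec

end RatCode

/-- Codes of rational polynomials: lists of coefficients, lowest degree first. -/
abbrev PolyCode := List RatCode

namespace PolyCode

open Polynomial

/-- The polynomial with a given code. -/
noncomputable def val (p : PolyCode) : ℚ[X] := p.foldr (fun c q => C c.val + X * q) 0

/-- Horner evaluation of a polynomial and of its derivative. -/
def hornerPair (p : PolyCode) (x : RatCode) : RatCode × RatCode :=
  p.foldr (fun c s => (c.add (x.mul s.1), s.1.add (x.mul s.2))) (RatCode.ofNat 0, RatCode.ofNat 0)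

def horner (p : PolyCode) (x : RatCode) : RatCode := (p.hornerPair x).1

def hornerDeriv (p : PolyCode) (x : RatCode) : RatCode := (p.hornerPair x).2

def posPart (p : PolyCode) : PolyCode := p.map RatCode.posPart

def negPart (p : PolyCode) : PolyCode := p.map RatCode.negPart

@[simp] theorem val_nil : val [] = 0 := rfl

@[simp] theorem val_cons (c : RatCode) (p : PolyCode) : val (c :: p) = C c.val + X * val p := rfl

theorem val_surjective : Function.Surjective val := by
  intro q
  induction q using Polynomial.recOnHorner with
  | M0 => exact ⟨[], rfl⟩
  | MC q a _ _ ih =>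
    obtain ⟨p, rfl⟩ := ih
    obtain ⟨c, rfl⟩ := RatCode.val_surjective a
    rcases p with - | ⟨d, p⟩
    · exact ⟨[c], by simp⟩
    · exact ⟨d.add c :: p, by simp; ring⟩
  | MX q _ ih =>
    obtain ⟨p, rfl⟩ := ih
    exact ⟨RatCode.ofNat 0 :: p, by simp [mul_comm]⟩

theorem natDegree_val_le (p : PolyCode) : p.val.natDegree ≤ p.length := by
  induction p with
  | nil => simp
  | cons c p ih =>
    rw [val_cons, natDegree_C_add, List.length_cons]
    exact natDegree_mul_le.trans (by rw [natDegree_X]; omega)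

theorem val_hornerPair (p : PolyCode) (x : RatCode) :
    (p.hornerPair x).1.val = p.val.eval x.val ∧
      (p.hornerPair x).2.val = (derivative p.val).eval x.val := by
  induction p with
  | nil => simp [hornerPair]
  | cons c p ih =>
    have : hornerPair (c :: p) x = (c.add (x.mul (hornerPair p x).1),
      (hornerPair p x).1.add (x.mul (hornerPair p x).2)) := rfl
    rw [this]
    simp [ih.1, ih.2]

@[simp] theorem val_horner (p : PolyCode) (x : RatCode) :
    (p.horner x).val = p.val.eval x.val := (val_hornerPair p x).1

@[simp] theorem val_hornerDeriv (p : PolyCode) (x : RatCode) :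
    (p.hornerDeriv x).val = (derivative p.val).eval x.val := (val_hornerPair p x).2

theorem val_posPart_sub_negPart (p : PolyCode) : p.posPart.val - p.negPart.val = p.val := by
  induction p with
  | nil => simp [posPart, negPart]
  | cons c p ih =>
    simp only [posPart, negPart, List.map_cons, val_cons] at ih ⊢
    rw [← ih, ← c.val_posPart_sub_negPart, C_sub]
    ring

/-- The rational polynomial `p` has nonnegative coefficients. -/
def Nonneg (p : ℚ[X]) : Prop := ∀ i, 0 ≤ p.coeff i

theorem nonneg_C_add_X_mul {a : ℚ} {p : ℚ[X]} (ha : 0 ≤ a) (hp : Nonneg p) :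
    Nonneg (C a + X * p) := by
  rintro (- | i)
  · simpa
  · simpa [coeff_C] using hp i

theorem nonneg_posPart (p : PolyCode) : Nonneg p.posPart.val := by
  induction p with
  | nil => intro i; simp [posPart]
  | cons c p ih => exact nonneg_C_add_X_mul c.val_posPart_nonneg ih

theorem nonneg_negPart (p : PolyCode) : Nonneg p.negPart.val := by
  induction p with
  | nil => intro i; simp [negPart]
  | cons c p ih => exact nonneg_C_add_X_mul c.val_negPart_nonneg ih

theorem Nonneg.derivative {p : ℚ[X]} (hp : Nonneg p) : Nonneg (derivative p) := by
  intro i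
  rw [coeff_derivative]
  exact mul_nonneg (hp _) (by positivity)

theorem Nonneg.aeval_le {p : ℚ[X]} (hp : Nonneg p) {x y : ℝ} (hx : 0 ≤ x) (hxy : x ≤ y) :
    aeval x p ≤ aeval y p := by
  rw [aeval_eq_sum_range, aeval_eq_sum_range]
  refine Finset.sum_le_sum fun i _ => ?_
  rw [Algebra.smul_def, Algebra.smul_def]
  have : (0 : ℝ) ≤ algebraMap ℚ ℝ (p.coeff i) := by simpa using hp i
  gcongr

/-- Lower bound of `p` on the interval `[l, u]` of nonnegative rationals. -/
def lower (p : PolyCode) (l u : RatCode) : RatCode :=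
  (p.posPart.horner l).add (p.negPart.horner u).neg

/-- Upper bound of `p` on the interval `[l, u]` of nonnegative rationals. -/
def upper (p : PolyCode) (l u : RatCode) : RatCode := p.lower u l

/-- Lower bound of the derivative of `p` on the interval `[l, u]` of nonnegative rationals. -/
def lowerDeriv (p : PolyCode) (l u : RatCode) : RatCode :=
  (p.posPart.hornerDeriv l).add (p.negPart.hornerDeriv u).neg

theorem aeval_ratCast (p : ℚ[X]) (x : ℚ) : aeval (x : ℝ) p = (p.eval x : ℚ) := by
  have := aeval_algebraMap_apply (A := ℚ) ℝ x p
  simpa using this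

theorem lower_le (p : PolyCode) {l u : RatCode} (hl : 0 ≤ l.val) {x : ℝ} (hlx : (l.val : ℝ) ≤ x)
    (hxu : x ≤ u.val) : ((p.lower l u).val : ℝ) ≤ aeval x p.val := by
  have hl' : (0 : ℝ) ≤ l.val := by exact_mod_cast hl
  have h1 := (nonneg_posPart p).aeval_le hl' hlx
  have h2 := (nonneg_negPart p).aeval_le (hl'.trans hlx) hxu
  rw [aeval_ratCast] at h1 h2
  rw [← val_posPart_sub_negPart p, map_sub]
  simp only [lower, RatCode.val_add, val_horner, RatCode.val_neg]
  push_cast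
  linarith

theorem le_upper (p : PolyCode) {l u : RatCode} (hl : 0 ≤ l.val) {x : ℝ} (hlx : (l.val : ℝ) ≤ x)
    (hxu : x ≤ u.val) : aeval x p.val ≤ ((p.upper l u).val : ℝ) := by
  have hl' : (0 : ℝ) ≤ l.val := by exact_mod_cast hl
  have h1 := (nonneg_negPart p).aeval_le hl' hlx
  have h2 := (nonneg_posPart p).aeval_le (hl'.trans hlx) hxu
  rw [aeval_ratCast] at h1 h2
  rw [← val_posPart_sub_negPart p, map_sub]
  simp only [upper, lower, RatCode.val_add, val_horner, RatCode.val_neg]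
  push_cast
  linarith

theorem lowerDeriv_le (p : PolyCode) {l u : RatCode} (hl : 0 ≤ l.val) {x : ℝ}
    (hlx : (l.val : ℝ) ≤ x) (hxu : x ≤ u.val) :
    ((p.lowerDeriv l u).val : ℝ) ≤ aeval x (derivative p.val) := by
  have hl' : (0 : ℝ) ≤ l.val := by exact_mod_cast hl
  have h1 := (nonneg_posPart p).derivative.aeval_le hl' hlx
  have h2 := (nonneg_negPart p).derivative.aeval_le (hl'.trans hlx) hxu
  rw [aeval_ratCast] at h1 h2
  rw [← val_posPart_sub_negPart p, map_sub, map_sub]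
  simp only [lowerDeriv, RatCode.val_add, val_hornerDeriv, RatCode.val_neg]
  push_cast
  linarith

open Filter Topology in
theorem eventually_lower (p : PolyCode) {x y : ℝ} (h : y < aeval x p.val) :
    ∀ᶠ z : ℝ × ℝ in 𝓝 x ×ˢ 𝓝 x, ∀ l u : RatCode, (l.val : ℝ) = z.1 → (u.val : ℝ) = z.2 →
      y < (p.lower l u).val := by
  have hc : Tendsto (fun z : ℝ × ℝ => aeval z.1 p.posPart.val - aeval z.2 p.negPart.val)
      (𝓝 x ×ˢ 𝓝 x) (𝓝 (aeval x p.val)) := by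
    rw [← val_posPart_sub_negPart p, map_sub]
    exact (((Polynomial.continuous_aeval _).tendsto x).comp tendsto_fst).sub
      (((Polynomial.continuous_aeval _).tendsto x).comp tendsto_snd)
  filter_upwards [hc.eventually (lt_mem_nhds h)] with z hz l u hl hu
  rw [← hl, ← hu, aeval_ratCast, aeval_ratCast] at hz
  simp only [lower, RatCode.val_add, val_horner, RatCode.val_neg]
  push_cast
  linarith

open Filter Topology in
theorem eventually_upper (p : PolyCode) {x y : ℝ} (h : aeval x p.val < y) :
    ∀ᶠ z : ℝ × ℝ in 𝓝 x ×ˢ 𝓝 x, ∀ l u : RatCode, (l.val : ℝ) = z.1 → (u.val : ℝ) = z.2 →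
      ((p.upper l u).val : ℝ) < y := by
  have hc : Tendsto (fun z : ℝ × ℝ => aeval z.2 p.posPart.val - aeval z.1 p.negPart.val)
      (𝓝 x ×ˢ 𝓝 x) (𝓝 (aeval x p.val)) := by
    rw [← val_posPart_sub_negPart p, map_sub]
    exact (((Polynomial.continuous_aeval _).tendsto x).comp tendsto_snd).sub
      (((Polynomial.continuous_aeval _).tendsto x).comp tendsto_fst)
  filter_upwards [hc.eventually (gt_mem_nhds h)] with z hz l u hl hu
  rw [← hl, ← hu, aeval_ratCast, aeval_ratCast] at hz
  simp only [upper, lower, RatCode.val_add, val_horner, RatCode.val_neg]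
  push_cast
  linarith

open Filter Topology in
theorem eventually_lowerDeriv (p : PolyCode) {x y : ℝ} (h : y < aeval x (derivative p.val)) :
    ∀ᶠ z : ℝ × ℝ in 𝓝 x ×ˢ 𝓝 x, ∀ l u : RatCode, (l.val : ℝ) = z.1 → (u.val : ℝ) = z.2 →
      y < (p.lowerDeriv l u).val := by
  have hc : Tendsto (fun z : ℝ × ℝ => aeval z.1 (derivative p.posPart.val) -
      aeval z.2 (derivative p.negPart.val)) (𝓝 x ×ˢ 𝓝 x) (𝓝 (aeval x (derivative p.val))) := by
    rw [← val_posPart_sub_negPart p, map_sub, map_sub]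
    exact (((Polynomial.continuous_aeval _).tendsto x).comp tendsto_fst).sub
      (((Polynomial.continuous_aeval _).tendsto x).comp tendsto_snd)
  filter_upwards [hc.eventually (lt_mem_nhds h)] with z hz l u hl hu
  rw [← hl, ← hu, aeval_ratCast, aeval_ratCast] at hz
  simp only [lowerDeriv, RatCode.val_add, val_hornerDeriv, RatCode.val_neg]
  push_cast
  linarith

/-- A polynomial identity is checked by finitely many evaluations. -/
theorem eq_zero_of_eval_nat {p : ℚ[X]} {N : ℕ} (hN : p.natDegree < N)
    (h : ∀ i < N, p.eval (i : ℚ) = 0) : p = 0 := by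
  refine eq_zero_of_natDegree_lt_card_of_eval_eq_zero' p
    ((Finset.range N).image (Nat.cast : ℕ → ℚ)) ?_ ?_
  · simpa using h
  · rwa [Finset.card_image_of_injective _ Nat.cast_injective, Finset.card_range]

section Primrec

variable {α : Type*} [Primcodable α] {f : α → PolyCode} {g g' : α → RatCode}

@[fun_prop] theorem primrec_hornerPair (hf : Primrec f) (hg : Primrec g) :
    Primrec fun a => (f a).hornerPair (g a) := by
  refine Primrec.list_foldr (h := fun a (s : RatCode × RatCode × RatCode) =>
    (s.1.add ((g a).mul s.2.1), s.2.1.add ((g a).mul s.2.2))) hf (Primrec.const _) ?_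
  unfold Primrec₂
  fun_prop

@[fun_prop] theorem primrec_horner (hf : Primrec f) (hg : Primrec g) :
    Primrec fun a => (f a).horner (g a) := by unfold horner; fun_prop

@[fun_prop] theorem primrec_hornerDeriv (hf : Primrec f) (hg : Primrec g) :
    Primrec fun a => (f a).hornerDeriv (g a) := by unfold hornerDeriv; fun_prop

@[fun_prop] theorem primrec_posPart (hf : Primrec f) : Primrec fun a => (f a).posPart := by
  refine Primrec.list_map hf ?_
  unfold Primrec₂
  fun_prop

@[fun_prop] theorem primrec_negPart (hf : Primrec f) : Primrec fun a => (f a).negPart := by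
  refine Primrec.list_map hf ?_
  unfold Primrec₂
  fun_prop

@[fun_prop] theorem primrec_lower (hf : Primrec f) (hg : Primrec g) (hg' : Primrec g') :
    Primrec fun a => (f a).lower (g a) (g' a) := by unfold lower; fun_prop

@[fun_prop] theorem primrec_upper (hf : Primrec f) (hg : Primrec g) (hg' : Primrec g') :
    Primrec fun a => (f a).upper (g a) (g' a) := by unfold upper; fun_prop

@[fun_prop] theorem primrec_lowerDeriv (hf : Primrec f) (hg : Primrec g) (hg' : Primrec g') :
    Primrec fun a => (f a).lowerDeriv (g a) (g' a) := by unfold lowerDeriv; fun_prop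

end Primrec

end PolyCode

theorem Primrec.all_range {α : Type*} [Primcodable α] {N : α → ℕ} {f : α → ℕ → Bool}
    (hN : Primrec N) (hf : Primrec fun x : α × ℕ => f x.1 x.2) :
    Primrec fun a => (List.range (N a)).all (f a) := by
  refine (Primrec.list_foldr (h := fun a (s : ℕ × Bool) => f a s.1 && s.2)
    (Primrec.list_range.comp hN) (Primrec.const true) ?_).of_eq fun a => ?_
  · exact Primrec.comp_and (f := fun x : α × ℕ × Bool => f x.1 x.2.1)
      (hf.comp (by fun_prop : Primrec fun x : α × ℕ × Bool => (x.1, x.2.1))) (by fun_prop)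
  · induction List.range (N a) with
    | nil => rfl
    | cons b l ih => simp [ih]

section

@[fun_prop]
theorem Primrec.comp_not {α : Type*} [Primcodable α] {f : α → Bool} (hf : Primrec f) :
    Primrec fun a => !f a := Primrec.not.comp hf

open Polynomial Filter Topology

/-- Code of a positive real algebraic number: a polynomial and an isolating interval. -/
abbrev RootCode := PolyCode × RatCode × RatCode

namespace RootCode

/-- The interval `[l, u]` lies in the isolating interval of `c`, and the polynomial changes sign on
it. -/
def refines (c : RootCode) (l u : RatCode) : Bool :=
  (!l.blt c.2.1) && (!c.2.2.blt u) && l.blt u && (c.1.horner l).blt (RatCode.ofNat 0) &&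
    (RatCode.ofNat 0).blt (c.1.horner u)

/-- A decidable condition which ensures that the interval isolates a simple root. -/
def valid (c : RootCode) : Bool :=
  (!c.2.1.blt (RatCode.ofNat 0)) && (RatCode.ofNat 0).blt (c.1.lowerDeriv c.2.1 c.2.2) &&
    c.refines c.2.1 c.2.2

theorem refines_iff (c : RootCode) (l u : RatCode) : c.refines l u = true ↔
    c.2.1.val ≤ l.val ∧ u.val ≤ c.2.2.val ∧ l.val < u.val ∧ c.1.val.eval l.val < 0 ∧
      0 < c.1.val.eval u.val := by
  simp only [refines, Bool.and_eq_true, Bool.not_eq_true', RatCode.blt_iff, PolyCode.val_horner,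
    RatCode.val_ofNat, Nat.cast_zero, ← Bool.not_eq_true, not_lt, and_assoc]

theorem valid_iff (c : RootCode) : c.valid = true ↔
    0 ≤ c.2.1.val ∧ 0 < (c.1.lowerDeriv c.2.1 c.2.2).val ∧ c.refines c.2.1 c.2.2 = true := by
  simp only [valid, Bool.and_eq_true, Bool.not_eq_true', RatCode.blt_iff,
    RatCode.val_ofNat, Nat.cast_zero, ← Bool.not_eq_true, not_lt, and_assoc]

@[fun_prop] theorem primrec_refines {α : Type*} [Primcodable α] {c : α → RootCode}
    {l u : α → RatCode} (hc : Primrec c) (hl : Primrec l) (hu : Primrec u) :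
    Primrec fun a => (c a).refines (l a) (u a) := by unfold refines; fun_prop

@[fun_prop] theorem primrec_valid {α : Type*} [Primcodable α] {c : α → RootCode}
    (hc : Primrec c) : Primrec fun a => (c a).valid := by unfold valid; fun_prop

/-- `x` is the real number with the code `c`. -/
def IsRoot (c : RootCode) (x : ℝ) : Prop :=
  c.valid = true ∧ c.2.1.val < x ∧ x < c.2.2.val ∧ aeval x c.1.val = 0

theorem strictMonoOn_aeval {p : PolyCode} {l u : RatCode} (hl : 0 ≤ l.val)
    (h : 0 < (p.lowerDeriv l u).val) :
    StrictMonoOn (fun x : ℝ => aeval x p.val) (Set.Icc (l.val : ℝ) u.val) := by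
  refine strictMonoOn_of_deriv_pos (convex_Icc _ _) (Polynomial.continuous_aeval _).continuousOn ?_
  intro x hx
  rw [interior_Icc] at hx
  rw [Polynomial.deriv_aeval]
  have := PolyCode.lowerDeriv_le p hl hx.1.le hx.2.le
  have h' : (0 : ℝ) < (p.lowerDeriv l u).val := by exact_mod_cast h
  linarith

theorem strictMonoOn_of_valid {c : RootCode} (hc : c.valid = true) :
    StrictMonoOn (fun x : ℝ => aeval x c.1.val) (Set.Icc (c.2.1.val : ℝ) c.2.2.val) :=
  strictMonoOn_aeval ((valid_iff c).1 hc).1 ((valid_iff c).1 hc).2.1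

theorem IsRoot.unique {c : RootCode} {x y : ℝ} (hx : c.IsRoot x) (hy : c.IsRoot y) : x = y :=
  (strictMonoOn_of_valid hx.1).injOn ⟨hx.2.1.le, hx.2.2.1.le⟩ ⟨hy.2.1.le, hy.2.2.1.le⟩
    (by simp only [hx.2.2.2, hy.2.2.2])

theorem exists_isRoot {c : RootCode} (hc : c.valid = true) : ∃ x, c.IsRoot x := by
  obtain ⟨-, h, h0, h1⟩ := ((refines_iff _ _ _).1 ((valid_iff c).1 hc).2.2).2
  have h' : (c.2.1.val : ℝ) ≤ c.2.2.val := by exact_mod_cast h.le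
  have := intermediate_value_Ioo h' (f := fun x : ℝ => aeval x c.1.val)
    (Polynomial.continuous_aeval _).continuousOn
  obtain ⟨x, hx, hx0⟩ := this (a := 0) ⟨by
    simp only [PolyCode.aeval_ratCast]; exact_mod_cast h0, by
    simp only [PolyCode.aeval_ratCast]; exact_mod_cast h1⟩
  exact ⟨x, hc, hx.1, hx.2, hx0⟩

theorem IsRoot.mem_of_refines {c : RootCode} {x : ℝ} (hx : c.IsRoot x) {l u : RatCode}
    (h : c.refines l u = true) : (l.val : ℝ) < x ∧ x < u.val := by
  obtain ⟨h1, h2, h3, h4, h5⟩ := (refines_iff _ _ _).1 h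
  have h1' : (c.2.1.val : ℝ) ≤ l.val := by exact_mod_cast h1
  have h2' : (u.val : ℝ) ≤ c.2.2.val := by exact_mod_cast h2
  have h3' : (l.val : ℝ) < u.val := by exact_mod_cast h3
  have hm := strictMonoOn_of_valid hx.1
  have hxm : x ∈ Set.Icc (c.2.1.val : ℝ) c.2.2.val := ⟨hx.2.1.le, hx.2.2.1.le⟩
  constructor
  · refine (hm.lt_iff_lt ⟨h1', h3'.le.trans h2'⟩ hxm).1 ?_
    simp only [hx.2.2.2, PolyCode.aeval_ratCast]
    exact_mod_cast h4
  · refine (hm.lt_iff_lt hxm ⟨h1'.trans h3'.le, h2'⟩).1 ?_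
    simp only [hx.2.2.2, PolyCode.aeval_ratCast]
    exact_mod_cast h5

theorem exists_ratCode_near {x : ℝ} {P : ℝ × ℝ → Prop} (h : ∀ᶠ z in 𝓝 x ×ˢ 𝓝 x, P z) :
    ∃ l u : RatCode, (l.val : ℝ) < x ∧ x < u.val ∧ P (l.val, u.val) := by
  obtain ⟨pa, ha, pb, hb, hab⟩ := eventually_prod_iff.1 h
  obtain ⟨ε, hε, hpa⟩ := Metric.eventually_nhds_iff.1 ha
  obtain ⟨δ, hδ, hpb⟩ := Metric.eventually_nhds_iff.1 hb
  obtain ⟨l, hl1, hl2⟩ := exists_rat_btwn (show x - ε < x by linarith)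
  obtain ⟨u, hu1, hu2⟩ := exists_rat_btwn (show x < x + δ by linarith)
  obtain ⟨l, rfl⟩ := RatCode.val_surjective l
  obtain ⟨u, rfl⟩ := RatCode.val_surjective u
  refine ⟨l, u, hl2, hu1, hab (hpa ?_) (hpb ?_)⟩
  · rw [Real.dist_eq, abs_lt]; constructor <;> linarith
  · rw [Real.dist_eq, abs_lt]; constructor <;> linarith

theorem IsRoot.exists_refines {c : RootCode} {x : ℝ} (hx : c.IsRoot x) {P : ℝ × ℝ → Prop}
    (h : ∀ᶠ z in 𝓝 x ×ˢ 𝓝 x, P z) :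
    ∃ l u : RatCode, c.refines l u = true ∧ P (l.val, u.val) := by
  have h1 : ∀ᶠ z : ℝ × ℝ in 𝓝 x ×ˢ 𝓝 x, (c.2.1.val : ℝ) < z.1 ∧ z.2 < c.2.2.val :=
    (lt_mem_nhds hx.2.1).prod_mk (gt_mem_nhds hx.2.2.1)
  obtain ⟨l, u, hl, hu, ⟨hcl, hcu⟩, hP⟩ := exists_ratCode_near (h1.and h)
  replace hcl : (c.2.1.val : ℝ) < l.val := hcl
  replace hcu : (u.val : ℝ) < c.2.2.val := hcu
  refine ⟨l, u, (refines_iff _ _ _).2 ⟨by exact_mod_cast hcl.le, by exact_mod_cast hcu.le,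
    by exact_mod_cast hl.trans hu, ?_, ?_⟩, hP⟩
  · have := strictMonoOn_of_valid hx.1 ⟨hcl.le, (hl.trans hx.2.2.1).le⟩
      ⟨hx.2.1.le, hx.2.2.1.le⟩ hl
    simp only [hx.2.2.2, PolyCode.aeval_ratCast] at this
    exact_mod_cast this
  · have := strictMonoOn_of_valid hx.1 ⟨hx.2.1.le, hx.2.2.1.le⟩
      ⟨(hx.2.1.trans hu).le, hcu.le⟩ hu
    simp only [hx.2.2.2, PolyCode.aeval_ratCast] at this
    exact_mod_cast this

theorem exists_code {p : ℚ[X]} {x : ℝ} (hx : 0 < x) (h0 : aeval x p = 0)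
    (h1 : 0 < aeval x (derivative p)) : ∃ c : RootCode, c.1.val = p ∧ c.IsRoot x := by
  obtain ⟨p, rfl⟩ := PolyCode.val_surjective p
  have h2 : ∀ᶠ z : ℝ × ℝ in 𝓝 x ×ˢ 𝓝 x, 0 < z.1 ∧ True :=
    (lt_mem_nhds hx).prod_mk Filter.univ_mem
  obtain ⟨l, u, hl, hu, ⟨hl0, -⟩, hd⟩ :=
    exists_ratCode_near (h2.and (PolyCode.eventually_lowerDeriv p h1))
  replace hl0 : (0 : ℝ) < l.val := hl0
  have hl0' : 0 < l.val := by exact_mod_cast hl0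
  have hd' : 0 < (p.lowerDeriv l u).val := by exact_mod_cast hd l u rfl rfl
  have hm := strictMonoOn_aeval hl0'.le hd'
  refine ⟨(p, l, u), rfl, (valid_iff _).2 ⟨hl0'.le, hd', (refines_iff _ _ _).2 ⟨le_rfl, le_rfl,
    by exact_mod_cast hl.trans hu, ?_, ?_⟩⟩, hl, hu, h0⟩
  · have := hm ⟨le_rfl, (hl.trans hu).le⟩ ⟨hl.le, hu.le⟩ hl
    simp only [h0, PolyCode.aeval_ratCast] at this
    exact_mod_cast this
  · have := hm ⟨hl.le, hu.le⟩ ⟨(hl.trans hu).le, le_rfl⟩ hu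
    simp only [h0, PolyCode.aeval_ratCast] at this
    exact_mod_cast this

/-- A positive algebraic number has a code whose polynomial generates its vanishing ideal. -/
theorem exists_code_dvd {x : ℝ} (hx : 0 < x) (hxa : IsAlgebraic ℚ x) :
    ∃ c : RootCode, c.IsRoot x ∧ ∀ q : ℚ[X], aeval x q = 0 → c.1.val ∣ q := by
  have hi := hxa.isIntegral
  have hd : aeval x (derivative (minpoly ℚ x)) ≠ 0 :=
    (minpoly.irreducible hi).separable.aeval_derivative_ne_zero (minpoly.aeval ℚ x)
  rcases lt_or_gt_of_ne hd with h | h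
  · obtain ⟨c, hc, hcx⟩ := exists_code (p := -minpoly ℚ x) hx (by simp) (by simpa using h)
    exact ⟨c, hcx, fun q hq => by rw [hc, neg_dvd]; exact minpoly.dvd ℚ x hq⟩
  · obtain ⟨c, hc, hcx⟩ := exists_code (p := minpoly ℚ x) hx (by simp) h
    exact ⟨c, hcx, fun q hq => by rw [hc]; exact minpoly.dvd ℚ x hq⟩

/-- Certificate for the fact that the number `a` with `a + n` coded by `c` is the value of `D` at
the number coded by `t`. -/
def check (t : RootCode) (c : RootCode × ℕ) (D : PolyCode) (w : PolyCode × RatCode × RatCode) :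
    Bool :=
  t.refines w.2.1 w.2.2 &&
  c.1.2.1.blt ((D.lower w.2.1 w.2.2).add (RatCode.ofNat c.2)) &&
  ((D.upper w.2.1 w.2.2).add (RatCode.ofNat c.2)).blt c.1.2.2 &&
  (List.range (c.1.1.length * D.length + (t.1.length + w.1.length) + 1)).all fun i =>
    (c.1.1.horner ((D.horner (RatCode.ofNat i)).add (RatCode.ofNat c.2))).beq
      ((t.1.horner (RatCode.ofNat i)).mul (w.1.horner (RatCode.ofNat i)))

theorem check_sound {t : RootCode} {c : RootCode × ℕ} {D : PolyCode}
    {w : PolyCode × RatCode × RatCode} {x : ℝ} (hx : t.IsRoot x) (hc : c.1.valid = true)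
    (h : check t c D w = true) : c.1.IsRoot (aeval x D.val + c.2) := by
  simp only [check, Bool.and_eq_true, RatCode.blt_iff, RatCode.val_add, RatCode.val_ofNat,
    List.all_eq_true, List.mem_range, RatCode.beq_iff, PolyCode.val_horner, RatCode.val_mul] at h
  obtain ⟨⟨⟨h1, h2⟩, h3⟩, h4⟩ := h
  obtain ⟨hl, hu⟩ := hx.mem_of_refines h1
  have hl0 : 0 ≤ w.2.1.val :=
    ((valid_iff t).1 hx.1).1.trans ((refines_iff _ _ _).1 h1).1
  have hlow := PolyCode.lower_le D hl0 hl.le hu.le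
  have hup := PolyCode.le_upper D hl0 hl.le hu.le
  have h2' : (c.1.2.1.val : ℝ) < (D.lower w.2.1 w.2.2).val + c.2 := by exact_mod_cast h2
  have h3' : ((D.upper w.2.1 w.2.2).val : ℝ) + c.2 < c.1.2.2.val := by exact_mod_cast h3
  refine ⟨hc, by linarith, by linarith, ?_⟩
  have hid : c.1.1.val.comp (D.val + C (c.2 : ℚ)) - t.1.val * w.1.val = 0 := by
    refine PolyCode.eq_zero_of_eval_nat (N := c.1.1.length * D.length +
      (t.1.length + w.1.length) + 1) (Nat.lt_succ_of_le ?_) fun i hi => ?_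
    · refine (natDegree_sub_le _ _).trans (max_le ?_ ?_)
      · rw [natDegree_comp, natDegree_add_C]
        exact (Nat.mul_le_mul (PolyCode.natDegree_val_le _) (PolyCode.natDegree_val_le _)).trans
          (Nat.le_add_right _ _)
      · exact natDegree_mul_le.trans ((Nat.add_le_add (PolyCode.natDegree_val_le _)
          (PolyCode.natDegree_val_le _)).trans (Nat.le_add_left _ _))
    · simp [h4 i hi]
  have := congrArg (aeval x) hid
  rw [map_sub, map_mul, hx.2.2.2, zero_mul, sub_zero, map_zero, aeval_comp] at this
  simpa using this

theorem check_complete {t : RootCode} {c : RootCode × ℕ} {D : PolyCode} {x : ℝ}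
    (hx : t.IsRoot x) (ht : ∀ q : ℚ[X], aeval x q = 0 → t.1.val ∣ q)
    (h : c.1.IsRoot (aeval x D.val + c.2)) : ∃ w, check t c D w = true := by
  obtain ⟨s, hs⟩ := ht (c.1.1.val.comp (D.val + C (c.2 : ℚ))) (by
    rw [aeval_comp]; simpa using h.2.2.2)
  obtain ⟨S, rfl⟩ := PolyCode.val_surjective s
  have e1 := PolyCode.eventually_lower D (x := x) (y := c.1.2.1.val - c.2) (by linarith [h.2.1])
  have e2 := PolyCode.eventually_upper D (x := x) (y := c.1.2.2.val - c.2)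
    (by linarith [h.2.2.1])
  obtain ⟨l, u, hlu, h1, h2⟩ := hx.exists_refines (e1.and e2)
  refine ⟨(S, l, u), ?_⟩
  simp only [check, Bool.and_eq_true, RatCode.blt_iff, RatCode.val_add, RatCode.val_ofNat,
    List.all_eq_true, List.mem_range, RatCode.beq_iff, PolyCode.val_horner, RatCode.val_mul]
  refine ⟨⟨⟨hlu, ?_⟩, ?_⟩, fun i _ => ?_⟩
  · have := h1 l u rfl rfl
    have : (c.1.2.1.val : ℝ) < (D.lower l u).val + c.2 := by linarith
    exact_mod_cast this
  · have := h2 l u rfl rfl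
    have : ((D.upper l u).val : ℝ) + c.2 < c.1.2.2.val := by linarith
    exact_mod_cast this
  · have := congrArg (eval (i : ℚ)) hs
    simpa using this

@[fun_prop] theorem primrec_check {α : Type*} [Primcodable α] {t : α → RootCode}
    {c : α → RootCode × ℕ} {D : α → PolyCode} {w : α → PolyCode × RatCode × RatCode}
    (ht : Primrec t) (hc : Primrec c) (hD : Primrec D) (hw : Primrec w) :
    Primrec fun a => check (t a) (c a) (D a) (w a) := by
  have : Primrec fun a => (List.range ((c a).1.1.length * (D a).length +
      ((t a).1.length + (w a).1.length) + 1)).all fun i =>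
        ((c a).1.1.horner (((D a).horner (RatCode.ofNat i)).add (RatCode.ofNat (c a).2))).beq
          (((t a).1.horner (RatCode.ofNat i)).mul ((w a).1.horner (RatCode.ofNat i))) :=
    Primrec.all_range (by fun_prop) (by fun_prop)
  unfold check
  fun_prop

end RootCode

end

section

open Polynomial Filter Topology
/-! ### A computable presentation of the field of real algebraic numbers -/

/-- Code of a real algebraic number `a`: a code of `a + n` together with `n`. -/
abbrev NumCode := {c : RootCode × ℕ // c.1.valid = true}

instance : Primcodable NumCode :=
  Primcodable.subtype (Primrec.primrecPred (by simp only [Bool.decide_eq_true]; fun_prop))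

namespace NumCode

/-- The real number with a given code. -/
noncomputable def val (c : NumCode) : ℝ :=
  (RootCode.exists_isRoot c.2).choose - c.1.2

theorem isRoot_val (c : NumCode) : c.1.1.IsRoot (c.val + c.1.2) := by
  simpa [val] using (RootCode.exists_isRoot c.2).choose_spec

theorem val_eq_iff {c : NumCode} {a : ℝ} : c.val = a ↔ c.1.1.IsRoot (a + c.1.2) :=
  ⟨fun h => h ▸ c.isRoot_val, fun h => add_right_cancel (c.isRoot_val.unique h)⟩

theorem isAlgebraic_val (c : NumCode) : IsAlgebraic ℚ c.val := by
  have h := c.isRoot_val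
  have hp : c.1.1.1.val ≠ 0 := by
    intro h0
    have := ((RootCode.refines_iff _ _ _).1 ((RootCode.valid_iff _).1 c.2).2.2).2.2.2.2
    rw [h0, eval_zero] at this
    exact lt_irrefl _ this
  have h1 : IsAlgebraic ℚ (c.val + c.1.2) := ⟨_, hp, h.2.2.2⟩
  simpa using h1.sub (isAlgebraic_natCast (R := ℚ) (A := ℝ) c.1.2)

theorem exists_val_eq {a : ℝ} (ha : IsAlgebraic ℚ a) : ∃ c : NumCode, c.val = a := by
  obtain ⟨n, hn⟩ := exists_nat_gt (-a)
  obtain ⟨c, hc, -⟩ := RootCode.exists_code_dvd (x := a + n) (by linarith)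
    (ha.add (isAlgebraic_natCast (R := ℚ) (A := ℝ) n))
  exact ⟨⟨(c, n), hc.1⟩, val_eq_iff.2 hc⟩

@[fun_prop] theorem computable_coe {α : Type*} [Primcodable α] {f : α → NumCode}
    (hf : Primrec f) : Primrec fun a => (f a).1 := Primrec.subtype_val.comp hf

theorem exists_primitive {a b : ℝ} (ha : IsAlgebraic ℚ a) (hb : IsAlgebraic ℚ b) :
    ∃ x : ℝ, 0 < x ∧ IsAlgebraic ℚ x ∧ ∃ p q : ℚ[X], aeval x p = a ∧ aeval x q = b := by
  let K := IntermediateField.adjoin ℚ {a, b}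
  have hfin : FiniteDimensional ℚ K :=
    IntermediateField.finiteDimensional_adjoin (by
      rintro x (rfl | rfl)
      exacts [ha.isIntegral, hb.isIntegral])
  obtain ⟨y, hy⟩ := Field.exists_primitive_element ℚ K
  obtain ⟨n, hn⟩ := exists_nat_gt (-(y : ℝ))
  have hya : IsAlgebraic ℚ (y : ℝ) := (Algebra.IsAlgebraic.isAlgebraic y).algebraMap
  have key : ∀ z ∈ K, ∃ p : ℚ[X], aeval ((y : ℝ) + n) p = z := by
    intro z hz
    have : (⟨z, hz⟩ : K) ∈ IntermediateField.adjoin ℚ {y} := hy ▸ IntermediateField.mem_top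
    rw [← IntermediateField.mem_toSubalgebra,
      IntermediateField.adjoin_simple_toSubalgebra_of_isAlgebraic (Algebra.IsAlgebraic.isAlgebraic y),
      Algebra.adjoin_singleton_eq_range_aeval] at this
    obtain ⟨p, hp⟩ := this
    refine ⟨p.comp (X - C (n : ℚ)), ?_⟩
    have h2 := congrArg (algebraMap K ℝ) hp
    rw [aeval_comp]
    simp only [map_sub, aeval_X, map_natCast, add_sub_cancel_right]
    exact (aeval_algebraMap_apply ℝ y p).trans h2
  obtain ⟨p, hp⟩ := key a (IntermediateField.subset_adjoin _ _ (by simp))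
  obtain ⟨q, hq⟩ := key b (IntermediateField.subset_adjoin _ _ (by simp))
  exact ⟨y + n, by linarith, hya.add (isAlgebraic_natCast (R := ℚ) (A := ℝ) n), p, q, hp, hq⟩

/-- Check that three polynomial codes satisfy `p op q = r`. -/
def checkOp (op : RatCode → RatCode → RatCode) (p q r : PolyCode) : Bool :=
  (List.range (p.length + q.length + r.length + 1)).all fun i =>
    (op (p.horner (RatCode.ofNat i)) (q.horner (RatCode.ofNat i))).beq
      (r.horner (RatCode.ofNat i))

theorem primrec_checkOp {op : RatCode → RatCode → RatCode}
    (hop : Primrec fun x : RatCode × RatCode => op x.1 x.2) {α : Type*} [Primcodable α]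
    {p q r : α → PolyCode} (hp : Primrec p) (hq : Primrec q) (hr : Primrec r) :
    Primrec fun a => checkOp op (p a) (q a) (r a) := by
  have : Primrec fun x : α × ℕ => (op ((p x.1).horner (RatCode.ofNat x.2))
      ((q x.1).horner (RatCode.ofNat x.2))).beq ((r x.1).horner (RatCode.ofNat x.2)) :=
    RatCode.primrec_beq (hop.comp (g := fun x : α × ℕ => ((p x.1).horner (RatCode.ofNat x.2),
      (q x.1).horner (RatCode.ofNat x.2))) (by fun_prop)) (by fun_prop)
  exact Primrec.all_range (N := fun a => (p a).length + (q a).length + (r a).length + 1)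
    (by fun_prop) this

/-- A ring operation is recursively enumerable on codes. -/
theorem isSigmaOne_op {op : RatCode → RatCode → RatCode} {opP : ℚ[X] → ℚ[X] → ℚ[X]}
    {opR : ℝ → ℝ → ℝ} (hop : Primrec fun x : RatCode × RatCode => op x.1 x.2)
    (hval : ∀ a b p q x, a.val = eval x p → b.val = eval x q → (op a b).val = eval x (opP p q))
    (hdeg : ∀ p q, (opP p q).natDegree ≤ p.natDegree + q.natDegree)
    (hR : ∀ (x : ℝ) p q, aeval x (opP p q) = opR (aeval x p) (aeval x q)) :
    IsSigmaOne fun x : (NumCode × NumCode) × NumCode => opR x.1.1.val x.1.2.val = x.2.val := by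
  let chk : ((NumCode × NumCode) × NumCode) × (RootCode ×
      (PolyCode × PolyCode × RatCode × RatCode) × (PolyCode × PolyCode × RatCode × RatCode) ×
      (PolyCode × PolyCode × RatCode × RatCode)) → Bool := fun y =>
    (y.2.1.valid && RootCode.check y.2.1 y.1.1.1.1 y.2.2.1.1 y.2.2.1.2) &&
    (RootCode.check y.2.1 y.1.1.2.1 y.2.2.2.1.1 y.2.2.2.1.2 &&
    RootCode.check y.2.1 y.1.2.1 y.2.2.2.2.1 y.2.2.2.2.2) &&
    checkOp op y.2.2.1.1 y.2.2.2.1.1 y.2.2.2.2.1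
  have hchk : Primrec chk :=
    Primrec.comp_and (by fun_prop) (primrec_checkOp hop (by fun_prop) (by fun_prop) (by fun_prop))
  refine (IsSigmaOne.of_computable hchk.to_comp).proj.of_eq fun y => ⟨?_, fun h => ?_⟩
  · rintro ⟨⟨t, w1, w2, w3⟩, h⟩
    simp only [chk, checkOp, Bool.and_eq_true, List.all_eq_true, List.mem_range, RatCode.beq_iff] at h
    obtain ⟨⟨⟨h0, h1⟩, h2, h3⟩, h4⟩ := h
    obtain ⟨x, hx⟩ := RootCode.exists_isRoot h0
    rw [val_eq_iff.2 (RootCode.check_sound hx y.1.1.2 h1),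
      val_eq_iff.2 (RootCode.check_sound hx y.1.2.2 h2),
      val_eq_iff.2 (RootCode.check_sound hx y.2.2 h3), ← hR]
    have : opP w1.1.val w2.1.val - w3.1.val = 0 := by
      refine PolyCode.eq_zero_of_eval_nat
        (N := w1.1.length + w2.1.length + w3.1.length + 1) (Nat.lt_succ_of_le ?_) fun i hi => ?_
      · refine (natDegree_sub_le _ _).trans (max_le ?_ ?_)
        · exact (hdeg _ _).trans ((Nat.add_le_add (PolyCode.natDegree_val_le _)
            (PolyCode.natDegree_val_le _)).trans (Nat.le_add_right _ _))
        · exact (PolyCode.natDegree_val_le _).trans (Nat.le_add_left _ _)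
      · rw [eval_sub, ← hval (w1.1.horner (RatCode.ofNat i)) (w2.1.horner (RatCode.ofNat i)) w1.1.val
          w2.1.val i (by simp) (by simp), h4 i hi]
        simp
    rw [sub_eq_zero.1 this]
  · obtain ⟨x, hx0, hxa, p, q, hp, hq⟩ :=
      exists_primitive y.1.1.isAlgebraic_val y.1.2.isAlgebraic_val
    obtain ⟨t, ht, htd⟩ := RootCode.exists_code_dvd hx0 hxa
    have hr : aeval x (opP p q) = y.2.val := by rw [hR, hp, hq, h]
    obtain ⟨r, hr'⟩ := PolyCode.val_surjective (opP p q)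
    obtain ⟨p, rfl⟩ := PolyCode.val_surjective p
    obtain ⟨q, rfl⟩ := PolyCode.val_surjective q
    rw [← hr'] at hr
    obtain ⟨w1, h1⟩ := RootCode.check_complete (c := y.1.1.1) ht htd (val_eq_iff.1 hp.symm)
    obtain ⟨w2, h2⟩ := RootCode.check_complete (c := y.1.2.1) ht htd (val_eq_iff.1 hq.symm)
    obtain ⟨w3, h3⟩ := RootCode.check_complete (c := y.2.1) ht htd (val_eq_iff.1 hr.symm)
    refine ⟨(t, (p, w1), (q, w2), (r, w3)), ?_⟩
    simp only [chk, checkOp, Bool.and_eq_true, List.all_eq_true, List.mem_range, RatCode.beq_iff]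
    refine ⟨⟨⟨ht.1, h1⟩, h2, h3⟩, fun i _ => ?_⟩
    rw [hval _ _ p.val q.val i (by simp) (by simp), ← hr']
    simp

theorem isSigmaOne_add :
    IsSigmaOne fun x : (NumCode × NumCode) × NumCode => x.1.1.val + x.1.2.val = x.2.val :=
  isSigmaOne_op (op := RatCode.add) (opP := (· + ·)) (opR := (· + ·)) (by fun_prop)
    (fun a b p q x ha hb => by simp [ha, hb])
    (fun p q => (natDegree_add_le _ _).trans (by omega)) (fun x p q => by simp)

theorem isSigmaOne_mul :
    IsSigmaOne fun x : (NumCode × NumCode) × NumCode => x.1.1.val * x.1.2.val = x.2.val :=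
  isSigmaOne_op (op := RatCode.mul) (opP := (· * ·)) (opR := (· * ·)) (by fun_prop)
    (fun a b p q x ha hb => by simp [ha, hb])
    (fun p q => natDegree_mul_le) (fun x p q => by simp)

theorem isSigmaOne_pos : IsSigmaOne fun c : NumCode => 0 < c.val := by
  have hchk : Primrec fun y : NumCode × RatCode × RatCode =>
      y.1.1.1.refines y.2.1 y.2.2 && !y.2.1.blt (RatCode.ofNat y.1.1.2) := by fun_prop
  refine (IsSigmaOne.of_computable hchk.to_comp).proj.of_eq fun c => ⟨?_, fun h => ?_⟩
  · rintro ⟨⟨l, u⟩, h⟩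
    simp only [Bool.and_eq_true, Bool.not_eq_true', RatCode.blt_iff, RatCode.val_ofNat,
      ← Bool.not_eq_true, not_lt] at h
    have h1 := (c.isRoot_val.mem_of_refines h.1).1
    have h2 : (c.1.2 : ℝ) ≤ l.val := by exact_mod_cast h.2
    linarith
  · have h1 : ∀ᶠ z : ℝ × ℝ in 𝓝 (c.val + c.1.2) ×ˢ 𝓝 (c.val + c.1.2),
        (c.1.2 : ℝ) < z.1 ∧ True :=
      (lt_mem_nhds (show (c.1.2 : ℝ) < c.val + c.1.2 by linarith)).prod_mk Filter.univ_mem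
    obtain ⟨l, u, hlu, hl, -⟩ := c.isRoot_val.exists_refines h1
    refine ⟨(l, u), ?_⟩
    simp only [Bool.and_eq_true, Bool.not_eq_true', RatCode.blt_iff, RatCode.val_ofNat,
      ← Bool.not_eq_true, not_lt]
    replace hl : (c.1.2 : ℝ) < l.val := hl
    exact ⟨hlu, by exact_mod_cast hl.le⟩

end NumCode

/-- A numbering of the real algebraic numbers for which the field operations and the order are
computable. -/
structure AlgNumbering where
  val : ℕ → ℝ
  isAlgebraic_val : ∀ n, IsAlgebraic ℚ (val n)
  exists_val_eq : ∀ a, IsAlgebraic ℚ a → ∃ n, val n = a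
  add : ℕ → ℕ → ℕ
  val_add : ∀ m n, val (add m n) = val m + val n
  computable_add : Computable fun x : ℕ × ℕ => add x.1 x.2
  mul : ℕ → ℕ → ℕ
  val_mul : ∀ m n, val (mul m n) = val m * val n
  computable_mul : Computable fun x : ℕ × ℕ => mul x.1 x.2
  inv : ℕ → ℕ
  val_inv : ∀ n, val (inv n) = (val n)⁻¹
  computable_inv : Computable inv
  nonneg : ℕ → Bool
  nonneg_iff : ∀ n, nonneg n = true ↔ 0 ≤ val n
  computable_nonneg : Computable nonneg
  isZero : ℕ → Bool
  isZero_iff : ∀ n, isZero n = true ↔ val n = 0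
  computable_isZero : Computable isZero

theorem exists_computable_surjective {α : Type*} [Primcodable α] (a : α) :
    ∃ f : ℕ → α, Computable f ∧ Function.Surjective f :=
  ⟨fun n => (Encodable.decode n).getD a,
    Computable.option_getD Computable.decode (Computable.const _),
    fun b => ⟨Encodable.encode b, by simp⟩⟩

theorem exists_numbering : ∃ val : ℕ → ℝ, (∀ n, IsAlgebraic ℚ (val n)) ∧
    (∀ a, IsAlgebraic ℚ a → ∃ n, val n = a) ∧
    (IsSigmaOne fun x : (ℕ × ℕ) × ℕ => val x.1.1 + val x.1.2 = val x.2) ∧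
    (IsSigmaOne fun x : (ℕ × ℕ) × ℕ => val x.1.1 * val x.1.2 = val x.2) ∧
    IsSigmaOne fun n => 0 < val n := by
  obtain ⟨z, -⟩ := NumCode.exists_val_eq (isAlgebraic_zero (R := ℚ) (A := ℝ))
  obtain ⟨dec, hdec, hsurj⟩ := exists_computable_surjective z
  have h3 : Computable fun x : (ℕ × ℕ) × ℕ => ((dec x.1.1, dec x.1.2), dec x.2) :=
    ((hdec.comp (by fun_prop)).pair (hdec.comp (by fun_prop))).pair (hdec.comp (by fun_prop))
  have sadd := NumCode.isSigmaOne_add.comp h3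
  have smul := NumCode.isSigmaOne_mul.comp h3
  have spos := NumCode.isSigmaOne_pos.comp hdec
  refine ⟨fun n => (dec n).val, fun n => (dec n).isAlgebraic_val, fun a ha => ?_,
    sadd, smul, spos⟩
  obtain ⟨c, hc⟩ := NumCode.exists_val_eq ha
  obtain ⟨n, rfl⟩ := hsurj c
  exact ⟨n, hc⟩

theorem exists_algNumbering : Nonempty AlgNumbering := by
  obtain ⟨val, halg, hsurj, sadd, smul, spos⟩ := exists_numbering
  obtain ⟨n0, hn0⟩ := hsurj 0 isAlgebraic_zero
  obtain ⟨n1, hn1⟩ := hsurj 1 isAlgebraic_one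
  have szero : IsSigmaOne fun n => val n = 0 :=
    (sadd.comp (f := fun n => ((n, n), n)) (by fun_prop)).of_eq fun n => by simp
  have sneg : IsSigmaOne fun n => val n < 0 :=
    ((sadd.comp (f := fun x : ℕ × ℕ => ((x.1, x.2), n0)) (by fun_prop)).and
      (spos.comp (f := fun x : ℕ × ℕ => x.2) (by fun_prop))).proj.of_eq fun n => by
        simp only [hn0]
        constructor
        · rintro ⟨m, h1, h2⟩; linarith
        · intro h
          obtain ⟨m, hm⟩ := hsurj (-val n) (halg n).neg
          exact ⟨m, by rw [hm]; ring, by rw [hm]; linarith⟩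
  obtain ⟨nonneg, hnonneg, hnonneg'⟩ := ((spos.or szero).computablePred
    (sneg.of_eq fun n => by rw [← le_iff_lt_or_eq', not_le])).exists_bool
  obtain ⟨isZero, hisZero, hisZero'⟩ := (szero.computablePred
    ((spos.or sneg).of_eq fun n => by rw [or_comm]; exact ne_iff_lt_or_gt.symm)).exists_bool
  obtain ⟨add, hadd, hadd'⟩ := IsSigmaOne.exists_computable
    (R := fun (x : ℕ × ℕ) n => val x.1 + val x.2 = val n) sadd
    fun x => (hsurj _ ((halg x.1).add (halg x.2))).imp fun _ => Eq.symm
  obtain ⟨mul, hmul, hmul'⟩ := IsSigmaOne.exists_computable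
    (R := fun (x : ℕ × ℕ) n => val x.1 * val x.2 = val n) smul
    fun x => (hsurj _ ((halg x.1).mul (halg x.2))).imp fun _ => Eq.symm
  have sinv : IsSigmaOne fun x : ℕ × ℕ => (val x.1)⁻¹ = val x.2 :=
    (((szero.comp (f := Prod.fst) (by fun_prop)).and
      (szero.comp (f := Prod.snd) (by fun_prop))).or
      (smul.comp (f := fun x : ℕ × ℕ => ((x.1, x.2), n1)) (by fun_prop))).of_eq fun x => by
        simp only [hn1]
        by_cases h : val x.1 = 0
        · simp [h, eq_comm]
        · simp only [h, false_and, false_or]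
          exact mul_eq_one_iff_inv_eq₀ h
  obtain ⟨inv, hinv, hinv'⟩ := IsSigmaOne.exists_computable
    (R := fun x n => (val x)⁻¹ = val n) sinv
    fun x => (hsurj _ (halg x).inv).imp fun _ => Eq.symm
  exact ⟨{
    val, isAlgebraic_val := halg, exists_val_eq := hsurj
    add := fun m n => add (m, n), val_add := fun m n => (hadd' (m, n)).symm, computable_add := hadd
    mul := fun m n => mul (m, n), val_mul := fun m n => (hmul' (m, n)).symm, computable_mul := hmul
    inv, val_inv := fun n => (hinv' n).symm, computable_inv := hinv
    nonneg, nonneg_iff := fun n => by rw [hnonneg', le_iff_lt_or_eq, eq_comm]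
    computable_nonneg := hnonneg
    isZero, isZero_iff := hisZero', computable_isZero := hisZero }⟩

end

/-! ### Simulation of machines with algebraic parameters -/

/-- A class of real functions that contains the algebraic constants and is closed under sums and
products is closed under the evaluation of polynomials with algebraic coefficients. -/
theorem MvPolynomial.eval_mem_of_closed {X : Type*} {C : (X → ℝ) → Prop}
    (hconst : ∀ a, IsAlgebraic ℚ a → C fun _ => a)
    (hadd : ∀ f g, C f → C g → C fun x => f x + g x)
    (hmul : ∀ f g, C f → C g → C fun x => f x * g x) {s : X → ℤ →₀ ℝ} (hs : ∀ i, C fun x => s x i)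
    {p : MvPolynomial ℤ ℝ} (hp : ∀ m ∈ p.support, IsAlgebraic ℚ (p.coeff m)) :
    C fun x => MvPolynomial.eval (s x) p := by
  classical
  have hpow : ∀ f n, C f → C fun x => f x ^ n := fun f n hf => by
    induction n with
    | zero => simpa using hconst 1 isAlgebraic_one
    | succ n ih => simpa only [pow_succ] using hmul _ _ ih hf
  have hprod : ∀ (S : Finset ℤ) (m : ℤ →₀ ℕ), C fun x => ∏ i ∈ S, s x i ^ m i := fun S m => by
    induction S using Finset.induction_on with
    | empty => simpa using hconst 1 isAlgebraic_one
    | insert i S hi ih =>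
      simp only [Finset.prod_insert hi]
      exact hmul _ _ (hpow _ _ (hs i)) ih
  have hsum : ∀ S : Finset (ℤ →₀ ℕ), (∀ m ∈ S, IsAlgebraic ℚ (p.coeff m)) →
      C fun x => ∑ m ∈ S, p.coeff m * ∏ i ∈ m.support, s x i ^ m i := fun S hS => by
    induction S using Finset.induction_on with
    | empty => simpa using hconst 0 isAlgebraic_zero
    | insert m S hm ih =>
      simp only [Finset.sum_insert hm]
      exact hadd _ _ (hmul _ _ (hconst _ (hS m (by simp))) (hprod _ _))
        (ih fun j hj => hS j (by simp [hj]))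
  simpa only [MvPolynomial.eval_eq] using hsum _ hp

namespace AlgNumbering

variable (N : AlgNumbering) {α : Type*} [Primcodable α]

@[fun_prop] theorem comp_add {f g : α → ℕ} (hf : Computable f) (hg : Computable g) :
    Computable fun a => N.add (f a) (g a) := N.computable_add.comp (hf.pair hg)

@[fun_prop] theorem comp_mul {f g : α → ℕ} (hf : Computable f) (hg : Computable g) :
    Computable fun a => N.mul (f a) (g a) := N.computable_mul.comp (hf.pair hg)

@[fun_prop] theorem comp_inv {f : α → ℕ} (hf : Computable f) :
    Computable fun a => N.inv (f a) := N.computable_inv.comp hf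

@[fun_prop] theorem comp_nonneg {f : α → ℕ} (hf : Computable f) :
    Computable fun a => N.nonneg (f a) := N.computable_nonneg.comp hf

@[fun_prop] theorem comp_isZero {f : α → ℕ} (hf : Computable f) :
    Computable fun a => N.isZero (f a) := N.computable_isZero.comp hf

noncomputable def zero : ℕ := (N.exists_val_eq 0 isAlgebraic_zero).choose

noncomputable def one : ℕ := (N.exists_val_eq 1 isAlgebraic_one).choose

noncomputable def negOne : ℕ := (N.exists_val_eq (-1) isAlgebraic_one.neg).choose

@[simp] theorem val_zero : N.val N.zero = 0 := (N.exists_val_eq 0 isAlgebraic_zero).choose_spec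

@[simp] theorem val_one : N.val N.one = 1 := (N.exists_val_eq 1 isAlgebraic_one).choose_spec

@[simp] theorem val_negOne : N.val N.negOne = -1 :=
  (N.exists_val_eq (-1) isAlgebraic_one.neg).choose_spec

/-- A number that denotes the natural number `n`. -/
noncomputable def ofNat (n : ℕ) : ℕ := Nat.rec N.zero (fun _ a => N.add a N.one) n

@[simp] theorem val_ofNat (n : ℕ) : N.val (N.ofNat n) = n := by
  induction n with
  | zero => simp [ofNat]
  | succ n ih => rw [ofNat, N.val_add, ← ofNat, ih, val_one, Nat.cast_succ]

@[fun_prop] theorem comp_ofNat {f : α → ℕ} (hf : Computable f) :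
    Computable fun a => N.ofNat (f a) := by
  have : Computable N.ofNat :=
    Computable.nat_rec (h := fun _ p => N.add p.2 N.one) Computable.id (Computable.const N.zero)
      (by unfold Computable₂; fun_prop)
  exact this.comp hf

/-- Equality of the numbers denoted. -/
noncomputable def beq (m n : ℕ) : Bool := N.isZero (N.add m (N.mul N.negOne n))

theorem beq_iff (m n : ℕ) : N.beq m n = true ↔ N.val m = N.val n := by
  rw [beq, isZero_iff, val_add, val_mul, val_negOne, neg_one_mul, ← sub_eq_add_neg, sub_eq_zero]

@[fun_prop] theorem comp_beq {f g : α → ℕ} (hf : Computable f) (hg : Computable g) :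
    Computable fun a => N.beq (f a) (g a) := by unfold beq; fun_prop

end AlgNumbering

/-- `l` with its `i`-th entry replaced by `v`, padded with `z` if necessary. -/
def List.setPad {α : Type*} (z : α) (l : List α) (i : ℕ) (v : α) : List α :=
  (List.range (l.length + i + 1)).map fun j => if j = i then v else l.getD j z

theorem List.getD_setPad {α : Type*} (z : α) (l : List α) (i : ℕ) (v : α) (j : ℕ) :
    (l.setPad z i v).getD j z = if j = i then v else l.getD j z := by
  rw [List.setPad, List.getD_eq_getElem?_getD, List.getElem?_map]
  by_cases h : j < l.length + i + 1
  · rw [List.getElem?_range h]; rfl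
  · rw [List.getElem?_eq_none (by simpa using h), if_neg (by omega),
      List.getD_eq_default _ _ (by omega)]
    rfl

theorem Computable.setPad {α β : Type*} [Primcodable α] [Primcodable β] (z : α) (i : ℕ)
    {l : β → List α} {v : β → α} (hl : Computable l) (hv : Computable v) :
    Computable fun b => (l b).setPad z i (v b) := by
  have : Primrec fun p : List α × α => p.1.setPad z i p.2 := by
    refine Primrec.list_map (Primrec.list_range.comp (by fun_prop)) ?_
    refine Primrec.ite (Primrec.eq.comp (by fun_prop) (by fun_prop)) (by fun_prop) ?_
    exact (Primrec.list_getD z).comp (by fun_prop) (by fun_prop)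
  exact this.to_comp.comp (hl.pair hv)

/-- A state of a machine whose entries are numbered reals: the entries at `0, 1, …` and those at
`-1, -2, …`. -/
abbrev Tape := List ℕ × List ℕ

namespace AlgNumbering

variable (N : AlgNumbering)

/-- The code of an entry of a tape. -/
noncomputable def tapeCode (t : Tape) : ℤ → ℕ
  | .ofNat n => t.1.getD n N.zero
  | .negSucc n => t.2.getD n N.zero

theorem tapeCode_ofNat (t : Tape) (n : ℕ) : N.tapeCode t (.ofNat n) = t.1.getD n N.zero := rfl

theorem tapeCode_negSucc (t : Tape) (n : ℕ) : N.tapeCode t (.negSucc n) = t.2.getD n N.zero := rfl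

/-- The state coded by a tape. -/
noncomputable def tapeState (t : Tape) : ℤ →₀ ℝ :=
  Finsupp.onFinset (Finset.Icc (-(t.2.length : ℤ)) t.1.length) (fun i => N.val (N.tapeCode t i)) (by
    intro i hi
    rw [Finset.mem_Icc]
    by_contra h
    refine hi ?_
    rcases i with n | n
    · have : t.1.length ≤ n := by
        by_contra h'
        exact h ⟨by simp only [Int.ofNat_eq_natCast]; omega,
          by simp only [Int.ofNat_eq_natCast]; omega⟩
      simp only [tapeCode, List.getD_eq_default _ _ this, val_zero]
    · have : t.2.length ≤ n := by
        by_contra h'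
        exact h ⟨by omega, by omega⟩
      simp only [tapeCode, List.getD_eq_default _ _ this, val_zero])

@[simp] theorem tapeState_apply (t : Tape) (i : ℤ) :
    N.tapeState t i = N.val (N.tapeCode t i) := rfl

@[fun_prop] theorem computable_tapeCode {α : Type*} [Primcodable α] {f : α → Tape}
    (hf : Computable f) (i : ℤ) : Computable fun a => N.tapeCode (f a) i := by
  rcases i with n | n <;> unfold tapeCode <;> fun_prop

/-- The tape `t` with the `i`-th entry replaced by `v`. -/
noncomputable def setTape (i : ℤ) (v : ℕ) (t : Tape) : Tape :=
  match i with
  | .ofNat n => (t.1.setPad N.zero n v, t.2)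
  | .negSucc n => (t.1, t.2.setPad N.zero n v)

theorem tapeCode_setTape (i : ℤ) (v : ℕ) (t : Tape) (j : ℤ) :
    N.tapeCode (N.setTape i v t) j = if j = i then v else N.tapeCode t j := by
  rcases i with m | m <;> rcases j with n | n <;>
    simp [setTape, tapeCode, List.getD_setPad, -List.getD_eq_getElem?_getD]

theorem computable_setTape {α : Type*} [Primcodable α] (i : ℤ) {v : α → ℕ} {t : α → Tape}
    (hv : Computable v) (ht : Computable t) : Computable fun a => N.setTape i (v a) (t a) := by
  rcases i with n | n
  · exact (Computable.setPad _ _ (by fun_prop) hv).pair (by fun_prop)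
  · exact Computable.pair (by fun_prop) (Computable.setPad _ _ (by fun_prop) hv)

/-- A real function of the state that is computable on codes. -/
def IsComputableOn (g : (ℤ →₀ ℝ) → ℝ) : Prop :=
  ∃ f : Tape → ℕ, Computable f ∧ ∀ t, N.val (f t) = g (N.tapeState t)

namespace IsComputableOn

variable {N} {g g' : (ℤ →₀ ℝ) → ℝ}

theorem const {a : ℝ} (ha : IsAlgebraic ℚ a) : N.IsComputableOn fun _ => a := by
  obtain ⟨n, hn⟩ := N.exists_val_eq a ha
  exact ⟨fun _ => n, by fun_prop, fun _ => hn⟩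

theorem coord (i : ℤ) : N.IsComputableOn fun s => s i :=
  ⟨fun t => N.tapeCode t i, by fun_prop, fun _ => rfl⟩

theorem add (h : N.IsComputableOn g) (h' : N.IsComputableOn g') :
    N.IsComputableOn fun s => g s + g' s := by
  obtain ⟨f, hf, hfg⟩ := h
  obtain ⟨f', hf', hfg'⟩ := h'
  exact ⟨fun t => N.add (f t) (f' t), by fun_prop, fun t => by rw [N.val_add, hfg, hfg']⟩

theorem mul (h : N.IsComputableOn g) (h' : N.IsComputableOn g') :
    N.IsComputableOn fun s => g s * g' s := by
  obtain ⟨f, hf, hfg⟩ := h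
  obtain ⟨f', hf', hfg'⟩ := h'
  exact ⟨fun t => N.mul (f t) (f' t), by fun_prop, fun t => by rw [N.val_mul, hfg, hfg']⟩

theorem div (h : N.IsComputableOn g) (h' : N.IsComputableOn g') :
    N.IsComputableOn fun s => g s / g' s := by
  obtain ⟨f, hf, hfg⟩ := h
  obtain ⟨f', hf', hfg'⟩ := h'
  exact ⟨fun t => N.mul (f t) (N.inv (f' t)), by fun_prop, fun t => by
    rw [N.val_mul, N.val_inv, hfg, hfg', ← div_eq_mul_inv]⟩

theorem eval {p : MvPolynomial ℤ ℝ} (hp : ∀ m ∈ p.support, IsAlgebraic ℚ (p.coeff m)) :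
    N.IsComputableOn fun s => MvPolynomial.eval s p :=
  MvPolynomial.eval_mem_of_closed (C := N.IsComputableOn) (fun _ => const) (fun _ _ => add)
    (fun _ _ => mul) (s := fun s => s) coord hp

theorem exists_forall_ne_zero {ι : Type*} (S : Finset ι) {g : ι → (ℤ →₀ ℝ) → ℝ}
    (h : ∀ i ∈ S, N.IsComputableOn (g i)) : ∃ b : Tape → Bool, Computable b ∧
      ∀ t, b t = true ↔ ∀ i ∈ S, g i (N.tapeState t) ≠ 0 := by
  classical
  induction S using Finset.induction_on with
  | empty => exact ⟨fun _ => true, by fun_prop, by simp⟩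
  | insert i S hi ih =>
    obtain ⟨b, hb, hbS⟩ := ih fun j hj => h j (by simp [hj])
    obtain ⟨f, hf, hfg⟩ := h i (by simp)
    refine ⟨fun t => !N.isZero (f t) && b t, by fun_prop, fun t => ?_⟩
    rw [Bool.and_eq_true, hbS, Finset.forall_mem_insert, Bool.not_eq_true', ← Bool.not_eq_true,
      isZero_iff, hfg]

theorem exists_update (S : Finset ℤ) {g : ℤ → (ℤ →₀ ℝ) → ℝ}
    (h : ∀ i ∈ S, N.IsComputableOn (g i)) : ∃ F : Tape → Tape, Computable F ∧
      ∀ t i, N.tapeState (F t) i = if i ∈ S then g i (N.tapeState t) else N.tapeState t i := by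
  classical
  induction S using Finset.induction_on with
  | empty => exact ⟨fun t => t, by fun_prop, by simp⟩
  | insert i S hi ih =>
    obtain ⟨F, hF, hFS⟩ := ih fun j hj => h j (by simp [hj])
    obtain ⟨f, hf, hfg⟩ := h i (by simp)
    refine ⟨fun t => N.setTape i (f t) (F t), N.computable_setTape i hf hF, fun t j => ?_⟩
    rw [tapeState_apply, tapeCode_setTape]
    by_cases hj : j = i
    · subst hj; simp [hfg]
    · rw [if_neg hj, ← tapeState_apply, hFS]; simp [hj]

end IsComputableOn

end AlgNumbering

namespace BSSMachine

open AlgNumbering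

variable (N : AlgNumbering) (M : BSSMachine)

theorem exists_node_step (hM : M.ParamsIn {r : ℝ | IsAlgebraic ℚ r}) (k : Fin M.size) :
    ∃ f : Tape → Option (Fin M.size × Tape), Computable f ∧
      ∀ t d, M.Step (k, N.tapeState t) d ↔ ∃ c ∈ f t, d = (c.1, N.tapeState c.2) := by
  have hk := hM k
  rcases hnode : M.node k with ⟨S, num, den, next⟩ | ⟨h, neg, nonneg⟩ | ⟨next⟩ | ⟨next⟩ | _
  · simp only [hnode] at hk
    obtain ⟨b, hb, hbS⟩ := IsComputableOn.exists_forall_ne_zero (N := N) S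
      (g := fun i s => MvPolynomial.eval s (den i)) fun i hi => IsComputableOn.eval (hk i hi).2
    obtain ⟨F, hF, hFS⟩ := IsComputableOn.exists_update (N := N) S
      (g := fun i s => MvPolynomial.eval s (num i) / MvPolynomial.eval s (den i))
      fun i hi => (IsComputableOn.eval (hk i hi).1).div (IsComputableOn.eval (hk i hi).2)
    refine ⟨fun t => bif b t then some (next, F t) else none, by fun_prop, fun t d => ?_⟩
    simp only [Step, hnode]
    constructor
    · rintro ⟨h1, h2, h3⟩
      have : b t = true := (hbS t).2 fun i hi => (h2 i hi).1
      refine ⟨(next, F t), by simp [this], Prod.ext h1 (Finsupp.ext fun i => ?_)⟩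
      simp only [hFS]
      split_ifs with hi
      · exact (h2 i hi).2
      · exact h3 i hi
    · rintro ⟨c, hc, rfl⟩
      cases hbt : b t with
      | false => simp [hbt] at hc
      | true =>
        simp only [hbt, cond_true, Option.mem_def, Option.some.injEq] at hc
        subst hc
        exact ⟨rfl, fun i hi => ⟨(hbS t).1 hbt i hi, by simp only [hFS, if_pos hi]⟩,
          fun i hi => by simp only [hFS, if_neg hi]⟩
  · simp only [hnode] at hk
    obtain ⟨f, hf, hfg⟩ := IsComputableOn.eval (N := N) hk
    refine ⟨fun t => some (bif N.nonneg (f t) then nonneg else neg, t), by fun_prop,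
      fun t d => ?_⟩
    simp only [Step, hnode, Option.mem_def, Option.some.injEq, exists_eq_left']
    rw [Prod.ext_iff]
    by_cases h0 : 0 ≤ MvPolynomial.eval (N.tapeState t) h
    · have h1 : N.nonneg (f t) = true := by rw [nonneg_iff, hfg]; exact h0
      simp [h0, h1]
    · have h1 : N.nonneg (f t) = false := by
        rw [← Bool.not_eq_true, nonneg_iff, hfg]; exact h0
      simp [h1, not_le.1 h0]
  · refine ⟨fun t => some (next, (t.1.tail, t.1.getD 0 N.zero :: t.2)), by fun_prop,
      fun t d => ?_⟩
    simp only [Step, hnode, Option.mem_def, Option.some.injEq, exists_eq_left']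
    rw [Prod.ext_iff, Finsupp.ext_iff]
    refine and_congr_right fun _ => forall_congr' fun i => ?_
    suffices N.tapeState t (i + 1) = N.tapeState (t.1.tail, t.1.getD 0 N.zero :: t.2) i by rw [this]
    rcases i with n | n | n
    · rw [show Int.ofNat n + 1 = Int.ofNat (n + 1) from rfl]
      simp only [tapeState_apply, tapeCode_ofNat]
      simp
    · rw [show Int.negSucc 0 + 1 = Int.ofNat 0 from rfl]
      simp only [tapeState_apply, tapeCode_ofNat, tapeCode_negSucc]
      simp
    · rw [show Int.negSucc (n + 1) + 1 = Int.negSucc n from rfl]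
      simp only [tapeState_apply, tapeCode_negSucc]
      simp
  · refine ⟨fun t => some (next, (t.2.getD 0 N.zero :: t.1, t.2.tail)), by fun_prop,
      fun t d => ?_⟩
    simp only [Step, hnode, Option.mem_def, Option.some.injEq, exists_eq_left']
    rw [Prod.ext_iff, Finsupp.ext_iff]
    refine and_congr_right fun _ => forall_congr' fun i => ?_
    suffices N.tapeState t (i - 1) = N.tapeState (t.2.getD 0 N.zero :: t.1, t.2.tail) i by rw [this]
    rcases i with (_ | n) | n
    · rw [show Int.ofNat 0 - 1 = Int.negSucc 0 from rfl]
      simp only [tapeState_apply, tapeCode_ofNat, tapeCode_negSucc]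
      simp
    · rw [show Int.ofNat (n + 1) - 1 = Int.ofNat n by simp]
      simp only [tapeState_apply, tapeCode_ofNat]
      simp
    · rw [show Int.negSucc n - 1 = Int.negSucc (n + 1) from rfl]
      simp only [tapeState_apply, tapeCode_negSucc]
      simp
  · exact ⟨fun _ => none, by fun_prop, fun t d => by simp [Step, hnode]⟩

theorem exists_step (hM : M.ParamsIn {r : ℝ | IsAlgebraic ℚ r}) :
    ∃ f : Fin M.size × Tape → Option (Fin M.size × Tape), Computable f ∧
      ∀ c d, M.Step (c.1, N.tapeState c.2) d ↔ ∃ c' ∈ f c, d = (c'.1, N.tapeState c'.2) := by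
  choose f hf hfM using M.exists_node_step N hM
  exact ⟨fun c => f c.1 c.2, Computable.fin_uncurry hf, fun c d => hfM c.1 c.2 d⟩

/-- The tape for the input map. -/
noncomputable def inputTape (x : List ℕ) : Tape :=
  (bif decide (x.length = 0) then N.zero :: x else N.one :: x, x.tail.map fun _ => N.one)

theorem tapeState_inputTape (x : List ℕ) :
    N.tapeState (inputTape N x) = inputState (x.map N.val) := by
  ext i
  have hI : inputState (x.map N.val) i = if 1 ≤ i then (x.map N.val).getD (i - 1).toNat 0
      else if -((x.map N.val).length : ℤ) < i then 1 else 0 := rfl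
  rw [hI, tapeState_apply, List.length_map]
  rcases i with (_ | n) | n
  · rcases x with - | ⟨a, x⟩
    · simp [tapeCode, inputTape]
    · have : (-1 : ℤ) < x.length := by omega
      simp [tapeCode, inputTape, this]
  · have h1 : (1 : ℤ) ≤ Int.ofNat (n + 1) := by simp
    have h2 : (Int.ofNat (n + 1) - 1).toNat = n := by simp
    rw [if_pos h1, h2]
    have h3 : N.tapeCode (inputTape N x) (Int.ofNat (n + 1)) = x.getD n N.zero := by
      rcases x with - | ⟨a, x⟩ <;> simp [tapeCode, inputTape]
    rw [h3, ← N.val_zero, List.getD_map]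
  · rw [if_neg (by omega)]
    rcases lt_or_ge (n + 1) x.length with h | h
    · rw [if_pos (by omega)]
      have : n < x.length - 1 := by omega
      simp [tapeCode, inputTape, this]
    · rw [if_neg (by omega)]
      have : x.length - 1 ≤ n := by omega
      simp [tapeCode, inputTape, this]

@[fun_prop] theorem computable_inputTape {α : Type*} [Primcodable α] {f : α → List ℕ}
    (hf : Computable f) : Computable fun a => inputTape N (f a) := by
  have : Computable fun a => (f a).tail.map fun _ => N.one :=
    Computable.list_map (by fun_prop) (by unfold Computable₂; fun_prop)
  unfold inputTape
  fun_prop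

/-- Computability of the halting computations of a machine, with the final states. -/
theorem exists_run (hM : M.ParamsIn {r : ℝ | IsAlgebraic ℚ r}) :
    ∃ h : List ℕ × ℕ → Option Tape, Computable h ∧
      ∀ x s, M.HaltsWith (x.map N.val) s ↔ ∃ n, ∃ t ∈ h (x, n), s = N.tapeState t := by
  classical
  obtain ⟨f, hf, hfM⟩ := M.exists_step N hM
  let run : List ℕ → ℕ → Option (Fin M.size × Tape) := fun x n =>
    Nat.rec (some (M.entry, inputTape N x)) (fun _ o => o.bind f) n
  have hrun : Computable fun p : List ℕ × ℕ => run p.1 p.2 := by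
    refine Computable.nat_rec (f := fun p : List ℕ × ℕ => p.2)
      (g := fun p => some (M.entry, inputTape N p.1))
      (h := fun _ (q : ℕ × Option (Fin M.size × Tape)) => q.2.bind f) (by fun_prop) (by fun_prop) ?_
    exact Computable.option_bind (by fun_prop) (hf.comp Computable.snd)
  have hreach : ∀ x d, Relation.ReflTransGen M.Step (M.entry, inputState (x.map N.val)) d ↔
      ∃ n, ∃ c ∈ run x n, d = (c.1, N.tapeState c.2) := by
    intro x d
    rw [← tapeState_inputTape]
    constructor
    · intro h
      induction h with
      | refl => exact ⟨0, _, rfl, rfl⟩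
      | tail _ hs ih =>
        obtain ⟨n, c, hc, rfl⟩ := ih
        obtain ⟨c', hc', rfl⟩ := (hfM c _).1 hs
        exact ⟨n + 1, c', Option.bind_eq_some_iff.2 ⟨c, hc, hc'⟩, rfl⟩
    · rintro ⟨n, c, hc, rfl⟩
      induction n generalizing c with
      | zero =>
        obtain rfl := Option.some.inj hc
        exact .refl
      | succ n ih =>
        obtain ⟨c', hc', hcc⟩ := Option.bind_eq_some_iff.1 hc
        exact (ih c' hc').tail ((hfM c' _).2 ⟨c, hcc, rfl⟩)
  let out : Fin M.size → Bool := fun k => decide (M.node k = .output)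
  have hout : Computable out := (Primrec.dom_finite out).to_comp
  refine ⟨fun p => (run p.1 p.2).bind fun c => bif out c.1 then some c.2 else none, ?_,
    fun x s => ?_⟩
  · refine Computable.option_bind hrun ?_
    unfold Computable₂
    fun_prop
  · simp only [HaltsWith, hreach]
    constructor
    · rintro ⟨k, hk, n, c, hc, hd⟩
      obtain ⟨rfl, rfl⟩ := Prod.ext_iff.1 hd
      refine ⟨n, c.2, Option.bind_eq_some_iff.2 ⟨c, hc, ?_⟩, rfl⟩
      simp only at hk
      simp [out, hk]
    · rintro ⟨n, t, ht, rfl⟩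
      obtain ⟨c, hc, hct⟩ := Option.bind_eq_some_iff.1 ht
      by_cases hk : M.node c.1 = .output
      · simp only [out, hk, decide_true, cond_true, Option.some.injEq] at hct
        exact ⟨c.1, hk, n, c, hc, by rw [hct]⟩
      · simp [out, hk] at hct

theorem isSigmaOne_halts (hM : M.ParamsIn {r : ℝ | IsAlgebraic ℚ r}) :
    IsSigmaOne fun x : List ℕ => M.Halts (x.map N.val) := by
  obtain ⟨h, hh, hhM⟩ := M.exists_run N hM
  refine ⟨fun p => (h p).isSome, Primrec.option_isSome.to_comp.comp hh, fun x => ?_⟩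
  simp only [Halts, hhM, Option.isSome_iff_exists]
  constructor
  · rintro ⟨s, n, t, ht, -⟩; exact ⟨n, t, ht⟩
  · rintro ⟨n, t, ht⟩; exact ⟨_, n, t, ht, rfl⟩

theorem isOutput_singleton (s : ℤ →₀ ℝ) (a : ℝ) :
    IsOutput s [a] ↔ s 0 ≠ 0 ∧ s (-1) = 0 ∧ a = s 1 := by
  simp [IsOutput]

theorem isSigmaOne_computes (hM : M.ParamsIn {r : ℝ | IsAlgebraic ℚ r}) :
    IsSigmaOne fun x : ℕ × ℕ => M.Computes [(x.1 : ℝ)] [(x.2 : ℝ)] := by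
  obtain ⟨N⟩ := exists_algNumbering
  obtain ⟨h, hh, hhM⟩ := M.exists_run N hM
  have hc : Computable fun p : (ℕ × ℕ) × ℕ => ((h ([N.ofNat p.1.1], p.2)).map fun t =>
      !N.isZero (N.tapeCode t 0) && (N.isZero (N.tapeCode t (-1)) &&
        N.beq (N.ofNat p.1.2) (N.tapeCode t 1))).getD false := by
    refine Computable.option_getD (Computable.option_map ?_ ?_) (by fun_prop)
    · fun_prop
    · unfold Computable₂
      fun_prop
  refine ⟨_, hc, fun x => ?_⟩
  have hx : [(x.1 : ℝ)] = [N.ofNat x.1].map N.val := by simp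
  simp only [Computes, isOutput_singleton, hx, hhM]
  constructor
  · rintro ⟨s, ⟨n, t, ht, rfl⟩, h1, h2, h3⟩
    refine ⟨n, ?_⟩
    rw [Option.mem_def] at ht
    simp only [ht, Option.map_some, Option.getD_some, Bool.and_eq_true, Bool.not_eq_true',
      ← Bool.not_eq_true, isZero_iff, beq_iff, val_ofNat]
    exact ⟨h1, h2, h3⟩
  · rintro ⟨n, hn⟩
    cases ht : h ([N.ofNat x.1], n) with
    | none => simp [ht] at hn
    | some t =>
      simp only [ht, Option.map_some, Option.getD_some, Bool.and_eq_true, Bool.not_eq_true',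
        ← Bool.not_eq_true, isZero_iff, beq_iff, val_ofNat] at hn
      exact ⟨_, ⟨n, t, ht, rfl⟩, hn.1, hn.2.1, hn.2.2⟩

theorem step_unique {c d d' : Fin M.size × (ℤ →₀ ℝ)} (h : M.Step c d) (h' : M.Step c d') :
    d = d' := by
  unfold Step at h h'
  split at h <;> rename_i hnode
  · simp only [hnode] at h'
    refine Prod.ext (h.1.trans h'.1.symm) (Finsupp.ext fun i => ?_)
    by_cases hi : i ∈ ‹Finset ℤ›
    · rw [(h.2.1 i hi).2, (h'.2.1 i hi).2]
    · rw [h.2.2 i hi, h'.2.2 i hi]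
  · simp only [hnode] at h'
    refine Prod.ext ?_ (h.2.2.trans h'.2.2.symm)
    rcases le_or_gt 0 (MvPolynomial.eval c.2 ‹MvPolynomial ℤ ℝ›) with h0 | h0
    · rw [h.1 h0, h'.1 h0]
    · rw [h.2.1 h0, h'.2.1 h0]
  · simp only [hnode] at h'
    exact Prod.ext (h.1.trans h'.1.symm) (Finsupp.ext fun i => by rw [h.2 i, h'.2 i])
  · simp only [hnode] at h'
    exact Prod.ext (h.1.trans h'.1.symm) (Finsupp.ext fun i => by rw [h.2 i, h'.2 i])
  · exact h.elim

theorem not_step_output {c d : Fin M.size × (ℤ →₀ ℝ)} (hc : M.node c.1 = .output) :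
    ¬ M.Step c d := by
  simp [Step, hc]

theorem haltsWith_unique {x : List ℝ} {s s' : ℤ →₀ ℝ} (h : M.HaltsWith x s)
    (h' : M.HaltsWith x s') : s = s' := by
  obtain ⟨k, hk, hs⟩ := h
  obtain ⟨k', hk', hs'⟩ := h'
  have hu : Relator.RightUnique M.Step := fun _ _ _ h h' => M.step_unique h h'
  rcases Relation.ReflTransGen.total_of_right_unique hu hs hs' with h | h
  · rcases h.cases_head with h | ⟨d, hd, -⟩
    · exact (Prod.ext_iff.1 h).2
    · exact (M.not_step_output hk hd).elim
  · rcases h.cases_head with h | ⟨d, hd, -⟩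
    · exact (Prod.ext_iff.1 h).2.symm
    · exact (M.not_step_output hk' hd).elim

theorem computes_singleton_unique {x : List ℝ} {a b : ℝ} (h : M.Computes x [a])
    (h' : M.Computes x [b]) : a = b := by
  obtain ⟨s, hs, ha⟩ := h
  obtain ⟨s', hs', hb⟩ := h'
  obtain rfl := M.haltsWith_unique hs hs'
  rw [isOutput_singleton] at ha hb
  rw [ha.2.2, hb.2.2]

end BSSMachine

section

open Filter Topology

/-! ### Specialization of real points to algebraic points -/

/-- The field of real algebraic numbers. -/
noncomputable abbrev RealAlg : IntermediateField ℚ ℝ := algebraicClosure ℚ ℝ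

theorem isAlgebraic_realAlg : Algebra.IsAlgebraic ℚ RealAlg :=
  ⟨fun x => (isAlgebraic_algebraMap_iff (algebraMap RealAlg ℝ).injective).1
    (mem_algebraicClosure_iff.1 x.2)⟩

section OneVariable

open Polynomial

variable {R : Type*} [CommRing R]

/-- A polynomial vanishing at `t` with minimal degree among those that do not vanish identically. -/
structure IsMinimalRelation (φ : R →+* ℝ) (t : ℝ) (P : R[X]) : Prop where
  eval : P.eval₂ φ t = 0
  map_ne_zero : P.map φ ≠ 0
  minimal : ∀ Q : R[X], Q.eval₂ φ t = 0 → Q.natDegree < P.natDegree → Q.map φ = 0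

namespace IsMinimalRelation

variable {φ : R →+* ℝ} {t : ℝ} {P : R[X]}

theorem natDegree_pos (h : IsMinimalRelation φ t P) : 0 < P.natDegree := by
  by_contra h0
  obtain ⟨a, rfl⟩ := natDegree_eq_zero.1 (Nat.eq_zero_of_not_pos h0)
  have := h.eval
  rw [eval₂_C] at this
  exact h.map_ne_zero (by rw [map_C, this, C_0])

theorem map_leadingCoeff_ne_zero (h : IsMinimalRelation φ t P) : φ P.leadingCoeff ≠ 0 := by
  intro h0
  have hmap : P.eraseLead.map φ = P.map φ := by
    conv_rhs => rw [← eraseLead_add_C_mul_X_pow P, Polynomial.map_add, Polynomial.map_mul, map_C,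
      h0, C_0, zero_mul, add_zero]
  refine h.map_ne_zero (hmap ▸ h.minimal P.eraseLead ?_ ?_)
  · rw [eval₂_eq_eval_map, hmap, ← eval₂_eq_eval_map, h.eval]
  · exact (eraseLead_natDegree_le P).trans_lt (Nat.sub_lt h.natDegree_pos one_pos)

theorem eval_derivative_ne_zero (h : IsMinimalRelation φ t P) : (derivative (P.map φ)).eval t ≠ 0 := by
  intro h0
  rw [derivative_map, ← eval₂_eq_eval_map] at h0
  have h1 := h.minimal _ h0 (natDegree_derivative_lt h.natDegree_pos.ne')
  rw [← derivative_map] at h1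
  have h2 := derivative_eq_zero.1 h1
  rw [natDegree_map_of_leadingCoeff_ne_zero φ h.map_leadingCoeff_ne_zero] at h2
  exact h.natDegree_pos.ne' h2

theorem eval₂_eq_zero [IsDomain R] (h : IsMinimalRelation φ t P) {ψ : R →+* ℝ} {t' : ℝ} (hψ : ∀ r, φ r = 0 → ψ r = 0)
    (hlead : ψ P.leadingCoeff ≠ 0) (hP : P.eval₂ ψ t' = 0) (Q : R[X]) (hQ : Q.eval₂ φ t = 0) :
    Q.eval₂ ψ t' = 0 := by
  induction hn : Q.natDegree using Nat.strong_induction_on generalizing Q with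
  | _ n ih =>
    rcases lt_or_ge Q.natDegree P.natDegree with hlt | hge
    · have h0 := h.minimal Q hQ hlt
      have h1 : Q.map ψ = 0 := by
        ext i
        rw [coeff_map, coeff_zero]
        refine hψ _ ?_
        rw [← coeff_map, h0, coeff_zero]
      rw [eval₂_eq_eval_map, h1, eval_zero]
    · have hP0 : P ≠ 0 := fun h0 => h.map_ne_zero (by rw [h0, Polynomial.map_zero])
      have hQ0 : Q ≠ 0 := by
        rintro rfl
        simp only [natDegree_zero] at hge
        exact h.natDegree_pos.ne' (Nat.le_zero.1 hge)
      have hp := leadingCoeff_ne_zero.2 hP0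
      have hq := leadingCoeff_ne_zero.2 hQ0
      have hdeg : (C P.leadingCoeff * Q).degree =
          (C Q.leadingCoeff * X ^ (Q.natDegree - P.natDegree) * P).degree := by
        rw [degree_mul, degree_mul, degree_C hp, degree_C_mul_X_pow _ hq, zero_add,
          degree_eq_natDegree hP0, degree_eq_natDegree hQ0, ← Nat.cast_add, Nat.sub_add_cancel hge]
      obtain ⟨T, hT⟩ : ∃ T, T = C P.leadingCoeff * Q -
        C Q.leadingCoeff * X ^ (Q.natDegree - P.natDegree) * P := ⟨_, rfl⟩
      have hlt : T.degree < Q.degree := by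
        rw [hT]
        refine (degree_sub_lt_left hdeg (mul_ne_zero (C_ne_zero.2 hp) hQ0) ?_).trans_eq ?_
        · rw [leadingCoeff_mul, leadingCoeff_mul, leadingCoeff_C, leadingCoeff_C_mul_X_pow, mul_comm]
        · rw [degree_mul, degree_C hp, zero_add]
      have hlt' : T.natDegree < n := by
        rw [← hn]
        by_cases h0 : T = 0
        · rw [h0, natDegree_zero]
          exact h.natDegree_pos.trans_le hge
        · exact natDegree_lt_natDegree h0 hlt
      have hTeval : T.eval₂ φ t = 0 := by
        rw [hT, eval₂_sub, eval₂_mul, eval₂_mul, hQ, h.eval, mul_zero, mul_zero, sub_zero]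
      have h1 := ih _ hlt' T hTeval rfl
      rw [hT, eval₂_sub, eval₂_mul, eval₂_mul, hP, mul_zero, sub_zero, eval₂_C] at h1
      exact (mul_eq_zero.1 h1).resolve_left hlead

end IsMinimalRelation

theorem exists_isMinimalRelation {φ : R →+* ℝ} {t : ℝ} {Q : R[X]} (hQ : Q.eval₂ φ t = 0)
    (hQ0 : Q.map φ ≠ 0) : ∃ P, IsMinimalRelation φ t P := by
  classical
  have hex : ∃ n, ∃ P : R[X], P.natDegree = n ∧ P.eval₂ φ t = 0 ∧ P.map φ ≠ 0 :=
    ⟨_, Q, rfl, hQ, hQ0⟩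
  obtain ⟨P, hP, hP1, hP2⟩ := Nat.find_spec hex
  refine ⟨P, hP1, hP2, fun Q hQ hlt => ?_⟩
  by_contra h0
  exact Nat.find_min hex (hP ▸ hlt) ⟨Q, rfl, hQ, h0⟩

/-- A real polynomial changes sign at a simple root. -/
theorem exists_sign_change {p : ℝ[X]} {t : ℝ} (h0 : p.eval t = 0)
    (h1 : (derivative p).eval t ≠ 0) {ε : ℝ} (hε : 0 < ε) :
    ∃ x y, t - ε < x ∧ x < y ∧ y < t + ε ∧ p.eval x * p.eval y < 0 := by
  obtain ⟨q, rfl⟩ := dvd_iff_isRoot.2 h0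
  have hq : q.eval t ≠ 0 := by
    simpa [derivative_mul] using h1
  have hc : Tendsto (fun s : ℝ => q.eval (t - s) * q.eval (t + s)) (𝓝[>] 0)
      (𝓝 (q.eval t * q.eval t)) := by
    have : Continuous fun s : ℝ => q.eval (t - s) * q.eval (t + s) := by fun_prop
    simpa using (this.tendsto 0).mono_left nhdsWithin_le_nhds
  have hpos : 0 < q.eval t * q.eval t := mul_self_pos.2 hq
  obtain ⟨s, hs, hs0⟩ := ((hc.eventually (lt_mem_nhds hpos)).and
    (Ioo_mem_nhdsGT hε)).exists
  refine ⟨t - s, t + s, by linarith [hs0.2], by linarith [hs0.1], by linarith [hs0.2], ?_⟩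
  have : ((X - C t) * q).eval (t - s) * ((X - C t) * q).eval (t + s) =
      -(s * s * (q.eval (t - s) * q.eval (t + s))) := by simp; ring
  rw [this, neg_lt_zero]
  exact mul_pos (mul_pos hs0.1 hs0.1) hs

end OneVariable

theorem exists_root_of_mul_neg {p : Polynomial ℝ} {x y : ℝ} (hxy : x < y)
    (h : p.eval x * p.eval y < 0) : ∃ z, x < z ∧ z < y ∧ p.eval z = 0 := by
  have hc : ContinuousOn (fun z => p.eval z) (Set.Icc x y) := p.continuous.continuousOn
  rcases mul_neg_iff.1 h with ⟨h1, h2⟩ | ⟨h1, h2⟩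
  · obtain ⟨z, hz, hz0⟩ := intermediate_value_Ioo' hxy.le hc ⟨h2, h1⟩
    exact ⟨z, hz.1, hz.2, hz0⟩
  · obtain ⟨z, hz, hz0⟩ := intermediate_value_Ioo hxy.le hc ⟨h1, h2⟩
    exact ⟨z, hz.1, hz.2, hz0⟩

theorem MvPolynomial.continuous_aeval_real {ι K : Type*} [Field K] [Algebra K ℝ]
    (g : MvPolynomial ι K) : Continuous fun b : ι → ℝ => MvPolynomial.aeval b g := by
  simp only [MvPolynomial.aeval_def, MvPolynomial.eval₂_eq]
  fun_prop

theorem MvPolynomial.aeval_cons {n : ℕ} (t : ℝ) (c : Fin n → ℝ)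
    (g : MvPolynomial (Fin (n + 1)) RealAlg) :
    MvPolynomial.aeval (Fin.cons t c : Fin (n + 1) → ℝ) g =
      (MvPolynomial.finSuccEquiv RealAlg n g).eval₂
        (MvPolynomial.aeval (R := RealAlg) c : MvPolynomial (Fin n) RealAlg →+* ℝ) t := by
  induction g using MvPolynomial.induction_on with
  | C a => simp [MvPolynomial.finSuccEquiv_apply]
  | add p q hp hq => rw [map_add, hp, hq, map_add, Polynomial.eval₂_add]
  | mul_X p i hp =>
    rw [map_mul, hp, map_mul, Polynomial.eval₂_mul]
    congr 1
    refine Fin.cases ?_ (fun j => ?_) i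
    · simp [MvPolynomial.finSuccEquiv_X_zero]
    · simp [MvPolynomial.finSuccEquiv_X_succ]

theorem exists_algebraic_specialization {n : ℕ} (b : Fin n → ℝ) {ε : ℝ} (hε : 0 < ε) :
    ∃ b' : Fin n → RealAlg, (∀ i, |(b' i : ℝ) - b i| < ε) ∧
      ∀ g : MvPolynomial (Fin n) RealAlg, MvPolynomial.aeval b g = 0 →
        MvPolynomial.aeval (fun i => (b' i : ℝ)) g = 0 := by
  induction n generalizing ε with
  | zero => exact ⟨Fin.elim0, fun i => i.elim0, fun g hg => by convert hg⟩
  | succ n ih =>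
    obtain ⟨t, c, rfl⟩ : ∃ t c, b = Fin.cons t c := ⟨b 0, Fin.tail b, (Fin.cons_self_tail b).symm⟩
    let φ : (Fin n → ℝ) → MvPolynomial (Fin n) RealAlg →+* ℝ := fun c =>
      (MvPolynomial.aeval (R := RealAlg) c : MvPolynomial (Fin n) RealAlg →+* ℝ)
    suffices H : ∃ (c' : Fin n → RealAlg) (t' : RealAlg), (∀ i, |(c' i : ℝ) - c i| < ε) ∧
        |(t' : ℝ) - t| < ε ∧ ∀ Q : Polynomial (MvPolynomial (Fin n) RealAlg),
          Q.eval₂ (φ c) t = 0 → Q.eval₂ (φ fun i => c' i) t' = 0 by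
      obtain ⟨c', t', hc', ht', hQ⟩ := H
      refine ⟨Fin.cons t' c', fun i => ?_, fun g hg => ?_⟩
      · refine Fin.cases ?_ (fun j => ?_) i
        · simpa using ht'
        · simpa using hc' j
      · have : (fun i => ((Fin.cons t' c' : Fin (n + 1) → RealAlg) i : ℝ)) =
            Fin.cons (t' : ℝ) fun i => (c' i : ℝ) := by
          funext i
          refine Fin.cases ?_ (fun j => ?_) i <;> simp
        rw [this, MvPolynomial.aeval_cons]
        rw [MvPolynomial.aeval_cons] at hg
        exact hQ _ hg
    by_cases hrel : ∃ Q : Polynomial (MvPolynomial (Fin n) RealAlg),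
        Q.eval₂ (φ c) t = 0 ∧ Q.map (φ c) ≠ 0
    · obtain ⟨Q, hQ, hQ0⟩ := hrel
      obtain ⟨P, hP⟩ := exists_isMinimalRelation hQ hQ0
      have heval := hP.eval
      rw [Polynomial.eval₂_eq_eval_map] at heval
      obtain ⟨x, y, hx, hxy, hy, hneg⟩ :=
        exists_sign_change heval hP.eval_derivative_ne_zero hε
      have hcont : ∀ (s : ℝ) (Q : Polynomial (MvPolynomial (Fin n) RealAlg)),
          Continuous fun c : Fin n → ℝ => Q.eval₂ (φ c) s := by
        intro s Q
        simp only [Polynomial.eval₂_eq_sum_range]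
        refine continuous_finsetSum _ fun i _ => ?_
        exact (MvPolynomial.continuous_aeval_real _).mul continuous_const
      have e1 : ∀ᶠ d : Fin n → ℝ in 𝓝 c, P.eval₂ (φ d) x * P.eval₂ (φ d) y < 0 := by
        rw [← Polynomial.eval₂_eq_eval_map, ← Polynomial.eval₂_eq_eval_map] at hneg
        exact ((hcont x P).mul (hcont y P)).continuousAt.eventually (gt_mem_nhds hneg)
      have e2 : ∀ᶠ d : Fin n → ℝ in 𝓝 c, φ d P.leadingCoeff ≠ 0 :=
        (MvPolynomial.continuous_aeval_real P.leadingCoeff).continuousAt.eventually_ne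
          hP.map_leadingCoeff_ne_zero
      obtain ⟨δ, hδ, hball⟩ := Metric.eventually_nhds_iff.1 (e1.and e2)
      obtain ⟨c', hc', hker⟩ := ih c (lt_min hε hδ)
      obtain ⟨h1, h2⟩ := hball (y := fun i => (c' i : ℝ)) ((dist_pi_lt_iff hδ).2 fun i => by
        rw [Real.dist_eq]; exact (hc' i).trans_le (min_le_right _ _))
      simp only [Polynomial.eval₂_eq_eval_map] at h1
      obtain ⟨t', hxt, hty, ht0⟩ := exists_root_of_mul_neg hxy h1
      rw [← Polynomial.eval₂_eq_eval_map] at ht0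
      have halg : IsAlgebraic ℚ t' := by
        have hK : IsAlgebraic RealAlg t' := by
          refine ⟨P.map (MvPolynomial.aeval (R := RealAlg) c' :
            MvPolynomial (Fin n) RealAlg →+* RealAlg), ?_, ?_⟩
          · intro h0
            refine h2 ?_
            have := congrArg (fun q => algebraMap RealAlg ℝ (q.coeff P.natDegree)) h0
            simp only [Polynomial.coeff_map, Polynomial.coeff_natDegree, Polynomial.coeff_zero,
              map_zero] at this
            rw [← this]
            exact MvPolynomial.aeval_algebraMap_apply ℝ c' P.leadingCoeff
          · rw [Polynomial.aeval_def, Polynomial.eval₂_map, ← ht0]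
            congr 1
            ext r
            · simp [φ]
            · simp [φ]
        have := isAlgebraic_realAlg
        exact hK.restrictScalars ℚ
      refine ⟨c', ⟨t', mem_algebraicClosure_iff.2 halg⟩,
        fun i => (hc' i).trans_le (min_le_left _ _), ?_, fun Q hQ =>
          hP.eval₂_eq_zero hker h2 ht0 Q hQ⟩
      rw [abs_lt]
      constructor <;> simp only <;> linarith
    · push Not at hrel
      obtain ⟨c', hc', hker⟩ := ih c hε
      obtain ⟨q, hq1, hq2⟩ := exists_rat_btwn (show t - ε < t + ε by linarith)
      refine ⟨c', (q : RealAlg), hc', ?_, fun Q hQ => ?_⟩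
      · rw [abs_lt]
        push_cast
        constructor <;> linarith
      · have h0 : Q.map (φ fun i => (c' i : ℝ)) = 0 := by
          ext i
          rw [Polynomial.coeff_map, Polynomial.coeff_zero]
          refine hker _ ?_
          have := congrArg (fun q => q.coeff i) (hrel Q hQ)
          rwa [Polynomial.coeff_map, Polynomial.coeff_zero] at this
        rw [Polynomial.eval₂_eq_eval_map, h0, Polynomial.eval_zero]

end

section

open Filter Topology

/-! ### Stability of computations under specialization -/

section Specialization

variable {ι : Type*}

/-- The filter of the points near `b` at which all polynomials with algebraic coefficients that
vanish at `b` vanish. -/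
def specializationFilter (b : ι → ℝ) : Filter (ι → ℝ) :=
  𝓝 b ⊓ 𝓟 {b' | ∀ g : MvPolynomial ι RealAlg,
    MvPolynomial.aeval b g = 0 → MvPolynomial.aeval b' g = 0}

theorem self_of_eventually {b : ι → ℝ} {Q : (ι → ℝ) → Prop}
    (h : ∀ᶠ b' in specializationFilter b, Q b') : Q b := by
  have : pure b ≤ specializationFilter b :=
    le_inf (pure_le_nhds b) (by rw [le_principal_iff, mem_pure]; exact fun g hg => hg)
  exact this h

theorem exists_algebraic_of_eventually [Fintype ι] {b : ι → ℝ} {Q : (ι → ℝ) → Prop}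
    (h : ∀ᶠ b' in specializationFilter b, Q b') :
    ∃ b' : ι → ℝ, (∀ i, IsAlgebraic ℚ (b' i)) ∧ Q b' := by
  rw [specializationFilter, eventually_inf_principal] at h
  obtain ⟨ε, hε, hQ⟩ := Metric.eventually_nhds_iff.1 h
  let e := Fintype.equivFin ι
  obtain ⟨c, hc, hg⟩ := exists_algebraic_specialization (b ∘ e.symm) hε
  refine ⟨fun i => c (e i), fun i => mem_algebraicClosure_iff.1 (c (e i)).2, hQ ?_ ?_⟩
  · refine (dist_pi_lt_iff hε).2 fun i => ?_
    simpa [Real.dist_eq] using hc (e i)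
  · intro g h0
    have h1 := hg (MvPolynomial.rename e g) (by
      rw [MvPolynomial.aeval_rename]
      have : (b ∘ e.symm) ∘ e = b := by ext i; simp
      rwa [this])
    rwa [MvPolynomial.aeval_rename] at h1

/-- `f` is given by a rational function with algebraic coefficients, defined at `b`, at all points
near `b` that specialize `b`. -/
def IsRegularAt (b : ι → ℝ) (f : (ι → ℝ) → ℝ) : Prop :=
  ∃ num den : MvPolynomial ι RealAlg, MvPolynomial.aeval b den ≠ 0 ∧
    ∀ᶠ b' in specializationFilter b,
      f b' = MvPolynomial.aeval b' num / MvPolynomial.aeval b' den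

theorem eventually_aeval_ne_zero {b : ι → ℝ} {g : MvPolynomial ι RealAlg}
    (h : MvPolynomial.aeval b g ≠ 0) :
    ∀ᶠ b' in specializationFilter b, MvPolynomial.aeval b' g ≠ 0 :=
  ((MvPolynomial.continuous_aeval_real g).continuousAt.eventually_ne h).filter_mono inf_le_left

namespace IsRegularAt

variable {b : ι → ℝ} {f g : (ι → ℝ) → ℝ}

theorem const {a : ℝ} (ha : IsAlgebraic ℚ a) : IsRegularAt b fun _ => a :=
  ⟨MvPolynomial.C ⟨a, mem_algebraicClosure_iff.2 ha⟩, 1, by simp, by simp⟩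

theorem coord (i : ι) : IsRegularAt b fun b' => b' i :=
  ⟨MvPolynomial.X i, 1, by simp, by simp⟩

theorem add (hf : IsRegularAt b f) (hg : IsRegularAt b g) :
    IsRegularAt b fun b' => f b' + g b' := by
  obtain ⟨n1, d1, h1, hf⟩ := hf
  obtain ⟨n2, d2, h2, hg⟩ := hg
  refine ⟨n1 * d2 + d1 * n2, d1 * d2, by simp [h1, h2], ?_⟩
  filter_upwards [hf, hg, eventually_aeval_ne_zero h1, eventually_aeval_ne_zero h2] with
    b' e1 e2 e3 e4
  rw [e1, e2, map_add, map_mul, map_mul, map_mul, div_add_div _ _ e3 e4]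

theorem mul (hf : IsRegularAt b f) (hg : IsRegularAt b g) :
    IsRegularAt b fun b' => f b' * g b' := by
  obtain ⟨n1, d1, h1, hf⟩ := hf
  obtain ⟨n2, d2, h2, hg⟩ := hg
  refine ⟨n1 * n2, d1 * d2, by simp [h1, h2], ?_⟩
  filter_upwards [hf, hg] with b' e1 e2
  rw [e1, e2, map_mul, map_mul, div_mul_div_comm]

theorem inv (hf : IsRegularAt b f) (h0 : f b ≠ 0) : IsRegularAt b fun b' => (f b')⁻¹ := by
  obtain ⟨n1, d1, h1, hf⟩ := hf
  refine ⟨d1, n1, ?_, ?_⟩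
  · rw [self_of_eventually hf] at h0
    exact (div_ne_zero_iff.1 h0).1
  · filter_upwards [hf] with b' e1
    rw [e1, inv_div]

theorem div (hf : IsRegularAt b f) (hg : IsRegularAt b g) (h0 : g b ≠ 0) :
    IsRegularAt b fun b' => f b' / g b' := by
  simpa only [div_eq_mul_inv] using hf.mul (hg.inv h0)

theorem eval {σ : (ι → ℝ) → ℤ →₀ ℝ} (hσ : ∀ i, IsRegularAt b fun b' => σ b' i)
    {p : MvPolynomial ℤ ℝ} (hp : ∀ m ∈ p.support, IsAlgebraic ℚ (p.coeff m)) :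
    IsRegularAt b fun b' => MvPolynomial.eval (σ b') p :=
  MvPolynomial.eval_mem_of_closed (C := IsRegularAt b) (fun _ => const) (fun _ _ => add)
    (fun _ _ => mul) hσ hp

theorem tendsto (hf : IsRegularAt b f) : Tendsto f (specializationFilter b) (𝓝 (f b)) := by
  obtain ⟨n1, d1, h1, hf⟩ := hf
  rw [self_of_eventually hf]
  refine Tendsto.congr' (EventuallyEq.symm hf) (Tendsto.mono_left ?_ inf_le_left)
  exact ((MvPolynomial.continuous_aeval_real n1).tendsto b).div
    ((MvPolynomial.continuous_aeval_real d1).tendsto b) h1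

theorem eventually_eq_zero (hf : IsRegularAt b f) (h0 : f b = 0) :
    ∀ᶠ b' in specializationFilter b, f b' = 0 := by
  obtain ⟨n1, d1, h1, hf⟩ := hf
  rw [self_of_eventually hf] at h0
  have h2 := (div_eq_zero_iff.1 h0).resolve_right h1
  filter_upwards [hf, (mem_inf_of_right (mem_principal_self _) :
    _ ∈ specializationFilter b)] with b' e1 e2
  rw [e1, e2 n1 h2, zero_div]

theorem eventually_ne_zero (hf : IsRegularAt b f) (h0 : f b ≠ 0) :
    ∀ᶠ b' in specializationFilter b, f b' ≠ 0 := hf.tendsto.eventually_ne h0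

theorem eventually_neg (hf : IsRegularAt b f) (h0 : f b < 0) :
    ∀ᶠ b' in specializationFilter b, f b' < 0 := hf.tendsto.eventually (gt_mem_nhds h0)

theorem eventually_nonneg (hf : IsRegularAt b f) (h0 : 0 ≤ f b) :
    ∀ᶠ b' in specializationFilter b, 0 ≤ f b' := by
  rcases h0.eq_or_lt with h0 | h0
  · filter_upwards [hf.eventually_eq_zero h0.symm] with b' h
    exact h.ge
  · filter_upwards [hf.tendsto.eventually (lt_mem_nhds h0)] with b' h
    exact h.le

end IsRegularAt

namespace BSSMachine

variable (M : BSSMachine) {b : ι → ℝ}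

theorem exists_regular_step (hM : M.ParamsIn {r : ℝ | IsAlgebraic ℚ r}) {k : Fin M.size}
    {σ : (ι → ℝ) → ℤ →₀ ℝ} (hσ : ∀ i, IsRegularAt b fun b' => σ b' i)
    {d : Fin M.size × (ℤ →₀ ℝ)} (hd : M.Step (k, σ b) d) :
    ∃ σ' : (ι → ℝ) → ℤ →₀ ℝ, (∀ i, IsRegularAt b fun b' => σ' b' i) ∧
      ∀ᶠ b' in specializationFilter b, M.Step (k, σ b') (d.1, σ' b') := by
  classical
  have hk := hM k
  rcases hnode : M.node k with ⟨S, num, den, next⟩ | ⟨h, neg, nonneg⟩ | ⟨next⟩ | ⟨next⟩ | _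
  · simp only [hnode] at hk
    simp only [Step, hnode] at hd ⊢
    let σ' : (ι → ℝ) → ℤ →₀ ℝ := fun b' => Finsupp.onFinset (S ∪ (σ b').support)
      (fun i => if i ∈ S then MvPolynomial.eval (σ b') (num i) / MvPolynomial.eval (σ b') (den i)
        else σ b' i) (fun i hi => by
          by_cases hiS : i ∈ S
          · simp [hiS]
          · simpa [hiS] using hi)
    have hσ' : ∀ b' i, σ' b' i = if i ∈ S then
        MvPolynomial.eval (σ b') (num i) / MvPolynomial.eval (σ b') (den i) else σ b' i :=
      fun _ _ => rfl
    refine ⟨σ', fun i => ?_, ?_⟩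
    · simp only [hσ']
      by_cases hi : i ∈ S
      · simp only [if_pos hi]
        exact (IsRegularAt.eval hσ (hk i hi).1).div (IsRegularAt.eval hσ (hk i hi).2)
          (hd.2.1 i hi).1
      · simpa only [if_neg hi] using hσ i
    · have hden : ∀ᶠ b' in specializationFilter b, ∀ i ∈ S,
          MvPolynomial.eval (σ b') (den i) ≠ 0 :=
        (Filter.eventually_all_finset S).2 fun i hi =>
          (IsRegularAt.eval hσ (hk i hi).2).eventually_ne_zero (hd.2.1 i hi).1
      filter_upwards [hden] with b' hb'
      exact ⟨hd.1, fun i hi => ⟨hb' i hi, by rw [hσ', if_pos hi]⟩,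
        fun i hi => by rw [hσ', if_neg hi]⟩
  · simp only [hnode] at hk
    simp only [Step, hnode] at hd ⊢
    refine ⟨σ, hσ, ?_⟩
    rcases le_or_gt 0 (MvPolynomial.eval (σ b) h) with h0 | h0
    · filter_upwards [(IsRegularAt.eval hσ hk).eventually_nonneg h0] with b' hb'
      exact ⟨fun _ => hd.1 h0, fun hn => (hn.not_ge hb').elim, rfl⟩
    · filter_upwards [(IsRegularAt.eval hσ hk).eventually_neg h0] with b' hb'
      exact ⟨fun hn => (hb'.not_ge hn).elim, fun _ => hd.2.1 h0, rfl⟩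
  · simp only [Step, hnode] at hd ⊢
    exact ⟨fun b' => (σ b').equivMapDomain (Equiv.subRight 1), fun i => hσ (i + 1),
      Eventually.of_forall fun b' => ⟨hd.1, fun i => rfl⟩⟩
  · simp only [Step, hnode] at hd ⊢
    exact ⟨fun b' => (σ b').equivMapDomain (Equiv.addRight 1), fun i => hσ (i + -1),
      Eventually.of_forall fun b' => ⟨hd.1, fun i => rfl⟩⟩
  · simp [Step, hnode] at hd

theorem eventually_reaches (hM : M.ParamsIn {r : ℝ | IsAlgebraic ℚ r})
    {c d : Fin M.size × (ℤ →₀ ℝ)} (h : Relation.ReflTransGen M.Step c d) :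
    ∀ σ : (ι → ℝ) → ℤ →₀ ℝ, (∀ i, IsRegularAt b fun b' => σ b' i) → σ b = c.2 →
    ∀ᶠ b' in specializationFilter b, ∃ s, Relation.ReflTransGen M.Step (c.1, σ b') (d.1, s) := by
  refine h.head_induction_on ?_ ?_
  · exact fun σ _ _ => Eventually.of_forall fun b' => ⟨σ b', .refl⟩
  · intro c e hce _ ih σ hσ hc
    obtain ⟨k, s⟩ := c
    obtain rfl : σ b = s := hc
    obtain ⟨σ', hσ', hstep⟩ := M.exists_regular_step hM hσ hce
    have he : (e.1, σ' b) = e := M.step_unique (self_of_eventually hstep) hce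
    filter_upwards [hstep, ih σ' hσ' (congrArg Prod.snd he)] with b' h1 ⟨s, h2⟩
    exact ⟨s, .head h1 h2⟩

theorem inputState_apply (x : List ℝ) (i : ℤ) : inputState x i =
    if 1 ≤ i then x.getD (i - 1).toNat 0 else if -(x.length : ℤ) < i then 1 else 0 := rfl

theorem isRegularAt_inputState {l : List ((ι → ℝ) → ℝ)} (hl : ∀ f ∈ l, IsRegularAt b f) (i : ℤ) :
    IsRegularAt b fun b' => inputState (l.map fun f => f b') i := by
  simp only [inputState_apply, List.length_map]
  by_cases h1 : 1 ≤ i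
  · simp only [if_pos h1]
    rcases lt_or_ge (i - 1).toNat l.length with h | h
    · have : ∀ b', (l.map fun f => f b').getD (i - 1).toNat 0 = l[(i - 1).toNat] b' :=
        fun b' => by
          rw [List.getD_eq_getElem _ _ (by simpa using h), List.getElem_map]
      simp only [this]
      exact hl _ (List.getElem_mem h)
    · have : ∀ b', (l.map fun f => f b').getD (i - 1).toNat 0 = 0 :=
        fun b' => List.getD_eq_default _ _ (by simpa using h)
      simp only [this]
      exact .const isAlgebraic_zero
  · simp only [if_neg h1]
    by_cases h2 : -(l.length : ℤ) < i
    · simp only [if_pos h2]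
      exact .const isAlgebraic_one
    · simp only [if_neg h2]
      exact .const isAlgebraic_zero

/-- Halting is stable under specialization of the input. -/
theorem eventually_halts (hM : M.ParamsIn {r : ℝ | IsAlgebraic ℚ r}) {l : List ((ι → ℝ) → ℝ)}
    (hl : ∀ f ∈ l, IsRegularAt b f) (h : M.Halts (l.map fun f => f b)) :
    ∀ᶠ b' in specializationFilter b, M.Halts (l.map fun f => f b') := by
  obtain ⟨s, k, hk, hs⟩ := h
  obtain ⟨σ, hσ⟩ : ∃ σ : (ι → ℝ) → ℤ →₀ ℝ, ∀ b', inputState (l.map fun f => f b') = σ b' :=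
    ⟨_, fun _ => rfl⟩
  have hreg := isRegularAt_inputState hl
  simp only [hσ] at hs hreg
  filter_upwards [M.eventually_reaches hM hs σ hreg rfl] with b' ⟨s', hs'⟩
  exact ⟨s', k, hk, hσ b' ▸ hs'⟩

end BSSMachine

end Specialization

end

section

open Filter Topology

/-! ### Codes of literals -/

namespace Literal

variable {L : FirstOrder.Language.{u, v}} {Y Z : Type*}

/-- The first entry of the code of a literal. -/
def tag : Literal L Y → ℕ
  | .eq _ _ => 0
  | .ne _ _ => 1
  | .rel _ _ => 2
  | .notRel _ _ => 3

/-- Renaming of the names in a literal. -/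
def relabel (g : Y → Z) : Literal L Y → Literal L Z
  | .eq t₁ t₂ => .eq (t₁.relabel g) (t₂.relabel g)
  | .ne t₁ t₂ => .ne (t₁.relabel g) (t₂.relabel g)
  | .rel P ts => .rel P fun i => (ts i).relabel g
  | .notRel P ts => .notRel P fun i => (ts i).relabel g

end Literal

theorem List.flatten_ofFn_injective {T R : Type*} {enc : T → List R} {n : ℕ} {ts ts' : Fin n → T}
    (h : ∀ i, ∀ t' r r', enc (ts i) ++ r = enc t' ++ r' → ts i = t' ∧ r = r') {r r' : List R}
    (hr : (List.ofFn fun i => enc (ts i)).flatten ++ r =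
      (List.ofFn fun i => enc (ts' i)).flatten ++ r') : ts = ts' ∧ r = r' := by
  induction n with
  | zero => exact ⟨funext fun i => i.elim0, by simpa using hr⟩
  | succ n ih =>
    simp only [List.ofFn_succ, List.flatten_cons, List.append_assoc] at hr
    obtain ⟨h0, hr⟩ := h 0 _ _ _ hr
    obtain ⟨h1, hr⟩ := ih (ts := fun i => ts i.succ) (ts' := fun i => ts' i.succ)
      (fun i => h i.succ) hr
    exact ⟨funext (Fin.cases h0 fun i => congrFun h1 i), hr⟩

namespace SymbolIndexing

variable {L : FirstOrder.Language.{u, v}} (c : SymbolIndexing L)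
variable {R R' Y Z : Type*} [Semiring R] [Semiring R']

theorem encodeTerm_relabel (e : Z → List R) (g : Y → Z) (t : L.Term Y) :
    c.encodeTerm e (t.relabel g) = c.encodeTerm (e ∘ g) t := by
  induction t with
  | var y => rfl
  | func f ts ih =>
    simp only [Language.Term.relabel, encodeTerm]
    simp only [ih]

theorem encodeLiteral_relabel (e : Z → List R) (g : Y → Z) (φ : Literal L Y) :
    c.encodeLiteral e (φ.relabel g) = c.encodeLiteral (e ∘ g) φ := by
  cases φ <;> simp only [Literal.relabel, encodeLiteral, encodeTerm_relabel]

theorem map_encodeTerm (h : R →+* R') (e : Y → List R) (t : L.Term Y) :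
    (c.encodeTerm e t).map h = c.encodeTerm (fun y => (e y).map h) t := by
  induction t with
  | var y => simp [encodeTerm]
  | func f ts ih => simp [encodeTerm, List.map_flatten, List.map_ofFn, Function.comp_def, ih]

theorem map_encodeLiteral (h : R →+* R') (e : Y → List R) (φ : Literal L Y) :
    (c.encodeLiteral e φ).map h = c.encodeLiteral (fun y => (e y).map h) φ := by
  cases φ <;> simp [encodeLiteral, List.map_flatten, List.map_ofFn, Function.comp_def,
    map_encodeTerm]
  · exact map_ofNat h 2
  · exact map_ofNat h 3

theorem forall_mem_encodeTerm {C : R → Prop} (h0 : C 0) (h1 : C 1)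
    (hadd : ∀ x y, C x → C y → C (x + y))
    {e : Y → List R} (he : ∀ y, ∀ x ∈ e y, C x) (t : L.Term Y) : ∀ x ∈ c.encodeTerm e t, C x := by
  have hnat : ∀ n : ℕ, C n := fun n => by
    induction n with
    | zero => simpa using h0
    | succ n ih => simpa using hadd _ _ ih h1
  induction t with
  | var y => simpa [encodeTerm, h0, hnat] using he y
  | func f ts ih =>
    simp only [encodeTerm, List.mem_cons, List.mem_flatten, List.mem_ofFn]
    rintro x (rfl | rfl | ⟨_, ⟨i, rfl⟩, hx⟩)
    exacts [h1, hnat _, ih i x hx]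

theorem forall_mem_encodeLiteral {C : R → Prop} (h0 : C 0) (h1 : C 1)
    (hadd : ∀ x y, C x → C y → C (x + y)) {e : Y → List R} (he : ∀ y, ∀ x ∈ e y, C x)
    (φ : Literal L Y) : ∀ x ∈ c.encodeLiteral e φ, C x := by
  have hnat : ∀ n : ℕ, C n := fun n => by
    induction n with
    | zero => simpa using h0
    | succ n ih => simpa using hadd _ _ ih h1
  have ht := c.forall_mem_encodeTerm h0 h1 hadd he
  cases φ <;> simp only [encodeLiteral, List.mem_cons, List.mem_append, List.mem_flatten,
    List.mem_ofFn]
  · rintro x (rfl | hx | hx)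
    exacts [h0, ht _ x hx, ht _ x hx]
  · rintro x (rfl | hx | hx)
    exacts [h1, ht _ x hx, ht _ x hx]
  · rintro x (rfl | rfl | ⟨_, ⟨i, rfl⟩, hx⟩)
    exacts [by exact_mod_cast hnat 2, hnat _, ht _ x hx]
  · rintro x (rfl | rfl | ⟨_, ⟨i, rfl⟩, hx⟩)
    exacts [by exact_mod_cast hnat 3, hnat _, ht _ x hx]

section UniqueReadability

variable [CharZero R]

/-- Unique readability of terms whose names are lists. -/
theorem encodeTerm_id_injective (t t' : L.Term (List R)) (r r' : List R)
    (h : c.encodeTerm id t ++ r = c.encodeTerm id t' ++ r') : t = t' ∧ r = r' := by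
  induction t generalizing t' r r' with
  | var a =>
    cases t' with
    | var a' =>
      simp only [encodeTerm, id, List.cons_append, List.cons.injEq, Nat.cast_inj, true_and] at h
      obtain ⟨rfl, rfl⟩ := List.append_inj h.2 h.1
      exact ⟨rfl, rfl⟩
    | func f ts => simp [encodeTerm] at h
  | @func n f ts ih =>
    cases t' with
    | var a' => simp [encodeTerm] at h
    | @func n' f' ts' =>
      simp only [encodeTerm, List.cons_append, List.cons.injEq, Nat.cast_inj, true_and] at h
      have hf := c.funIndex_injective h.1
      obtain ⟨rfl, hf⟩ := Sigma.mk.inj hf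
      obtain rfl := eq_of_heq hf
      obtain ⟨rfl, rfl⟩ := List.flatten_ofFn_injective (enc := c.encodeTerm id) (fun i => ih i) h.2
      exact ⟨rfl, rfl⟩

theorem head?_encodeLiteral (e : Y → List R) (φ : Literal L Y) :
    (c.encodeLiteral e φ).head? = some (φ.tag : R) := by
  cases φ <;> simp [encodeLiteral, Literal.tag]

theorem encodeLiteral_id_injective :
    Function.Injective (c.encodeLiteral (id : List R → List R)) := by
  have heq : ∀ t₁ t₂ s₁ s₂ : L.Term (List R), c.encodeTerm id t₁ ++ c.encodeTerm id t₂ =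
      c.encodeTerm id s₁ ++ c.encodeTerm id s₂ → t₁ = s₁ ∧ t₂ = s₂ := by
    intro t₁ t₂ s₁ s₂ h
    obtain ⟨h1, h2⟩ := c.encodeTerm_id_injective _ _ _ _ h
    exact ⟨h1, (c.encodeTerm_id_injective t₂ s₂ [] [] (by simpa using h2)).1⟩
  have hrel : ∀ {n n' : ℕ} (P : L.Relations n) (P' : L.Relations n') (ts : Fin n → L.Term (List R))
      (ts' : Fin n' → L.Term (List R)),
      ((c.relIndex ⟨n, P⟩ : R) :: (List.ofFn fun i => c.encodeTerm id (ts i)).flatten) =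
      ((c.relIndex ⟨n', P'⟩ : R) :: (List.ofFn fun i => c.encodeTerm id (ts' i)).flatten) →
      (⟨n, P, ts⟩ : Σ n, L.Relations n × (Fin n → L.Term (List R))) = ⟨n', P', ts'⟩ := by
    intro n n' P P' ts ts' h
    simp only [List.cons.injEq, Nat.cast_inj] at h
    obtain ⟨rfl, hP⟩ := Sigma.mk.inj (c.relIndex_injective h.1)
    obtain rfl := eq_of_heq hP
    obtain ⟨rfl, -⟩ := List.flatten_ofFn_injective (enc := c.encodeTerm id) (r := []) (r' := [])
      (fun i => c.encodeTerm_id_injective (ts i)) (by simpa using h.2)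
    rfl
  intro φ ψ h
  have htag : φ.tag = ψ.tag := by
    have := congrArg List.head? h
    rw [head?_encodeLiteral, head?_encodeLiteral, Option.some.injEq] at this
    exact_mod_cast this
  cases φ <;> cases ψ <;> try (exfalso; simp only [Literal.tag] at htag; omega)
  · obtain ⟨rfl, rfl⟩ := heq _ _ _ _ (List.cons.inj h).2
    rfl
  · obtain ⟨rfl, rfl⟩ := heq _ _ _ _ (List.cons.inj h).2
    rfl
  · obtain ⟨rfl, h⟩ := Sigma.mk.inj (hrel _ _ _ _ (List.cons.inj h).2)
    obtain ⟨rfl, rfl⟩ := Prod.mk.inj (eq_of_heq h)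
    rfl
  · obtain ⟨rfl, h⟩ := Sigma.mk.inj (hrel _ _ _ _ (List.cons.inj h).2)
    obtain ⟨rfl, rfl⟩ := Prod.mk.inj (eq_of_heq h)
    rfl

/-- Unique readability of literals. -/
theorem encodeLiteral_eq_iff {e : Y → List R} {e' : Z → List R} {φ : Literal L Y}
    {ψ : Literal L Z} :
    c.encodeLiteral e φ = c.encodeLiteral e' ψ ↔ φ.relabel e = ψ.relabel e' := by
  rw [← c.encodeLiteral_id_injective.eq_iff, encodeLiteral_relabel, encodeLiteral_relabel]
  rfl

end UniqueReadability

end SymbolIndexing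

end

section

open Filter Topology

/-! ### The substructure of algebraic elements -/

theorem FirstOrder.Language.Term.relabel_injective_of_injective {L : FirstOrder.Language.{u, v}}
    {Y Z : Type*} {g : Y → Z} (hg : Function.Injective g) :
    Function.Injective (Language.Term.relabel g : L.Term Y → L.Term Z) := by
  intro t t' h
  induction t generalizing t' with
  | var y =>
    cases t' with
    | var y' => exact congrArg _ (hg (Language.Term.var.inj h))
    | func f ts => cases h
  | @func n f ts ih =>
    cases t' with
    | var y' => cases h
    | @func n' f' ts' =>
      obtain ⟨rfl, h1, h2⟩ := Language.Term.func.inj h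
      obtain rfl := eq_of_heq h1
      exact congrArg _ (funext fun i => ih i (congrFun (eq_of_heq h2) i))

theorem FirstOrder.Language.Substructure.realize_term_coe {L : FirstOrder.Language.{u, v}}
    {B Y : Type*} [L.Structure B] {S : L.Substructure B} (t : L.Term Y) (w : Y → S) :
    t.realize (fun y => (w y : B)) = (t.realize w : S) :=
  Language.HomClass.realize_term S.subtype

namespace Literal

variable {L : FirstOrder.Language.{u, v}} {Y Z : Type*}

theorem relabel_injective {g : Y → Z} (hg : Function.Injective g) :
    Function.Injective (relabel g : Literal L Y → Literal L Z) := by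
  have ht := Language.Term.relabel_injective_of_injective (L := L) hg
  intro φ ψ h
  cases φ with
  | eq t₁ t₂ =>
    cases ψ <;> simp only [relabel, reduceCtorEq] at h
    obtain ⟨h1, h2⟩ := Literal.eq.inj h
    rw [ht h1, ht h2]
  | ne t₁ t₂ =>
    cases ψ <;> simp only [relabel, reduceCtorEq] at h
    obtain ⟨h1, h2⟩ := Literal.ne.inj h
    rw [ht h1, ht h2]
  | rel P ts =>
    cases ψ <;> simp only [relabel, reduceCtorEq] at h
    obtain ⟨rfl, h1, h2⟩ := Literal.rel.inj h
    obtain rfl := eq_of_heq h1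
    exact congrArg _ (funext fun i => ht (congrFun (eq_of_heq h2) i))
  | notRel P ts =>
    cases ψ <;> simp only [relabel, reduceCtorEq] at h
    obtain ⟨rfl, h1, h2⟩ := Literal.notRel.inj h
    obtain rfl := eq_of_heq h1
    exact congrArg _ (funext fun i => ht (congrFun (eq_of_heq h2) i))

variable {B : Type*} [L.Structure B]

theorem holds_relabel_eq {t₁ t₂ : L.Term Y} {w : Y → B} :
    ((Literal.eq t₁ t₂).relabel w).Holds ↔ t₁.realize w = t₂.realize w := by
  simp [relabel, Holds, Language.Term.realize_relabel]

theorem holds_relabel_ne {t₁ t₂ : L.Term Y} {w : Y → B} :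
    ((Literal.ne t₁ t₂).relabel w).Holds ↔ t₁.realize w ≠ t₂.realize w := by
  simp [relabel, Holds, Language.Term.realize_relabel]

theorem holds_relabel_rel {n : ℕ} {P : L.Relations n} {ts : Fin n → L.Term Y} {w : Y → B} :
    ((Literal.rel P ts).relabel w).Holds ↔
      Language.Structure.RelMap P fun i => (ts i).realize w := by
  simp [relabel, Holds, Language.Term.realize_relabel]

theorem holds_relabel_notRel {n : ℕ} {P : L.Relations n} {ts : Fin n → L.Term Y} {w : Y → B} :
    ((Literal.notRel P ts).relabel w).Holds ↔
      ¬ Language.Structure.RelMap P fun i => (ts i).realize w := by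
  simp [relabel, Holds, Language.Term.realize_relabel]

end Literal

namespace SymbolIndexing

variable {L : FirstOrder.Language.{u, v}} (c : SymbolIndexing L)

section Diagram

variable {R Y B : Type*} [Semiring R] [CharZero R] [L.Structure B] {e : B → List R}

theorem mem_atomicDiagram_iff (he : Function.Injective e) (w : Y → B) (φ : Literal L Y) :
    c.encodeLiteral (fun y => e (w y)) φ ∈ c.atomicDiagram e ↔ (φ.relabel w).Holds := by
  have hcode : c.encodeLiteral e (φ.relabel w) = c.encodeLiteral (fun y => e (w y)) φ :=
    c.encodeLiteral_relabel e w φ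
  constructor
  · rintro ⟨ψ, hψ, h⟩
    rw [← hcode, encodeLiteral_eq_iff] at h
    rwa [← Literal.relabel_injective he h]
  · exact fun h => ⟨_, h, hcode⟩

theorem mem_range_of_mem_atomicDiagram {f : Y → List R} {y : Y}
    (h : c.encodeLiteral f (.eq (.var y) (.var y)) ∈ c.atomicDiagram e) : f y ∈ Set.range e := by
  obtain ⟨ψ, -, h⟩ := h
  rw [encodeLiteral_eq_iff] at h
  cases ψ with
  | eq t₁ t₂ =>
    have h1 := (Literal.eq.inj h).1
    cases t₁ with
    | var a => exact ⟨a, (Language.Term.var.inj h1)⟩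
    | func => cases h1
  | _ => cases h

end Diagram

variable {A : Set (List ℝ)} [L.Structure A]

/-- The atomic diagram is the halting set of a machine with algebraic parameters. -/
def HasHaltingDiagram (c : SymbolIndexing L) (A : Set (List ℝ)) [L.Structure A] : Prop :=
  ∃ M : BSSMachine, M.ParamsIn {r : ℝ | IsAlgebraic ℚ r} ∧
    ∀ x, M.Halts x ↔ x ∈ c.atomicDiagram (fun a : A => (a : List ℝ))

variable {ι Y : Type*} {b : ι → ℝ} {ξ : Y → List ((ι → ℝ) → ℝ)}

theorem eventually_mem_atomicDiagram (hc : c.HasHaltingDiagram A)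
    (hξ : ∀ y, ∀ f ∈ ξ y, IsRegularAt b f) (φ : Literal L Y)
    (h : c.encodeLiteral (fun y => (ξ y).map fun f => f b) φ ∈
      c.atomicDiagram (fun a : A => (a : List ℝ))) :
    ∀ᶠ b' in specializationFilter b, c.encodeLiteral (fun y => (ξ y).map fun f => f b') φ ∈
      c.atomicDiagram (fun a : A => (a : List ℝ)) := by
  obtain ⟨M, hM, hMD⟩ := hc
  have hmap : ∀ b', c.encodeLiteral (fun y => (ξ y).map fun f => f b') φ =
      (c.encodeLiteral ξ φ).map fun f => f b' :=
    fun b' => (c.map_encodeLiteral (Pi.evalRingHom (fun _ => ℝ) b') ξ φ).symm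
  simp only [← hMD, hmap] at h ⊢
  exact M.eventually_halts hM (c.forall_mem_encodeLiteral (.const isAlgebraic_zero)
    (.const isAlgebraic_one) (fun _ _ => .add) hξ φ) h

theorem eventually_holds (hc : c.HasHaltingDiagram A)
    (hξ : ∀ y, ∀ f ∈ ξ y, IsRegularAt b f) {w : Y → A}
    (hw : ∀ y, (w y : List ℝ) = (ξ y).map fun f => f b) {φ : Literal L Y}
    (h : (φ.relabel w).Holds) :
    ∀ᶠ b' in specializationFilter b, ∀ w' : Y → A,
      (∀ y, (w' y : List ℝ) = (ξ y).map fun f => f b') → (φ.relabel w').Holds := by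
  rw [← c.mem_atomicDiagram_iff Subtype.val_injective] at h
  simp only [hw] at h
  filter_upwards [c.eventually_mem_atomicDiagram hc hξ φ h] with b' hb' w' hw'
  rw [← c.mem_atomicDiagram_iff Subtype.val_injective]
  simpa only [hw'] using hb'

theorem eventually_mem (hc : c.HasHaltingDiagram A)
    (hξ : ∀ y, ∀ f ∈ ξ y, IsRegularAt b f) {y : Y} (hy : ((ξ y).map fun f => f b) ∈ A) :
    ∀ᶠ b' in specializationFilter b, ((ξ y).map fun f => f b') ∈ A := by
  have h0 : c.encodeLiteral (fun _ : Unit => (ξ y).map fun f => f b) (.eq (.var ()) (.var ())) ∈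
      c.atomicDiagram (fun a : A => (a : List ℝ)) :=
    (c.mem_atomicDiagram_iff Subtype.val_injective (fun _ : Unit => (⟨_, hy⟩ : A))
      (.eq (.var ()) (.var ()))).2 rfl
  filter_upwards [c.eventually_mem_atomicDiagram (ξ := fun _ : Unit => ξ y) hc (fun _ => hξ y) _ h0]
    with b' hb'
  simpa using c.mem_range_of_mem_atomicDiagram hb'

/-- The coordinates of finitely many lists, as functions on the space of all coordinates. -/
def coordList {J : Type*} {n : J → ℕ} (j : J) : List (((Σ j, Fin (n j)) → ℝ) → ℝ) :=
  List.ofFn fun k => fun b => b ⟨j, k⟩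

theorem isRegularAt_coordList {J : Type*} {n : J → ℕ} (b : (Σ j, Fin (n j)) → ℝ) (j : J) :
    ∀ f ∈ coordList (n := n) j, IsRegularAt b f := by
  intro f hf
  obtain ⟨k, rfl⟩ := List.mem_ofFn.1 hf
  exact .coord _

theorem map_coordList {J : Type*} (l : J → List ℝ) (j : J) :
    ((coordList (n := fun j => (l j).length) j).map fun f => f fun x => (l x.1).get x.2) = l j := by
  simp [coordList, List.map_ofFn, Function.comp_def]

theorem isRegularAt_map_const {l : List ℝ} (hl : ∀ r ∈ l, IsAlgebraic ℚ r) :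
    ∀ f ∈ l.map fun r (_ : ι → ℝ) => r, IsRegularAt b f := by
  intro f hf
  obtain ⟨r, hr, rfl⟩ := List.mem_map.1 hf
  exact .const (hl r hr)

theorem map_map_const (l : List ℝ) (b' : ι → ℝ) :
    ((l.map fun r (_ : ι → ℝ) => r).map fun f => f b') = l := by
  simp [Function.comp_def]

theorem isAlgebraic_of_mem_map_coordList {J : Type*} {n : J → ℕ} {b' : (Σ j, Fin (n j)) → ℝ}
    (hb' : ∀ i, IsAlgebraic ℚ (b' i)) (j : J) :
    ∀ r ∈ (coordList (n := n) j).map fun f => f b', IsAlgebraic ℚ r := by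
  intro r hr
  obtain ⟨f, hf, rfl⟩ := List.mem_map.1 hr
  obtain ⟨k, rfl⟩ := List.mem_ofFn.1 hf
  exact hb' _

/-- The substructure of the elements with algebraic coordinates. -/
def algebraicSubstructure (hc : c.HasHaltingDiagram A) : L.Substructure A where
  carrier := {a | ∀ r ∈ (a : List ℝ), IsAlgebraic ℚ r}
  fun_mem := by
    intro n f x hx
    let z : A := Language.Structure.funMap f x
    let l : Unit → List ℝ := fun _ => z
    let ξ : Fin n ⊕ Unit → List (((Σ j : Unit, Fin (l j).length) → ℝ) → ℝ) :=
      Sum.elim (fun i => (x i : List ℝ).map fun r _ => r) coordList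
    let b : (Σ j : Unit, Fin (l j).length) → ℝ := fun x => (l x.1).get x.2
    have hξ : ∀ y, ∀ f ∈ ξ y, IsRegularAt b f := by
      rintro (i | j)
      · exact isRegularAt_map_const (hx i)
      · exact isRegularAt_coordList b j
    let w : Fin n ⊕ Unit → A := Sum.elim x fun _ => z
    have hw : ∀ y, (w y : List ℝ) = (ξ y).map fun f => f b := by
      rintro (i | j)
      · exact (map_map_const _ _).symm
      · exact (map_coordList l j).symm
    have hlit : ((Literal.eq (.func f fun i => .var (.inl i)) (.var (.inr ())) :
        Literal L (Fin n ⊕ Unit)).relabel w).Holds := rfl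
    obtain ⟨b', hb', h1, h2⟩ := exists_algebraic_of_eventually
      ((c.eventually_holds hc hξ hw hlit).and (c.eventually_mem (y := .inr ()) hc hξ
        (by rw [← hw]; exact z.2)))
    let w' : Fin n ⊕ Unit → A := Sum.elim x fun _ => ⟨_, h2⟩
    have h3 := h1 w' (by
      rintro (i | j)
      · exact (map_map_const _ _).symm
      · rfl)
    have h4 : z = w' (.inr ()) := h3
    change ∀ r ∈ (z : List ℝ), IsAlgebraic ℚ r
    rw [h4]
    exact isAlgebraic_of_mem_map_coordList hb' ()

theorem eventually_realize_iff (hc : c.HasHaltingDiagram A) (S : L.Substructure A) {α : Type*}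
    {m : ℕ} {ψ : L.BoundedFormula α m} (hψ : ψ.IsQF) {ξ : α ⊕ Fin m → List ((ι → ℝ) → ℝ)}
    (hξ : ∀ y, ∀ f ∈ ξ y, IsRegularAt b f) {w : α ⊕ Fin m → A}
    (hw : ∀ y, (w y : List ℝ) = (ξ y).map fun f => f b) :
    ∀ᶠ b' in specializationFilter b, ∀ w' : α ⊕ Fin m → S,
      (∀ y, ((w' y : A) : List ℝ) = (ξ y).map fun f => f b') →
      (ψ.Realize (w' ∘ .inl) (w' ∘ .inr) ↔ ψ.Realize (w ∘ .inl) (w ∘ .inr)) := by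
  induction hψ with
  | falsum => exact Eventually.of_forall fun b' w' _ => Iff.rfl
  | of_isAtomic h =>
    cases h with
    | equal t₁ t₂ =>
      simp only [Language.BoundedFormula.realize_bdEqual, Sum.elim_comp_inl_inr]
      by_cases h : t₁.realize w = t₂.realize w
      · filter_upwards [c.eventually_holds hc hξ hw (Literal.holds_relabel_eq.2 h)]
          with b' hb' w' hw'
        have := Literal.holds_relabel_eq.1 (hb' (fun y => w' y) hw')
        rw [Language.Substructure.realize_term_coe, Language.Substructure.realize_term_coe] at this
        exact iff_of_true (Subtype.ext this) h
      · filter_upwards [c.eventually_holds hc hξ hw (Literal.holds_relabel_ne.2 h)]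
          with b' hb' w' hw'
        have := Literal.holds_relabel_ne.1 (hb' (fun y => w' y) hw')
        rw [Language.Substructure.realize_term_coe, Language.Substructure.realize_term_coe] at this
        exact iff_of_false (fun h' => this (congrArg _ h')) h
    | rel P ts =>
      simp only [Language.BoundedFormula.realize_rel, Sum.elim_comp_inl_inr]
      have hrel : ∀ w' : α ⊕ Fin m → S, (Language.Structure.RelMap P
          fun i => (ts i).realize fun y => (w' y : A)) ↔
          Language.Structure.RelMap P fun i => (ts i).realize w' := fun w' => by
        simp only [Language.Substructure.realize_term_coe]
        exact Iff.rfl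
      by_cases h : Language.Structure.RelMap P fun i => (ts i).realize w
      · filter_upwards [c.eventually_holds hc hξ hw (Literal.holds_relabel_rel.2 h)]
          with b' hb' w' hw'
        have := Literal.holds_relabel_rel.1 (hb' (fun y => w' y) hw')
        exact iff_of_true ((hrel w').1 this) h
      · filter_upwards [c.eventually_holds hc hξ hw (Literal.holds_relabel_notRel.2 h)]
          with b' hb' w' hw'
        have := Literal.holds_relabel_notRel.1 (hb' (fun y => w' y) hw')
        exact iff_of_false (fun h' => this ((hrel w').2 h')) h
  | imp _ _ ih₁ ih₂ =>
    filter_upwards [ih₁, ih₂] with b' h1 h2 w' hw'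
    simp only [Language.BoundedFormula.realize_imp, h1 w' hw', h2 w' hw']

/-- Witnesses for the quantifiers of an existential formula. -/
theorem _root_.FirstOrder.Language.BoundedFormula.IsExistential.exists_isQF {α B : Type*}
    [L.Structure B] {k : ℕ} {φ : L.BoundedFormula α k} (hφ : φ.IsExistential) (a : α → B)
    (xs : Fin k → B) (h : φ.Realize a xs) :
    ∃ (m : ℕ) (ψ : L.BoundedFormula α m), ψ.IsQF ∧ (∃ ys, ψ.Realize a ys) ∧
      ∀ (S : L.Substructure B) (a' : α → S), (∃ ys, ψ.Realize a' ys) → ∃ xs, φ.Realize a' xs := by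
  induction hφ with
  | of_isQF h' => exact ⟨_, _, h', ⟨xs, h⟩, fun _ _ => id⟩
  | ex _ ih =>
    obtain ⟨x, hx⟩ := Language.BoundedFormula.realize_ex.1 h
    obtain ⟨m, ψ, hψ, hys, hS⟩ := ih _ hx
    refine ⟨m, ψ, hψ, hys, fun S a' ha' => ?_⟩
    obtain ⟨xs', hxs'⟩ := hS S a' ha'
    refine ⟨Fin.init xs', Language.BoundedFormula.realize_ex.2 ⟨xs' (Fin.last _), ?_⟩⟩
    rwa [Fin.snoc_init_self]

theorem leOne_algebraicSubstructure (hc : c.HasHaltingDiagram A) :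
    LeOne (c.algebraicSubstructure hc) := by
  intro n φ hφ a h
  obtain ⟨m, ψ, hψ, ⟨ys, hys⟩, hS⟩ := hφ.exists_isQF _ _ h
  suffices ∃ ys, ψ.Realize a ys by
    obtain ⟨xs, hxs⟩ := hS _ a this
    rwa [Subsingleton.elim xs default] at hxs
  let l : Fin m → List ℝ := fun j => ys j
  let ξ : Fin n ⊕ Fin m → List (((Σ j, Fin (l j).length) → ℝ) → ℝ) :=
    Sum.elim (fun i => ((a i : A) : List ℝ).map fun r _ => r) coordList
  let b : (Σ j, Fin (l j).length) → ℝ := fun x => (l x.1).get x.2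
  have hξ : ∀ y, ∀ f ∈ ξ y, IsRegularAt b f := by
    rintro (i | j)
    · exact isRegularAt_map_const (a i).2
    · exact isRegularAt_coordList b j
  let w : Fin n ⊕ Fin m → A := Sum.elim (fun i => a i) ys
  have hw : ∀ y, (w y : List ℝ) = (ξ y).map fun f => f b := by
    rintro (i | j)
    · exact (map_map_const _ _).symm
    · exact (map_coordList l j).symm
  obtain ⟨b', hb', h1, h2⟩ := exists_algebraic_of_eventually
    ((c.eventually_realize_iff hc (c.algebraicSubstructure hc) hψ hξ hw).and
      (eventually_all.2 fun j : Fin m => c.eventually_mem (y := .inr j) hc hξ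
        (by rw [← hw]; exact (ys j).2)))
  refine ⟨fun j => ⟨⟨_, h2 j⟩, isAlgebraic_of_mem_map_coordList hb' j⟩, ?_⟩
  refine (h1 (Sum.elim a _) ?_).2 hys
  rintro (i | j)
  · exact (map_map_const _ _).symm
  · rfl

end SymbolIndexing

end

/-! ### Codes of literals as sequences of tokens -/

theorem Computable.list_flatMap {α β σ : Type*} [Primcodable α] [Primcodable β] [Primcodable σ]
    {f : α → List β} {g : α → β → List σ} (hf : Computable f) (hg : Computable₂ g) :
    Computable fun a => (f a).flatMap (g a) := by
  refine (Computable.list_foldl (g := fun _ => []) (h := fun a (p : List σ × β) => p.1 ++ g a p.2)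
    hf (by fun_prop) ?_).of_eq fun a => ?_
  · have : Computable fun q : α × List σ × β => g q.1 q.2.2 := hg.comp (by fun_prop) (by fun_prop)
    exact Computable.comp_append (f := fun q : α × List σ × β => q.2.1) (by fun_prop) this
  · suffices ∀ (l : List β) (acc : List σ),
        l.foldl (fun s b => s ++ g a b) acc = acc ++ l.flatMap (g a) by simpa using this (f a) []
    intro l
    induction l with
    | nil => simp
    | cons b l ih => intro acc; simp [ih]

theorem Literal.holds_relabel_coe {L : FirstOrder.Language.{u, v}} {B : Type*} [L.Structure B]
    {S : L.Substructure B} (φ : Literal L S) :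
    (φ.relabel ((↑) : S → B)).Holds ↔ φ.Holds := by
  have hterm : ∀ t : L.Term S, t.realize ((↑) : S → B) = (t.realize id : S) :=
    fun t => Language.Substructure.realize_term_coe t id
  cases φ with
  | eq t₁ t₂ => rw [holds_relabel_eq, hterm, hterm]; exact Subtype.ext_iff.symm
  | ne t₁ t₂ => rw [holds_relabel_ne, hterm, hterm]; exact not_congr Subtype.ext_iff.symm
  | rel P ts => simp only [holds_relabel_rel, hterm]; exact Iff.rfl
  | notRel P ts => simp only [holds_relabel_notRel, hterm]; exact Iff.rfl

namespace SymbolIndexing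

variable {R Y Z : Type*} [Semiring R]

/-- Code of a token: a name, or the index of a function symbol. -/
def encodeToken (e : Y → List R) : Y ⊕ ℕ → List R
  | .inl y => 0 :: ((e y).length : R) :: e y
  | .inr f => [1, (f : R)]

theorem flatMap_encodeToken_injective [CharZero R] {e : Y → List R} {e' : Z → List R}
    {l : List (Y ⊕ ℕ)} {l' : List (Z ⊕ ℕ)}
    (h : l.flatMap (encodeToken e) = l'.flatMap (encodeToken e')) :
    l.map (Sum.map e id) = l'.map (Sum.map e' id) := by
  induction l generalizing l' with
  | nil =>
    rcases l' with _ | ⟨x | x, l'⟩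
    · rfl
    all_goals simp [encodeToken] at h
  | cons x l ih =>
    rcases l' with _ | ⟨x', l'⟩
    · rcases x with x | x <;> simp [encodeToken] at h
    rcases x with x | x <;> rcases x' with x' | x' <;>
      simp only [encodeToken, List.flatMap_cons, List.cons_append, List.cons.injEq, zero_ne_one,
        one_ne_zero, Nat.cast_inj, true_and, false_and, List.nil_append] at h
    · obtain ⟨h1, h2⟩ := List.append_inj h.2 h.1
      simp [h1, ih h2]
    · simp [h.1, ih h.2]

theorem flatMap_encodeToken_map (e : Z → List R) (g : Y → Z) (l : List (Y ⊕ ℕ)) :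
    (l.map (Sum.map g id)).flatMap (encodeToken e) = l.flatMap (encodeToken (e ∘ g)) := by
  rw [List.flatMap_map]
  congr 1
  funext x
  cases x <;> rfl

/-- One step of the reader of token sequences with names `ℕ`; the second component of the state
holds the entries of an incomplete token. -/
def readStep (s : List (ℕ ⊕ ℕ) × List ℕ) (x : ℕ) : List (ℕ ⊕ ℕ) × List ℕ :=
  bif decide (s.2 = [1]) then (s.1 ++ [.inr x], [])
  else bif decide (s.2 = [0, 1]) then (s.1 ++ [.inl x], []) else (s.1, s.2 ++ [x])

/-- The sequence of tokens with a given code. -/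
def readTokens (w : List ℕ) : List (ℕ ⊕ ℕ) := (w.foldl readStep ([], [])).1

theorem computable_readTokens : Computable readTokens := by
  have h : Computable₂ fun (_ : List ℕ) (p : (List (ℕ ⊕ ℕ) × List ℕ) × ℕ) => readStep p.1 p.2 := by
    have hl : Computable fun x : ℕ => (Sum.inl x : ℕ ⊕ ℕ) := Computable.sumInl
    have hr : Computable fun x : ℕ => (Sum.inr x : ℕ ⊕ ℕ) := Computable.sumInr
    unfold Computable₂ readStep
    fun_prop
  exact Computable.fst.comp (Computable.list_foldl Computable.id (Computable.const ([], [])) h)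

theorem readTokens_flatMap (l : List (ℕ ⊕ ℕ)) :
    readTokens (l.flatMap (encodeToken fun k => [k])) = l := by
  suffices ∀ acc, (l.flatMap (encodeToken fun k => [k])).foldl readStep (acc, []) =
      (acc ++ l, []) by rw [readTokens, this]; rfl
  induction l with
  | nil => simp
  | cons x l ih =>
    intro acc
    rcases x with x | x <;> simp [encodeToken, readStep, ih]

variable {L : FirstOrder.Language.{u, v}} (c : SymbolIndexing L)

/-- The tokens of a term in prefix notation. -/
def termTokens : L.Term Y → List (Y ⊕ ℕ)
  | .var y => [.inl y]
  | .func (l := n) f ts =>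
      .inr (c.funIndex ⟨n, f⟩) :: (List.ofFn fun i => termTokens (ts i)).flatten

/-- The tokens of the terms of a literal. -/
def literalTokens : Literal L Y → List (Y ⊕ ℕ)
  | .eq t₁ t₂ => c.termTokens t₁ ++ c.termTokens t₂
  | .ne t₁ t₂ => c.termTokens t₁ ++ c.termTokens t₂
  | .rel _ ts => (List.ofFn fun i => c.termTokens (ts i)).flatten
  | .notRel _ ts => (List.ofFn fun i => c.termTokens (ts i)).flatten

/-- The part of the code of a literal that precedes the terms. -/
def literalHeader : Literal L Y → List ℕ
  | .eq _ _ => [0]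
  | .ne _ _ => [1]
  | .rel (n := n) P _ => [2, c.relIndex ⟨n, P⟩]
  | .notRel (n := n) P _ => [3, c.relIndex ⟨n, P⟩]

theorem encodeTerm_eq_flatMap (e : Y → List R) (t : L.Term Y) :
    c.encodeTerm e t = (c.termTokens t).flatMap (encodeToken e) := by
  induction t with
  | var y => simp [encodeTerm, termTokens, encodeToken]
  | func f ts ih =>
    simp [encodeTerm, termTokens, encodeToken, ih, List.flatMap, List.map_flatten,
      List.flatten_flatten, List.map_ofFn, Function.comp_def]

theorem encodeLiteral_eq_append (e : Y → List R) (φ : Literal L Y) :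
    c.encodeLiteral e φ =
      (c.literalHeader φ).map (↑) ++ (c.literalTokens φ).flatMap (encodeToken e) := by
  cases φ <;> simp [encodeLiteral, literalHeader, literalTokens, encodeTerm_eq_flatMap,
    List.flatMap, List.map_flatten, List.flatten_flatten, List.map_ofFn, Function.comp_def]

theorem termTokens_relabel (g : Y → Z) (t : L.Term Y) :
    c.termTokens (t.relabel g) = (c.termTokens t).map (Sum.map g id) := by
  induction t with
  | var y => rfl
  | func f ts ih =>
    simp [termTokens, Language.Term.relabel, ih, List.map_flatten, List.map_ofFn,
      Function.comp_def]

theorem literalTokens_relabel (g : Y → Z) (φ : Literal L Y) :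
    c.literalTokens (φ.relabel g) = (c.literalTokens φ).map (Sum.map g id) := by
  cases φ <;> simp [literalTokens, Literal.relabel, termTokens_relabel, List.map_flatten,
    List.map_ofFn, Function.comp_def]

theorem literalHeader_relabel (g : Y → Z) (φ : Literal L Y) :
    c.literalHeader (φ.relabel g) = c.literalHeader φ := by
  cases φ <;> rfl

theorem exists_term_relabel_eq {g : Y → Z} (t : L.Term Z)
    (h : ∀ z, .inl z ∈ c.termTokens t → z ∈ Set.range g) : ∃ t' : L.Term Y, t'.relabel g = t := by
  induction t with
  | var z =>
    obtain ⟨y, rfl⟩ := h z (by simp [termTokens])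
    exact ⟨.var y, rfl⟩
  | func f ts ih =>
    choose ts' hts' using fun i => ih i fun z hz => h z (by
      simp only [termTokens, List.mem_cons, List.mem_flatten, List.mem_ofFn]
      exact .inr ⟨_, ⟨i, rfl⟩, hz⟩)
    exact ⟨.func f ts', congrArg _ (funext hts')⟩

theorem exists_literal_relabel_eq {g : Y → Z} (φ : Literal L Z)
    (h : ∀ z, .inl z ∈ c.literalTokens φ → z ∈ Set.range g) : ∃ φ' : Literal L Y, φ'.relabel g = φ := by
  cases φ with
  | eq t₁ t₂ =>
    obtain ⟨t₁', rfl⟩ := c.exists_term_relabel_eq t₁ fun z hz => h z (List.mem_append_left _ hz)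
    obtain ⟨t₂', rfl⟩ := c.exists_term_relabel_eq t₂ fun z hz => h z (List.mem_append_right _ hz)
    exact ⟨.eq t₁' t₂', rfl⟩
  | ne t₁ t₂ =>
    obtain ⟨t₁', rfl⟩ := c.exists_term_relabel_eq t₁ fun z hz => h z (List.mem_append_left _ hz)
    obtain ⟨t₂', rfl⟩ := c.exists_term_relabel_eq t₂ fun z hz => h z (List.mem_append_right _ hz)
    exact ⟨.ne t₁' t₂', rfl⟩
  | rel P ts =>
    choose ts' hts' using fun i => c.exists_term_relabel_eq (ts i) fun z hz => h z (by
      simp only [literalTokens, List.mem_flatten, List.mem_ofFn]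
      exact ⟨_, ⟨i, rfl⟩, hz⟩)
    exact ⟨.rel P ts', congrArg _ (funext hts')⟩
  | notRel P ts =>
    choose ts' hts' using fun i => c.exists_term_relabel_eq (ts i) fun z hz => h z (by
      simp only [literalTokens, List.mem_flatten, List.mem_ofFn]
      exact ⟨_, ⟨i, rfl⟩, hz⟩)
    exact ⟨.notRel P ts', congrArg _ (funext hts')⟩

/-- Length of the header of a code. -/
def headerLength (w : List ℕ) : ℕ := bif decide (w.headD 0 < 2) then 1 else 2

theorem headerLength_header_append (φ : Literal L Y) (r : List ℕ) :
    headerLength (c.literalHeader φ ++ r) = (c.literalHeader φ).length := by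
  cases φ <;> rfl

/-- Replacement of each name `k` in a code of a literal by `e k`. -/
def translate (e : ℕ → List R) (w : List ℕ) : List R :=
  (w.take (headerLength w)).map (↑) ++
    (readTokens (w.drop (headerLength w))).flatMap (encodeToken e)

theorem translate_encodeLiteral (e : ℕ → List R) (g : Y → ℕ) (φ : Literal L Y) :
    translate e (c.encodeLiteral (fun y => [g y]) φ) = c.encodeLiteral (fun y => e (g y)) φ := by
  have h := flatMap_encodeToken_map (fun k : ℕ => [k]) g (c.literalTokens φ)
  have hcode : c.encodeLiteral (fun y => [g y]) φ = c.literalHeader φ ++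
      ((c.literalTokens φ).map (Sum.map g id)).flatMap (encodeToken fun k => [k]) := by
    rw [h, encodeLiteral_eq_append]
    exact congrArg (· ++ _) (List.map_id _)
  rw [hcode, encodeLiteral_eq_append, translate, headerLength_header_append, List.take_left,
    List.drop_left, readTokens_flatMap, flatMap_encodeToken_map]
  rfl

theorem eq_of_translate_eq [CharZero R] {e : ℕ → List R} {e' : Y → List R} {w : List ℕ}
    {φ : Literal L Y} (h : translate e w = c.encodeLiteral e' φ) :
    w.take (headerLength w) = c.literalHeader φ ∧
      (readTokens (w.drop (headerLength w))).map (Sum.map e id) =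
        (c.literalTokens φ).map (Sum.map e' id) := by
  have key : ∀ {l : List (ℕ ⊕ ℕ)}, l.flatMap (encodeToken e) =
      (c.literalTokens φ).flatMap (encodeToken e') →
        l.map (Sum.map e id) = (c.literalTokens φ).map (Sum.map e' id) :=
    flatMap_encodeToken_injective
  rw [encodeLiteral_eq_append, translate] at h
  have hnil : readTokens [] = [] := rfl
  suffices w.take (headerLength w) = c.literalHeader φ by
    rw [this] at h
    exact ⟨this, key (List.append_cancel_left h)⟩
  have h2 : ∀ a : ℕ, (a : R) = 2 ↔ a = 2 := fun a => by exact_mod_cast Nat.cast_inj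
  have h3 : ∀ a : ℕ, (a : R) = 3 ↔ a = 3 := fun a => by exact_mod_cast Nat.cast_inj
  rcases w with _ | ⟨a, _ | ⟨b, w⟩⟩
  · cases φ <;> simp [headerLength, literalHeader, hnil] at h
  all_goals
    by_cases ha : a < 2 <;> cases φ <;>
      simp [headerLength, literalHeader, ha, hnil, h2, h3] at h ⊢ <;>
        first | exact h.1 | exact ⟨h.1, h.2.1⟩ | exact absurd h.1 (by omega)

variable {A : Set (List ℝ)} [L.Structure A]

/-- Reduction of the atomic diagram of a substructure, the names of whose elements are the natural
numbers `κ s`, to the atomic diagram of the structure. -/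
theorem mem_atomicDiagram_substructure_iff {S : L.Substructure A} {κ : List ℝ → ℕ}
    {e : ℕ → List ℝ} (he : ∀ s : S, e (κ (s : A)) = (s : A))
    (hS : ∀ (a : A) k, e k = a → a ∈ S) (w : List ℕ) :
    w ∈ c.atomicDiagram (fun s : S => [κ (s : A)]) ↔ translate (fun k => [κ (e k)]) w = w ∧
      translate e w ∈ c.atomicDiagram (fun a : A => (a : List ℝ)) := by
  constructor
  · rintro ⟨φ, hφ, rfl⟩
    simp only [translate_encodeLiteral, he, true_and]
    exact ⟨φ.relabel (↑), (Literal.holds_relabel_coe φ).2 hφ, c.encodeLiteral_relabel _ _ φ⟩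
  · rintro ⟨hw, ψ, hψ, h⟩
    obtain ⟨h1, h2⟩ := c.eq_of_translate_eq h.symm
    obtain ⟨φ, rfl⟩ := c.exists_literal_relabel_eq (g := ((↑) : S → A)) ψ fun a ha => by
      have : .inl (a : List ℝ) ∈
          (readTokens (w.drop (headerLength w))).map (Sum.map e id) := by
        rw [h2]
        exact List.mem_map.2 ⟨_, ha, rfl⟩
      obtain ⟨k | k, -, hk⟩ := List.mem_map.1 this
      · exact ⟨⟨a, hS a k (Sum.inl.inj hk)⟩, rfl⟩
      · cases hk
    refine ⟨φ, (Literal.holds_relabel_coe φ).1 hψ, ?_⟩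
    rw [literalHeader_relabel] at h1
    rw [literalTokens_relabel] at h2
    have h3 := congrArg (fun l => (l.map (Sum.map κ id)).flatMap
      (encodeToken fun k : ℕ => [k])) h2
    simp only [List.map_map, Sum.map_comp_map, Function.comp_id, flatMap_encodeToken_map] at h3
    rw [encodeLiteral_eq_append, ← h1]
    exact (congrArg _ h3.symm).trans hw

end SymbolIndexing

/-! ### The effective presentation -/

namespace AlgNumbering

variable (N : AlgNumbering)

/-- The least number that denotes `r`. -/
noncomputable def code (r : ℝ) : ℕ := sInf {k | N.val k = r}

theorem val_code {r : ℝ} (hr : IsAlgebraic ℚ r) : N.val (N.code r) = r :=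
  Nat.sInf_mem (s := {k | N.val k = r}) (N.exists_val_eq r hr)

theorem computable_code_val : Computable fun k => N.code (N.val k) := by
  have h : Partrec fun k => Nat.rfind fun m => (Part.some (N.beq m k) : Part Bool) := by
    refine Partrec.rfind (p := fun k m => Part.some (N.beq m k)) ?_
    exact Computable.partrec (f := fun x : ℕ × ℕ => N.beq x.2 x.1) (by fun_prop)
  refine h.of_eq_tot fun k => Nat.mem_rfind.2 ⟨?_, fun {m} hm => ?_⟩
  · rw [Part.mem_some_iff, eq_comm, beq_iff, N.val_code (N.isAlgebraic_val k)]
  · rw [Part.mem_some_iff, eq_comm, Bool.eq_false_iff, Ne, beq_iff]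
    exact Nat.notMem_of_lt_sInf hm

/-- The list of natural numbers with the code `k`. -/
def natList (k : ℕ) : List ℕ := (Encodable.decode k).getD []

theorem computable_natList : Computable natList :=
  Computable.option_getD Computable.decode (Computable.const [])

/-- A natural number that codes a list of algebraic numbers. -/
noncomputable def listCode (l : List ℝ) : ℕ := Encodable.encode (l.map N.code)

theorem map_val_natList_listCode {l : List ℝ} (hl : ∀ r ∈ l, IsAlgebraic ℚ r) :
    (natList (N.listCode l)).map N.val = l := by
  simp only [natList, listCode, Encodable.encodek, Option.getD_some, List.map_map]
  exact (List.map_congr_left fun r hr => N.val_code (hl r hr)).trans (List.map_id _)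

theorem computable_listCode_natList :
    Computable fun k => N.listCode ((natList k).map N.val) := by
  have h : Computable fun k => Encodable.encode ((natList k).map fun k => N.code (N.val k)) :=
    Computable.encode.comp (Computable.list_map computable_natList
      (N.computable_code_val.comp Computable.snd))
  exact h.of_eq fun k => by simp [listCode, Function.comp_def]

theorem computablePred_of_isRealDecidable {X : Set (List ℝ)}
    (hX : IsRealDecidable {r : ℝ | IsAlgebraic ℚ r} X) :
    ComputablePred fun l : List ℕ => l.map N.val ∈ X := by
  obtain ⟨⟨M, hM, hMX⟩, M', hM', hMX'⟩ := hX
  exact IsSigmaOne.computablePred ((M.isSigmaOne_halts N hM).of_eq fun l => hMX _)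
    ((M'.isSigmaOne_halts N hM').of_eq fun l => hMX' _)

end AlgNumbering

theorem IsRealDecidable.computablePred_natCast {X : Set (List ℝ)}
    (hX : IsRealDecidable {r : ℝ | IsAlgebraic ℚ r} X) :
    ComputablePred fun k : ℕ => [(k : ℝ)] ∈ X := by
  obtain ⟨N⟩ := exists_algNumbering
  have : Computable fun k => [N.ofNat k] := by fun_prop
  simpa using (N.computablePred_of_isRealDecidable hX).comp this

theorem ComputablePred.and_of {α : Type*} [Primcodable α] {p q : α → Prop} (hp : ComputablePred p)
    (hq : ComputablePred q) : ComputablePred fun a => p a ∧ q a := by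
  obtain ⟨f, hf, hfp⟩ := hp.exists_bool
  obtain ⟨g, hg, hgq⟩ := hq.exists_bool
  exact .of_bool (f := fun a => f a && g a) (by fun_prop) fun a => by simp [hfp, hgq]

theorem ComputablePred.or_of {α : Type*} [Primcodable α] {p q : α → Prop} (hp : ComputablePred p)
    (hq : ComputablePred q) : ComputablePred fun a => p a ∨ q a := by
  obtain ⟨f, hf, hfp⟩ := hp.exists_bool
  obtain ⟨g, hg, hgq⟩ := hq.exists_bool
  exact .of_bool (f := fun a => f a || g a) (by fun_prop) fun a => by simp [hfp, hgq]

/-- A function on natural numbers with a computable domain that is computed by a machine with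
algebraic parameters is computable. -/
theorem BSSMachine.exists_computable_of_computes {I : Type*} {M : BSSMachine}
    (hM : M.ParamsIn {r : ℝ | IsAlgebraic ℚ r}) {i a : I → ℕ}
    (hi : ComputablePred fun k => ∃ x, i x = k)
    (h : ∀ x, M.Computes [(i x : ℝ)] [(a x : ℝ)]) :
    ∃ f : ℕ → ℕ, Computable f ∧ ∀ x, f (i x) = a x := by
  have hR : IsSigmaOne fun p : ℕ × ℕ =>
      (¬ ∃ x, i x = p.1) ∨ M.Computes [(p.1 : ℝ)] [(p.2 : ℝ)] :=
    ((IsSigmaOne.of_computablePred hi.not).comp Computable.fst).or (M.isSigmaOne_computes hM)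
  obtain ⟨f, hf, hfR⟩ := IsSigmaOne.exists_computable
    (R := fun k m : ℕ => (¬ ∃ x, i x = k) ∨ M.Computes [(k : ℝ)] [(m : ℝ)]) hR fun k => by
      by_cases hk : ∃ x, i x = k
      · obtain ⟨x, rfl⟩ := hk
        exact ⟨a x, .inr (h x)⟩
      · exact ⟨0, .inl hk⟩
  refine ⟨f, hf, fun x => ?_⟩
  have := M.computes_singleton_unique ((hfR (i x)).resolve_left fun h => h ⟨x, rfl⟩) (h x)
  exact_mod_cast this

namespace SymbolIndexing

variable {L : FirstOrder.Language.{u, v}} {c : SymbolIndexing L}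

theorem IsRealComputableLanguage.isTuringComputableLanguage
    (h : c.IsRealComputableLanguage {r : ℝ | IsAlgebraic ℚ r}) : c.IsTuringComputableLanguage := by
  obtain ⟨hP, hf, hc, ⟨M, hM, hMP⟩, M', hM', hMf⟩ := h
  have hP := hP.computablePred_natCast
  have hf := hf.computablePred_natCast
  have hc := hc.computablePred_natCast
  simp only [Set.mem_ofPred_eq, List.cons.injEq, and_true, Nat.cast_inj,
    eq_comm (a := (_ : ℕ)) (b := c.relIndex _), eq_comm (a := (_ : ℕ)) (b := c.funIndex _)]
    at hP hf hc
  refine ⟨hP, hf, hc, BSSMachine.exists_computable_of_computes hM hP hMP,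
    BSSMachine.exists_computable_of_computes hM' ?_ hMf⟩
  refine (hf.or_of hc).of_eq fun k => ?_
  rw [← exists_or]
  exact exists_congr fun f => by tauto

theorem computable_headerLength : Computable headerLength := by
  have : Computable fun w : List ℕ => bif decide (w.getD 0 0 < 2) then 1 else 2 := by fun_prop
  exact this.of_eq fun w => by cases w <;> rfl

theorem computable_translate {e : ℕ → List ℕ} (he : Computable e) {o : ℕ → ℕ} (ho : Computable o) :
    Computable fun w : List ℕ => (w.take (headerLength w)).map o ++
      (readTokens (w.drop (headerLength w))).flatMap
        (Sum.elim (fun k => o 0 :: o (e k).length :: e k) fun f => [o 1, o f]) := by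
  have htake : Computable fun w : List ℕ => w.take (headerLength w) :=
    Primrec.list_take.to_comp.comp computable_headerLength Computable.id
  have hdrop : Computable fun w : List ℕ => w.drop (headerLength w) :=
    Primrec.list_drop.to_comp.comp computable_headerLength Computable.id
  refine .comp_append (.list_map htake (ho.comp Computable.snd))
    (.list_flatMap (computable_readTokens.comp hdrop) ?_)
  have hl : Computable fun k => o 0 :: o (e k).length :: e k := by fun_prop
  have hr : Computable fun f => [o 1, o f] := by fun_prop
  exact (Computable.sumCasesOn (f := fun x : List ℕ × (ℕ ⊕ ℕ) => x.2) Computable.snd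
    (hl.comp Computable.snd).to₂ (hr.comp Computable.snd).to₂).of_eq fun x => by cases x.2 <;> rfl

theorem map_val_translate (N : AlgNumbering) (e : ℕ → List ℕ) (w : List ℕ) :
    ((w.take (headerLength w)).map N.ofNat ++
      (readTokens (w.drop (headerLength w))).flatMap
        (Sum.elim (fun k => N.ofNat 0 :: N.ofNat (e k).length :: e k)
          fun f => [N.ofNat 1, N.ofNat f])).map N.val = translate (fun k => (e k).map N.val) w := by
  rw [translate, List.map_append, List.map_map, List.map_flatMap]
  congr 2
  · funext k; simp
  · funext x; cases x <;> simp [encodeToken]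

theorem computable_translate_nat {e : ℕ → ℕ} (he : Computable e) :
    Computable fun w => translate (R := ℕ) (fun k => [e k]) w := by
  have : Computable fun k => [e k] := by fun_prop
  refine (computable_translate this Computable.id).of_eq fun w => ?_
  rw [translate]
  congr 2
  funext x; cases x <;> rfl

theorem isTuringComputable_algebraicSubstructure {A : Set (List ℝ)} [L.Structure A]
    (hA : c.IsRealComputable {r : ℝ | IsAlgebraic ℚ r} A) (hc : c.HasHaltingDiagram A) :
    c.IsTuringComputable (c.algebraicSubstructure hc) := by
  obtain ⟨N⟩ := exists_algNumbering
  let S := c.algebraicSubstructure hc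
  have hcode : ∀ s : S, ((AlgNumbering.natList (N.listCode (s : A))).map N.val) = (s : A) :=
    fun s => N.map_val_natList_listCode s.2
  refine ⟨hA.1.isTuringComputableLanguage, fun s => N.listCode (s : A), fun s t h => ?_, ?_⟩
  · have := congrArg (fun k => (AlgNumbering.natList k).map N.val) h
    simp only [hcode] at this
    exact Subtype.ext (Subtype.ext this)
  · have hD := (N.computablePred_of_isRealDecidable hA.2).comp
      (computable_translate AlgNumbering.computable_natList
        (N.comp_ofNat Computable.id))
    simp only [id, map_val_translate] at hD
    have hcheck : ComputablePred fun w =>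
        translate (R := ℕ) (fun k => [N.listCode ((AlgNumbering.natList k).map N.val)]) w = w :=
      .of_bool (f := fun w => decide (translate (R := ℕ)
        (fun k => [N.listCode ((AlgNumbering.natList k).map N.val)]) w = w))
        (.comp_decide_eq (computable_translate_nat N.computable_listCode_natList) .id)
        fun w => by simp
    refine (hcheck.and_of hD).of_eq fun w => ?_
    refine (c.mem_atomicDiagram_substructure_iff (S := S) hcode ?_ w).symm
    intro a k h r hr
    rw [← h] at hr
    obtain ⟨m, -, rfl⟩ := List.mem_map.1 hr
    exact N.isAlgebraic_val m

end SymbolIndexing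

theorem mainTheorem11 {L : FirstOrder.Language.{u, v}} (c : SymbolIndexing L)
    (A : Set (List ℝ)) [L.Structure A]
    (hA : c.IsRealComputable {r : ℝ | IsAlgebraic ℚ r} A) :
    ∃ S : L.Substructure A, LeOne S ∧ c.IsTuringComputable S := by
  have hc : c.HasHaltingDiagram A := hA.2.1
  exact ⟨c.algebraicSubstructure hc, c.leOne_algebraicSubstructure hc,
    SymbolIndexing.isTuringComputable_algebraicSubstructure hA hc⟩
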